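/- **Setting.** Let $f_1,\dots,f_N:\mathbb R^d\to\mathbb R$ be differentiable with $\beta$-Lipschitz gradients ($\beta>0$, $N\ge 1$), and $f=\frac1N\sum_{i=1}^N f_i$. For each client $i$ let $g_i(x)=g_i(x;\zeta_i)$, $\zeta_i\sim P_i$, be an unbiased stochastic gradient: $\mathbb E\,g_i(x)=\nabla f_i(x)$ and $\mathbb E\|g_i(x)-\nabla f_i(x)\|^2\le\sigma^2$ for all $x$. FedAvg with $1\le S\le N$ sampled clients, $K\ge1$ local steps, local and global step-sizes $\eta_l,\eta_g>0$ starts at $x^0$. In round $r=1,2,\dots$ it draws a set $\mathcal S^r$ uniformly among the subsets of $\{1,\dots,N\}$ of size $S$, sets $y^r_{i,0}=x^{r-1}$, $y^r_{i,k}=y^r_{i,k-1}-\eta_l\, g_i(y^r_{i,k-1})$ for $k=1,\dots,K$ (fresh independent samples in every round, client and step), and $x^r=x^{r-1}+\frac{\eta_g}{S}\sum_{i\in\mathcal S^r}(y^r_{i,K}-x^{r-1})$. For weights $w_1,\dots,w_{R+1}\ge0$ that are not all zero, its output $\bar x^R$ after $R$ rounds is $x^{r-1}$ with probability $w_r/\sum_\tau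 w_\tau$, $r\in\{1,\dots,R+1\}$, chosen independently of the run. The clients satisfy $(G,B)$-bounded gradient dissimilarity with $G\ge0$, $B\ge1$: $\frac1N\sum_i\|\nabla f_i(x)\|^2\le G^2+B^2\|\nabla f(x)\|^2$ for all $x$; in the two convex cases below it may be replaced by $\frac1N\sum_i\|\nabla f_i(x)\|^2\le G^2+2\beta B^2(f(x)-f(x^\star))$ for all $x$. For $\mu\ge0$, $f_i$ is called $\mu$-convex if $\langle\nabla f_i(x),y-x\rangle\le-\big(f_i(x)-f_i(y)+\frac\mu2\|x-y\|^2\big)$ for all $x,y$. Let $x^\star$ be a minimizer of $f$ (in the convex cases), $f^\star$ a lower bound of $f$ (in the non-convex case), $D=\|x^0-x^\star\|$, $F=f(x^0)-f^\star$, and $M^2=\sigma^2\big(1+\frac S{\eta_g^2}\big)+K\big(1-\frac SN\big)G^2$. **Theorem.** There is a universal constant $C>0$ such that, in every such setting, the following holds. (I) *Number of rounds.* For every $\varepsilon>0$ and every $\eta_g\ge\sqrt S$ there are a number of rounds $R$, a local step-size $0<\eta_l\le\frac1{(1+B^2)6\beta K\eta_g}$ and weights such that * *Strongly convex* (all $f_i$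 are $\mu$-convex with $\mu>0$): $\mathbb E[f(\bar x^R)]-f(x^\star)\le\varepsilon$ and $$R\le C\Big(1+\log\big(1+\tfrac{\mu D^2}{\varepsilon}\big)\Big)\Big(\frac{\sigma^2}{\mu KS\varepsilon}+\Big(1-\frac SN\Big)\frac{G^2}{\mu S\varepsilon}+\frac{\sqrt\beta\,G}{\mu\sqrt\varepsilon}+\frac{B^2\beta}{\mu}\Big);$$ * *General convex* (all $f_i$ are $0$-convex): $\mathbb E[f(\bar x^R)]-f(x^\star)\le\varepsilon$ and $$R\le C\Big(\frac{\sigma^2D^2}{KS\varepsilon^2}+\Big(1-\frac SN\Big)\frac{G^2D^2}{S\varepsilon^2}+\frac{\sqrt\beta\,GD^2}{\varepsilon^{3/2}}+\frac{B^2\beta D^2}{\varepsilon}\Big);$$ * *Non-convex*: $\mathbb E\|\nabla f(\bar x^R)\|^2\le\varepsilon$ and $$R\le C\Big(\frac{\beta\sigma^2F}{KS\varepsilon^2}+\Big(1-\frac SN\Big)\frac{\beta G^2F}{S\varepsilon^2}+\frac{\beta GF}{\varepsilon^{3/2}}+\frac{B^2\beta F}{\varepsilon}\Big).$$ (II) *Rates.*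 For every $\eta_g\ge1$ and every integer $R$ (with $R\ge\frac{8(1+B^2)\beta}\mu$ in the strongly convex case and $R\ge1$ in the others) there are a local step-size $0<\eta_l\le\frac1{(1+B^2)8\beta K\eta_g}$ and weights such that * *Strongly convex*: with $T_1=\frac{M^2}{\mu RKS}$, $T_2=\frac{\beta G^2}{\mu^2R^2}$ and $L=1+\log\big(1+\frac{\mu D^2}{T_1+T_2}\big)$ ($L=1$ if $T_1+T_2=0$), $$\mathbb E[f(\bar x^R)]-f(x^\star)\le C\Big(L\,T_1+L^2\,T_2+\mu D^2\exp\big(-\tfrac{\mu}{16(1+B^2)\beta}R\big)\Big);$$ * *General convex*: $$\mathbb E[f(\bar x^R)]-f(x^\star)\le C\Big(\frac{MD}{\sqrt{RKS}}+\frac{D^{4/3}(\beta G^2)^{1/3}}{(R+1)^{2/3}}+\frac{B^2\beta D^2}{R}\Big);$$ * *Non-convex*: $$\mathbb E\|\nabla f(\bar x^R)\|^2\le C\Big(\frac{\sqrt\beta\,M\sqrt F}{\sqrt{RKS}}+\frac{F^{2/3}(\beta^2G^2)^{1/3}}{(R+1)^{2/3}}+\frac{B^2\beta F}{R}\Big).$$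 -/

import Mathlib

open MeasureTheory ProbabilityTheory

noncomputable section

namespace FedAvg

/-- The parameter space `ℝ^d` with its Euclidean norm. -/
abbrev Vec (d : ℕ) : Type := EuclideanSpace ℝ (Fin d)

/-- The global objective `f = (1/N) ∑ i, f_i`. -/
def objective {d N : ℕ} (f : Fin N → Vec d → ℝ) (x : Vec d) : ℝ :=
  (1 / (N : ℝ)) * ∑ i, f i x

/-! ### Assumptions on the client functions -/

/-- Every `f_i` is `β`-smooth: differentiable with `β`-Lipschitz gradient. -/
def Smooth {d N : ℕ} (β : ℝ) (f : Fin N → Vec d → ℝ) : Prop :=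
  ∀ i, Differentiable ℝ (f i) ∧
    ∀ x y, ‖gradient (f i) x - gradient (f i) y‖ ≤ β * ‖x - y‖

/-- Every (differentiable) `f_i` is `μ`-convex; `μ = 0` is plain convexity. -/
def MuConvex {d N : ℕ} (μ : ℝ) (f : Fin N → Vec d → ℝ) : Prop :=
  ∀ i x y, inner ℝ (gradient (f i) x) (y - x) ≤ -(f i x - f i y + μ / 2 * ‖x - y‖ ^ 2)

/-- `(G,B)`-bounded gradient dissimilarity. -/
def BoundedDissimilarity {d N : ℕ} (G B : ℝ) (f : Fin N → Vec d → ℝ) : Prop :=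
  ∀ x, (1 / (N : ℝ)) * ∑ i, ‖gradient (f i) x‖ ^ 2
    ≤ G ^ 2 + B ^ 2 * ‖gradient (objective f) x‖ ^ 2

/-- The relaxed form of `(G,B)`-bounded gradient dissimilarity that is used for convex clients;
`fstar` is the minimum of the objective. -/
def RelaxedDissimilarity {d N : ℕ} (β G B fstar : ℝ) (f : Fin N → Vec d → ℝ) : Prop :=
  ∀ x, (1 / (N : ℝ)) * ∑ i, ‖gradient (f i) x‖ ^ 2
    ≤ G ^ 2 + 2 * β * B ^ 2 * (objective f x - fstar)

/-- `g i x ζ`, with `ζ` drawn from `P i`, is an unbiased stochastic gradient of `f i` at `x` with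
variance at most `σ²`. -/
structure StochasticGradient {d N : ℕ} {Z : Type*} [MeasurableSpace Z] (σ : ℝ)
    (f : Fin N → Vec d → ℝ) (P : Fin N → Measure Z) (g : Fin N → Vec d → Z → Vec d) : Prop where
  measurable : ∀ i, Measurable (Function.uncurry (g i))
  memLp_two : ∀ i x, MemLp (g i x) 2 (P i)
  unbiased : ∀ i x, ∫ ζ, g i x ζ ∂(P i) = gradient (f i) x
  variance_le : ∀ i x, ∫ ζ, ‖g i x ζ - gradient (f i) x‖ ^ 2 ∂(P i) ≤ σ ^ 2

/-! ### The algorithm -/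

/-- `localIter g i ηl ζ x k` is the model of client `i` after `k` local steps started at the server
model `x`; the step number `k + 1` uses the sample `ζ k`. -/
def localIter {d N : ℕ} {Z : Type*} (g : Fin N → Vec d → Z → Vec d) (i : Fin N) (ηl : ℝ)
    (ζ : ℕ → Z) (x : Vec d) : ℕ → Vec d
  | 0 => x
  | k + 1 => localIter g i ηl ζ x k - ηl • g i (localIter g i ηl ζ x k) (ζ k)

/-- The randomness of one round: the set of sampled clients, and for every client the sequence of
samples for its stochastic gradients. -/
abbrev Round (N : ℕ) (Z : Type*) : Type _ := Finset (Fin N) × (Fin N → ℕ → Z)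

/-- The law of the randomness of one round: the set of clients is uniform among the sets of
`S` clients (sampling without replacement), the samples of client `i` are i.i.d. with law `P i`,
and everything is independent. -/
def roundLaw {N : ℕ} {Z : Type*} [MeasurableSpace Z] (S : ℕ) (P : Fin N → Measure Z) :
    Measure (Round N Z) :=
  (uniformOn {s : Finset (Fin N) | s.card = S}).prod
    (Measure.pi fun i => Measure.infinitePi fun _ : ℕ => P i)

/-- One round: every sampled client makes `K` local steps, and the server aggregates. -/
def roundStep {d N : ℕ} {Z : Type*} (g : Fin N → Vec d → Z → Vec d) (S K : ℕ) (ηl ηg : ℝ)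
    (x : Vec d) (ξ : Round N Z) : Vec d :=
  x + (ηg / (S : ℝ)) • ∑ i ∈ ξ.1, (localIter g i ηl (ξ.2 i) x K - x)

/-- The server model `x^r` after `r` rounds; round `r + 1` uses the randomness `ω r`. -/
def serverIter {d N : ℕ} {Z : Type*} (g : Fin N → Vec d → Z → Vec d) (S K : ℕ) (ηl ηg : ℝ)
    (x0 : Vec d) (ω : ℕ → Round N Z) : ℕ → Vec d
  | 0 => x0
  | r + 1 => roundStep g S K ηl ηg (serverIter g S K ηl ηg x0 ω r) (ω r)

/-- The law of the randomness of the whole run: independent rounds. -/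
def runLaw {N : ℕ} {Z : Type*} [MeasurableSpace Z] (S : ℕ) (P : Fin N → Measure Z) :
    Measure (ℕ → Round N Z) :=
  Measure.infinitePi fun _ : ℕ => roundLaw S P

/-- The law of the output after `R` rounds with weights `w`: the output is `x^r`, `0 ≤ r ≤ R`, with
probability `w r / ∑ w`, independently of the run. -/
def outputLaw {d N : ℕ} {Z : Type*} [MeasurableSpace Z] (P : Fin N → Measure Z)
    (g : Fin N → Vec d → Z → Vec d) (S K : ℕ) (ηl ηg : ℝ) (x0 : Vec d) (R : ℕ) (w : ℕ → ℝ) :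
    Measure (Vec d) :=
  ∑ r ∈ Finset.range (R + 1),
    ENNReal.ofReal (w r / ∑ t ∈ Finset.range (R + 1), w t) •
      (runLaw S P).map (fun ω => serverIter g S K ηl ηg x0 ω r)

/-- For some weights, the output of `R` rounds of FedAvg with the step-sizes `ηl`, `ηg` satisfies
`E[err (output)] ≤ b` (and the expectation exists). -/
def OutputErrorLE {d N : ℕ} {Z : Type*} [MeasurableSpace Z] (P : Fin N → Measure Z)
    (g : Fin N → Vec d → Z → Vec d) (S K : ℕ) (ηl ηg : ℝ) (x0 : Vec d) (R : ℕ)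
    (err : Vec d → ℝ) (b : ℝ) : Prop :=
  ∃ w : ℕ → ℝ, (∀ r, 0 ≤ w r) ∧ 0 < ∑ r ∈ Finset.range (R + 1), w r ∧
    Integrable err (outputLaw P g S K ηl ηg x0 R w) ∧
    ∫ x, err x ∂(outputLaw P g S K ηl ηg x0 R w) ≤ b

/-- `M² = σ² (1 + S / ηg²) + K (1 - S / N) G²`. -/
def sqM (N S K : ℕ) (σ G ηg : ℝ) : ℝ :=
  σ ^ 2 * (1 + (S : ℝ) / ηg ^ 2) + (K : ℝ) * (1 - (S : ℝ) / (N : ℝ)) * G ^ 2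

end FedAvg

end

/-! Everything is governed by the effective step η = K·ηl·ηg. One round moves the server by −ηg·ηl/S
times a sum over the sampled clients, and each summand is accumulated gradient noise plus K
gradients of f_i taken at the local points instead of at the server model x. Three sources of error
follow. The noise increments of a client are martingale differences and the clients are independent,
so variances add and averaging gains the factor 1/(KS). Sampling without replacement has the
variance of a finite population, proportional to 1 − S/N. Replacing local points by x costs, by
smoothness, the client drift; for small steps the drift inequality absorbs itself, which leaves
order ηl²(Kσ² + K²‖∇f_i(x)‖²) (`sum_integral_sq_drift_le`). The dissimilarity assumption then bounds
the mean of ‖∇f_i(x)‖² by G² plus a multiple of the quantity that is being decreased, and that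
multiple is absorbed because 8(1+B²)βη ≤ 1.

The outcome is a one-round inequality with error η²·O(M²/(KS)) + η³·O(βG²). In the convex cases
(`roundStep_convex`) the potential is ‖x − x⋆‖²; it contracts by 1 − μη/2 and drops by η(f(x) −
f(x⋆)). Convexity is applied at the local points and transported to x at the price of the drift
(`inner_gradient_le_of_convex`). In the non-convex case (`roundStep_nonconvex`) the potential is f −
f⋆ and drops by η‖∇f(x)‖²/4, with one more factor β in both error terms.

Since the server model is independent of the randomness of the next round, the inequality can be
integrated along the run (`descends_of_step`). The recursion telescopes under uniform weights when
there is no contraction, and under the weights (1−a)^{-(r+1)} when there is. What remains is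
deterministic: an initial term, decaying like 1/(ηR) or exp(−μηR/2), is balanced against ηc₁ + η²c₂.
The step η = 1/(b+s+t) does this for both numbers of rounds and for the sublinear rates; the
strongly convex rate uses the smaller of 1/b and 2L/(μR). -/

noncomputable section

namespace FedAvg

set_option linter.unusedSectionVars false

/-! ### Independent pairs and recursively defined processes -/

section Independence

variable {Ω E Z V : Type*} [MeasurableSpace Ω] [MeasurableSpace E] [MeasurableSpace Z]
  {μ : Measure Ω} [IsProbabilityMeasure μ] {X : Ω → E} {Y : Ω → Z}
  [NormedAddCommGroup V] [InnerProductSpace ℝ V]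

lemma map_pair_eq_prod (hX : Measurable X) (hY : Measurable Y) (h : IndepFun X Y μ) :
    μ.map (fun ω => (X ω, Y ω)) = (μ.map X).prod (μ.map Y) :=
  (indepFun_iff_map_prod_eq_prod_map_map hX.aemeasurable hY.aemeasurable).1 h

/-- Conditioning on `X` by Fubini on the product law. Since `φ` is nonnegative and its fibre
integrals are dominated by an integrable function of `X`, joint integrability is a conclusion and
not an assumption; this lets moment bounds propagate along a run by induction. -/
lemma integral_pair_le {φ : E × Z → ℝ} {ψ : E → ℝ} (hX : Measurable X) (hY : Measurable Y)
    (h : IndepFun X Y μ) (hφ : Measurable φ) (hφ0 : ∀ p, 0 ≤ φ p)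
    (hint : ∀ x, Integrable (fun z => φ (x, z)) (μ.map Y))
    (hle : ∀ x, ∫ z, φ (x, z) ∂(μ.map Y) ≤ ψ x) (hψm : Measurable ψ)
    (hψ : Integrable (fun ω => ψ (X ω)) μ) :
    Integrable (fun ω => φ (X ω, Y ω)) μ ∧ ∫ ω, φ (X ω, Y ω) ∂μ ≤ ∫ ω, ψ (X ω) ∂μ := by
  have hXY : Measurable fun ω => (X ω, Y ω) := hX.prodMk hY
  have : IsProbabilityMeasure (μ.map X) := Measure.isProbabilityMeasure_map hX.aemeasurable
  have : IsProbabilityMeasure (μ.map Y) := Measure.isProbabilityMeasure_map hY.aemeasurable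
  have hψ' : Integrable ψ (μ.map X) :=
    (integrable_map_measure hψm.aestronglyMeasurable hX.aemeasurable).2 hψ
  have hnn : ∀ x, 0 ≤ ∫ z, φ (x, z) ∂(μ.map Y) := fun x => integral_nonneg fun z => hφ0 _
  have hsec : Integrable (fun x => ∫ z, φ (x, z) ∂(μ.map Y)) (μ.map X) := by
    refine hψ'.mono' ?_ (Filter.Eventually.of_forall fun x => ?_)
    · exact hφ.stronglyMeasurable.integral_prod_right'.aestronglyMeasurable
    · rw [Real.norm_of_nonneg (hnn x)]; exact hle x
  have hprod : Integrable φ ((μ.map X).prod (μ.map Y)) := by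
    rw [integrable_prod_iff hφ.aestronglyMeasurable]
    refine ⟨Filter.Eventually.of_forall hint, ?_⟩
    simpa only [Real.norm_of_nonneg (hφ0 _)] using hsec
  have hprod' := hprod
  rw [← map_pair_eq_prod hX hY h] at hprod'
  refine ⟨(integrable_map_measure hφ.aestronglyMeasurable hXY.aemeasurable).1 hprod', ?_⟩
  have h1 : ∫ ω, φ (X ω, Y ω) ∂μ = ∫ p, φ p ∂(μ.map fun ω => (X ω, Y ω)) :=
    (integral_map hXY.aemeasurable hφ.aestronglyMeasurable).symm
  rw [h1, map_pair_eq_prod hX hY h, integral_prod _ hprod,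
    ← integral_map (f := ψ) hX.aemeasurable hψm.aestronglyMeasurable]
  exact integral_mono hsec hψ' hle

lemma integral_pair_eq_zero [CompleteSpace V] [MeasurableSpace V] [BorelSpace V]
    [SecondCountableTopology V] {φ : E × Z → V}
    (hX : Measurable X) (hY : Measurable Y) (h : IndepFun X Y μ) (hφ : Measurable φ)
    (hint : Integrable (fun ω => φ (X ω, Y ω)) μ)
    (hz : ∀ x, ∫ z, φ (x, z) ∂(μ.map Y) = 0) : ∫ ω, φ (X ω, Y ω) ∂μ = 0 := by
  have hXY : Measurable fun ω => (X ω, Y ω) := hX.prodMk hY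
  have : IsProbabilityMeasure (μ.map X) := Measure.isProbabilityMeasure_map hX.aemeasurable
  have : IsProbabilityMeasure (μ.map Y) := Measure.isProbabilityMeasure_map hY.aemeasurable
  have h2 : Integrable φ ((μ.map X).prod (μ.map Y)) := by
    rw [← map_pair_eq_prod hX hY h]
    exact (integrable_map_measure hφ.aestronglyMeasurable hXY.aemeasurable).2 hint
  have h1 : ∫ ω, φ (X ω, Y ω) ∂μ = ∫ p, φ p ∂(μ.map fun ω => (X ω, Y ω)) :=
    (integral_map hXY.aemeasurable hφ.aestronglyMeasurable).symm
  rw [h1, map_pair_eq_prod hX hY h, integral_prod _ h2]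
  simp [hz]

lemma integrable_sq_norm_of_memLp {f : Ω → V} (hf : MemLp f 2 μ) :
    Integrable (fun ω => ‖f ω‖ ^ 2) μ :=
  (memLp_two_iff_integrable_sq_norm hf.1).1 hf

lemma integrable_inner_of_memLp {f g : Ω → V} (hf : MemLp f 2 μ) (hg : MemLp g 2 μ) :
    Integrable (fun ω => inner ℝ (f ω) (g ω)) μ := by
  refine ((integrable_sq_norm_of_memLp hf).add (integrable_sq_norm_of_memLp hg)).mono'
    (hf.1.inner hg.1) (Filter.Eventually.of_forall fun ω => ?_)
  have h1 := abs_real_inner_le_norm (f ω) (g ω)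
  simp only [Real.norm_eq_abs, Pi.add_apply]
  nlinarith [sq_nonneg (‖f ω‖ - ‖g ω‖), norm_nonneg (f ω), norm_nonneg (g ω)]

/-- If the conditional mean of `W (X, Y)` given `X` vanishes, it is orthogonal to `U X`. -/
lemma integral_inner_pair_eq_zero [CompleteSpace V] [MeasurableSpace V] [BorelSpace V]
    [SecondCountableTopology V] {U : E → V} {W : E × Z → V}
    (hX : Measurable X) (hY : Measurable Y) (h : IndepFun X Y μ) (hU : Measurable U)
    (hW : Measurable W) (hU2 : MemLp (fun ω => U (X ω)) 2 μ)
    (hW2 : MemLp (fun ω => W (X ω, Y ω)) 2 μ)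
    (hWi : ∀ x, Integrable (fun z => W (x, z)) (μ.map Y))
    (hz : ∀ x, ∫ z, W (x, z) ∂(μ.map Y) = 0) :
    ∫ ω, inner ℝ (U (X ω)) (W (X ω, Y ω)) ∂μ = 0 := by
  refine integral_pair_eq_zero (φ := fun p : E × Z => inner ℝ (U p.1) (W p)) hX hY h
    ((hU.comp measurable_fst).inner hW) (integrable_inner_of_memLp hU2 hW2) fun x => ?_
  simp only
  rw [integral_inner (hWi x), hz x, inner_zero_right]

end Independence

section Orbit

variable {E Z : Type*}

/-- The process driven by the noise sequence `ω`. -/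
def orbit (T : E → Z → E) (x0 : E) (ω : ℕ → Z) : ℕ → E
  | 0 => x0
  | n + 1 => T (orbit T x0 ω n) (ω n)

lemma orbit_congr (T : E → Z → E) (x0 : E) {ω ω' : ℕ → Z} (n : ℕ) (h : ∀ k < n, ω k = ω' k) :
    orbit T x0 ω n = orbit T x0 ω' n := by
  induction n with
  | zero => rfl
  | succ n ih => simp only [orbit]; rw [ih fun k hk => h k (by omega), h n (by omega)]

variable [MeasurableSpace E] [MeasurableSpace Z]

lemma measurable_orbit {T : E → Z → E} (hT : Measurable (Function.uncurry T)) (x0 : E) (n : ℕ) :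
    Measurable fun ω : ℕ → Z => orbit T x0 ω n := by
  induction n with
  | zero => exact measurable_const
  | succ n ih => exact hT.comp (ih.prodMk (measurable_pi_apply n))

/-- The state at time `n` is a function of the coordinates below `n` (`orbit_congr`), and these are
independent of coordinate `n`. -/
lemma indepFun_orbit (P : Measure Z) [IsProbabilityMeasure P] {T : E → Z → E}
    (hT : Measurable (Function.uncurry T)) (x0 : E) (n : ℕ) :
    IndepFun (fun ω : ℕ → Z => orbit T x0 ω n) (fun ω => ω n)
      (Measure.infinitePi fun _ : ℕ => P) := by
  have : Nonempty Z := P.nonempty_of_neZero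
  have hi : iIndepFun (fun (i : ℕ) (ω : ℕ → Z) => ω i) (Measure.infinitePi fun _ : ℕ => P) :=
    iIndepFun_infinitePi (X := fun _ z => z) fun _ => measurable_id
  have h := hi.indepFun_finset (Finset.range n) {n} (by simp) fun i => measurable_pi_apply i
  -- Any extension of the finite tuple to a full sequence would do, because the orbit up to time `n`
  -- does not see the filler values.
  let ext : (Finset.range n → Z) → ℕ → Z := fun p k =>
    if hk : k ∈ Finset.range n then p ⟨k, hk⟩ else Classical.arbitrary Z
  have hext : Measurable ext := by
    refine measurable_pi_lambda _ fun k => ?_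
    by_cases hk : k ∈ Finset.range n
    · simp only [ext, hk, dite_true]; exact measurable_pi_apply _
    · simp only [ext, hk, dite_false]; exact measurable_const
  have h2 := h.comp ((measurable_orbit hT x0 n).comp hext)
    (measurable_pi_apply (⟨n, by simp⟩ : ({n} : Finset ℕ)))
  have he : (fun ω : ℕ → Z => orbit T x0 ω n) =
      ((fun ω => orbit T x0 ω n) ∘ ext) ∘ fun ω (i : Finset.range n) => ω i := by
    funext ω
    refine orbit_congr T x0 n fun k hk => ?_
    simp [ext, hk]
  rw [he]
  exact h2

end Orbit

/-! ### Local steps of one client -/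

section Client

variable {V Z : Type*} [NormedAddCommGroup V] [InnerProductSpace ℝ V] [CompleteSpace V]
  [MeasurableSpace V] [BorelSpace V] [SecondCountableTopology V] [MeasurableSpace Z]

/-- `h x ζ`, `ζ ∼ P`, is an unbiased estimate of `m x` with variance at most `σ²`, and `m` is
`β`-Lipschitz. -/
structure IsOracle (β σ : ℝ) (P : Measure Z) (h : V → Z → V) (m : V → V) : Prop where
  measurable : Measurable (Function.uncurry h)
  memLp_two : ∀ x, MemLp (h x) 2 P
  unbiased : ∀ x, ∫ ζ, h x ζ ∂P = m x
  variance_le : ∀ x, ∫ ζ, ‖h x ζ - m x‖ ^ 2 ∂P ≤ σ ^ 2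
  lipschitz : ∀ x y, ‖m x - m y‖ ≤ β * ‖x - y‖

/-- One stochastic step, acting on the current point and the accumulated noise. -/
def noisyStep (h : V → Z → V) (m : V → V) (η : ℝ) (p : V × V) (ζ : Z) : V × V :=
  (p.1 - η • h p.1 ζ, p.2 + (h p.1 ζ - m p.1))

/-- The point after `k` local steps. -/
def localPoint (h : V → Z → V) (m : V → V) (η : ℝ) (x : V) (k : ℕ) (ζ : ℕ → Z) : V :=
  (orbit (noisyStep h m η) (x, 0) ζ k).1

/-- The noise accumulated in `k` local steps. -/
def localNoise (h : V → Z → V) (m : V → V) (η : ℝ) (x : V) (k : ℕ) (ζ : ℕ → Z) : V :=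
  (orbit (noisyStep h m η) (x, 0) ζ k).2

variable {β σ η : ℝ} {P : Measure Z} [IsProbabilityMeasure P] {h : V → Z → V} {m : V → V}

/-- Unrolling the recursion for each sample sequence separates the centred noise, treated by
orthogonality, from the mean gradients, treated by smoothness. -/
lemma localPoint_eq (x : V) (k : ℕ) (ζ : ℕ → Z) :
    localPoint h m η x k ζ =
      x - η • (localNoise h m η x k ζ + ∑ j ∈ Finset.range k, m (localPoint h m η x j ζ)) := by
  induction k with
  | zero => simp [localPoint, localNoise, orbit]
  | succ k ih =>
    have h1 : localPoint h m η x (k + 1) ζ = localPoint h m η x k ζ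
        - η • h (localPoint h m η x k ζ) (ζ k) := rfl
    have h2 : localNoise h m η x (k + 1) ζ = localNoise h m η x k ζ
        + (h (localPoint h m η x k ζ) (ζ k) - m (localPoint h m η x k ζ)) := rfl
    rw [Finset.sum_range_succ, h1, h2]
    nth_rw 1 [ih]
    module

namespace IsOracle

lemma measurable_mean (ho : IsOracle β σ P h m) : Measurable m :=
  (LipschitzWith.of_dist_le' (f := m) (K := β) fun x y => by
    simpa [dist_eq_norm] using ho.lipschitz x y).continuous.measurable

lemma measurable_step (ho : IsOracle β σ P h m) :
    Measurable (Function.uncurry (noisyStep h m η)) := by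
  have h1 : Measurable fun p : (V × V) × Z => h p.1.1 p.2 :=
    ho.measurable.comp ((measurable_fst.comp measurable_fst).prodMk measurable_snd)
  have h2 : Measurable fun p : (V × V) × Z => p.1.1 := measurable_fst.comp measurable_fst
  have h3 : Measurable fun p : (V × V) × Z => p.1.2 := measurable_snd.comp measurable_fst
  exact (h2.sub (h1.const_smul η)).prodMk (h3.add (h1.sub (ho.measurable_mean.comp h2)))

lemma measurable_localPoint (ho : IsOracle β σ P h m) (x : V) (k : ℕ) :
    Measurable (localPoint h m η x k) :=
  measurable_fst.comp (measurable_orbit ho.measurable_step _ k)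

lemma measurable_localNoise (ho : IsOracle β σ P h m) (x : V) (k : ℕ) :
    Measurable (localNoise h m η x k) :=
  measurable_snd.comp (measurable_orbit ho.measurable_step _ k)

lemma measurable_deviation (ho : IsOracle β σ P h m) :
    Measurable fun p : (V × V) × Z => h p.1.1 p.2 - m p.1.1 :=
  (ho.measurable.comp ((measurable_fst.comp measurable_fst).prodMk measurable_snd)).sub
    (ho.measurable_mean.comp (measurable_fst.comp measurable_fst))

lemma memLp_deviation (ho : IsOracle β σ P h m) (x : V) : MemLp (fun z => h x z - m x) 2 P :=
  (ho.memLp_two x).sub (memLp_const _)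

lemma integral_deviation (ho : IsOracle β σ P h m) (x : V) : ∫ z, (h x z - m x) ∂P = 0 := by
  rw [integral_sub ((ho.memLp_two x).integrable (by norm_num)) (integrable_const _)]
  simp [ho.unbiased x]

/-- The current point is independent of the fresh sample, so the variance bound, which is uniform in
the point, passes to the random point. -/
lemma step_deviation (ho : IsOracle β σ P h m) (x : V) (k : ℕ) :
    MemLp (fun ζ : ℕ → Z => h (localPoint h m η x k ζ) (ζ k) - m (localPoint h m η x k ζ)) 2
      (Measure.infinitePi fun _ : ℕ => P) ∧
    ∫ ζ, ‖h (localPoint h m η x k ζ) (ζ k) - m (localPoint h m η x k ζ)‖ ^ 2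
      ∂(Measure.infinitePi fun _ : ℕ => P) ≤ σ ^ 2 := by
  have hX := measurable_orbit (ho.measurable_step (η := η)) (x, (0 : V)) k
  have key := integral_pair_le (φ := fun p : (V × V) × Z => ‖h p.1.1 p.2 - m p.1.1‖ ^ 2)
    (ψ := fun _ => σ ^ 2) hX (measurable_pi_apply k)
    (indepFun_orbit P ho.measurable_step (x, 0) k)
    (ho.measurable_deviation.norm.pow_const 2) (fun p => by positivity)
    (fun p => by
      rw [Measure.infinitePi_map_eval]
      exact integrable_sq_norm_of_memLp (ho.memLp_deviation p.1))
    (fun p => by rw [Measure.infinitePi_map_eval]; exact ho.variance_le p.1)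
    measurable_const (integrable_const _)
  refine ⟨(memLp_two_iff_integrable_sq_norm ?_).2 key.1,
    key.2.trans (by simp)⟩
  exact (ho.measurable_deviation.comp (hX.prodMk (measurable_pi_apply k))).aestronglyMeasurable

lemma memLp_mean_sub (ho : IsOracle β σ P h m) {Ω : Type*} [MeasurableSpace Ω] {ν : Measure Ω}
    [IsFiniteMeasure ν] {Y : Ω → V} (hYm : Measurable Y) (hY : MemLp Y 2 ν) (x : V) :
    MemLp (fun ω => m (Y ω) - m x) 2 ν := by
  refine MemLp.of_le_mul (c := β) (hY.sub (memLp_const x)) ?_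
    (Filter.Eventually.of_forall fun ω => ho.lipschitz _ _)
  exact ((ho.measurable_mean.comp hYm).sub_const _).aestronglyMeasurable

lemma memLp_mean (ho : IsOracle β σ P h m) {Ω : Type*} [MeasurableSpace Ω] {ν : Measure Ω}
    [IsFiniteMeasure ν] {Y : Ω → V} (hYm : Measurable Y) (hY : MemLp Y 2 ν) :
    MemLp (fun ω => m (Y ω)) 2 ν := by
  have := (ho.memLp_mean_sub hYm hY 0).add (memLp_const (m 0))
  simpa [Pi.add_def] using this

lemma memLp_local (ho : IsOracle β σ P h m) (x : V) (k : ℕ) :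
    MemLp (localPoint h m η x k) 2 (Measure.infinitePi fun _ : ℕ => P) ∧
    MemLp (localNoise h m η x k) 2 (Measure.infinitePi fun _ : ℕ => P) := by
  induction k with
  | zero =>
    exact ⟨memLp_const x, memLp_const (0 : V)⟩
  | succ k ih =>
    have hd := (ho.step_deviation (η := η) x k).1
    have hm := ho.memLp_mean (ho.measurable_localPoint (η := η) x k) ih.1
    refine ⟨?_, ih.2.add hd⟩
    have h2 := ih.1.sub ((hd.add hm).const_smul η)
    refine (memLp_congr_ae (Filter.Eventually.of_forall fun ζ => ?_)).1 h2
    simp only [localPoint, orbit, noisyStep, Pi.sub_apply, Pi.add_apply, Pi.smul_apply,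
      sub_add_cancel]

lemma integral_localNoise (ho : IsOracle β σ P h m) (x : V) (k : ℕ) :
    ∫ ζ, localNoise h m η x k ζ ∂(Measure.infinitePi fun _ : ℕ => P) = 0 := by
  induction k with
  | zero => simp [localNoise, orbit]
  | succ k ih =>
    have hd := (ho.step_deviation (η := η) x k).1.integrable (by norm_num)
    have hM := (ho.memLp_local (η := η) x k).2.integrable (by norm_num)
    have h0 := integral_pair_eq_zero (φ := fun p : (V × V) × Z => h p.1.1 p.2 - m p.1.1)
      (measurable_orbit (ho.measurable_step (η := η)) (x, (0 : V)) k) (measurable_pi_apply k)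
      (indepFun_orbit P ho.measurable_step (x, 0) k) ho.measurable_deviation hd
      (fun p => by rw [Measure.infinitePi_map_eval]; exact ho.integral_deviation p.1)
    have h1 := integral_add hM hd
    rw [ih, zero_add] at h1
    exact h1.trans h0

/-- Martingale orthogonality. The accumulated noise is a component of the state, hence determined by
earlier samples, and the new increment has conditional mean zero; the cross term vanishes and each
step adds at most σ². -/
lemma integral_sq_localNoise_le (ho : IsOracle β σ P h m) (x : V) (k : ℕ) :
    ∫ ζ, ‖localNoise h m η x k ζ‖ ^ 2 ∂(Measure.infinitePi fun _ : ℕ => P) ≤ k * σ ^ 2 := by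
  induction k with
  | zero => simp [localNoise, orbit]
  | succ k ih =>
    obtain ⟨hd, hd2⟩ := ho.step_deviation (η := η) x k
    have hM := (ho.memLp_local (η := η) x k).2
    have h0 := integral_inner_pair_eq_zero (U := fun p : V × V => p.2)
      (W := fun p : (V × V) × Z => h p.1.1 p.2 - m p.1.1)
      (measurable_orbit (ho.measurable_step (η := η)) (x, (0 : V)) k) (measurable_pi_apply k)
      (indepFun_orbit P ho.measurable_step (x, 0) k) measurable_snd ho.measurable_deviation
      hM hd
      (fun p => by
        rw [Measure.infinitePi_map_eval]
        exact (ho.memLp_deviation p.1).integrable (by norm_num))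
      (fun p => by rw [Measure.infinitePi_map_eval]; exact ho.integral_deviation p.1)
    have hexp : ∀ ζ, ‖localNoise h m η x (k + 1) ζ‖ ^ 2 = ‖localNoise h m η x k ζ‖ ^ 2
        + 2 * inner ℝ (localNoise h m η x k ζ)
          (h (localPoint h m η x k ζ) (ζ k) - m (localPoint h m η x k ζ))
        + ‖h (localPoint h m η x k ζ) (ζ k) - m (localPoint h m η x k ζ)‖ ^ 2 := fun ζ =>
      norm_add_sq_real _ _
    simp only [hexp]
    have hi : Integrable (fun ζ => ‖localNoise h m η x k ζ‖ ^ 2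
        + 2 * inner ℝ (localNoise h m η x k ζ)
          (h (localPoint h m η x k ζ) (ζ k) - m (localPoint h m η x k ζ)))
        (Measure.infinitePi fun _ : ℕ => P) :=
      (integrable_sq_norm_of_memLp hM).add ((integrable_inner_of_memLp hM hd).const_mul 2)
    rw [integral_add hi (integrable_sq_norm_of_memLp hd),
      integral_add (integrable_sq_norm_of_memLp hM) ((integrable_inner_of_memLp hM hd).const_mul 2),
      integral_const_mul]
    have h0' : ∫ ζ, inner ℝ (localNoise h m η x k ζ)
          (h (localPoint h m η x k ζ) (ζ k) - m (localPoint h m η x k ζ))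
          ∂(Measure.infinitePi fun _ : ℕ => P) = 0 := h0
    rw [h0']
    push_cast
    linarith

end IsOracle

lemma norm_sum_sq_le {ι : Type*} (s : Finset ι) (v : ι → V) :
    ‖∑ i ∈ s, v i‖ ^ 2 ≤ s.card * ∑ i ∈ s, ‖v i‖ ^ 2 :=
  (pow_le_pow_left₀ (norm_nonneg _) (norm_sum_le s v) 2).trans sq_sum_le_card_mul_sum_sq

lemma norm_add_sq_le (a b : V) : ‖a + b‖ ^ 2 ≤ 2 * ‖a‖ ^ 2 + 2 * ‖b‖ ^ 2 := by
  have := pow_le_pow_left₀ (norm_nonneg _) (norm_add_le a b) 2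
  nlinarith [sq_nonneg (‖a‖ - ‖b‖)]

namespace IsOracle

/-- A pathwise bound. The sum over the steps before `k` is enlarged to all `K` steps so that the
drift part on the right does not depend on `k`; after summation the inequality then bounds the total
drift by a small multiple of itself. -/
lemma sq_norm_localPoint_sub_le (ho : IsOracle β σ P h m) (x : V) {k K : ℕ} (hk : k ≤ K)
    (ζ : ℕ → Z) :
    ‖localPoint h m η x k ζ - x‖ ^ 2 ≤ 2 * η ^ 2 * ‖localNoise h m η x k ζ‖ ^ 2
      + 4 * η ^ 2 * K * (β ^ 2 * ∑ j ∈ Finset.range K, ‖localPoint h m η x j ζ - x‖ ^ 2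
        + K * ‖m x‖ ^ 2) := by
  have h1 : localPoint h m η x k ζ - x =
      -(η • (localNoise h m η x k ζ + ∑ j ∈ Finset.range k, m (localPoint h m η x j ζ))) := by
    nth_rw 1 [localPoint_eq]; abel
  have h2 : ‖∑ j ∈ Finset.range k, m (localPoint h m η x j ζ)‖ ^ 2 ≤
      K * (2 * (β ^ 2 * ∑ j ∈ Finset.range K, ‖localPoint h m η x j ζ - x‖ ^ 2
        + K * ‖m x‖ ^ 2)) := by
    refine (norm_sum_sq_le _ _).trans ?_
    have hb : ∀ j, ‖m (localPoint h m η x j ζ)‖ ^ 2 ≤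
        2 * (β ^ 2 * ‖localPoint h m η x j ζ - x‖ ^ 2) + 2 * ‖m x‖ ^ 2 := fun j => by
      have h3 := norm_add_sq_le (m (localPoint h m η x j ζ) - m x) (m x)
      rw [sub_add_cancel] at h3
      have h4 := pow_le_pow_left₀ (norm_nonneg _) (ho.lipschitz (localPoint h m η x j ζ) x) 2
      rw [mul_pow] at h4
      linarith
    have h5 : ∑ j ∈ Finset.range k, ‖m (localPoint h m η x j ζ)‖ ^ 2 ≤
        ∑ j ∈ Finset.range K,
          (2 * (β ^ 2 * ‖localPoint h m η x j ζ - x‖ ^ 2) + 2 * ‖m x‖ ^ 2) :=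
      (Finset.sum_le_sum_of_subset_of_nonneg (Finset.range_subset_range.2 hk)
        fun _ _ _ => by positivity).trans (Finset.sum_le_sum fun j _ => hb j)
    have h6 : (k : ℝ) ≤ K := by exact_mod_cast hk
    rw [Finset.card_range]
    refine (mul_le_mul h6 h5 (Finset.sum_nonneg fun _ _ => by positivity) (by positivity)).trans ?_
    rw [Finset.sum_add_distrib, ← Finset.mul_sum, ← Finset.mul_sum, Finset.sum_const,
      Finset.card_range, nsmul_eq_mul]
    apply le_of_eq; ring
  rw [h1, norm_neg, norm_smul, mul_pow, Real.norm_eq_abs, sq_abs]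
  have h7 := norm_add_sq_le (localNoise h m η x k ζ)
    (∑ j ∈ Finset.range k, m (localPoint h m η x j ζ))
  nlinarith [mul_le_mul_of_nonneg_left (h7.trans (add_le_add_right
    (mul_le_mul_of_nonneg_left h2 (by norm_num : (0 : ℝ) ≤ 2)) _)) (sq_nonneg η)]

lemma integrable_sq_drift (ho : IsOracle β σ P h m) (x : V) (k : ℕ) :
    Integrable (fun ζ => ‖localPoint h m η x k ζ - x‖ ^ 2)
      (Measure.infinitePi fun _ : ℕ => P) :=
  integrable_sq_norm_of_memLp ((ho.memLp_local x k).1.sub (memLp_const x))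

/-- The client drift: the local points stay close to the starting point. -/
lemma sum_integral_sq_drift_le (ho : IsOracle β σ P h m) (x : V) (K : ℕ)
    (hη : (η * β * K) ^ 2 ≤ 1 / 256) :
    ∑ k ∈ Finset.range K,
      ∫ ζ, ‖localPoint h m η x k ζ - x‖ ^ 2 ∂(Measure.infinitePi fun _ : ℕ => P) ≤
      K * (3 * η ^ 2 * K * σ ^ 2 + 5 * η ^ 2 * K ^ 2 * ‖m x‖ ^ 2) := by
  set e : ℕ → ℝ := fun k =>
    ∫ ζ, ‖localPoint h m η x k ζ - x‖ ^ 2 ∂(Measure.infinitePi fun _ : ℕ => P) with he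
  have hstep : ∀ k ∈ Finset.range K, e k ≤ 2 * η ^ 2 * (K * σ ^ 2)
      + 4 * η ^ 2 * K * (β ^ 2 * ∑ j ∈ Finset.range K, e j + K * ‖m x‖ ^ 2) := by
    intro k hk
    have hkK : k ≤ K := (Finset.mem_range.1 hk).le
    have hi1 : Integrable (fun ζ => 2 * η ^ 2 * ‖localNoise h m η x k ζ‖ ^ 2)
        (Measure.infinitePi fun _ : ℕ => P) :=
      (integrable_sq_norm_of_memLp (ho.memLp_local x k).2).const_mul _
    have hi2 : Integrable (fun ζ => β ^ 2 * ∑ j ∈ Finset.range K, ‖localPoint h m η x j ζ - x‖ ^ 2)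
        (Measure.infinitePi fun _ : ℕ => P) :=
      (integrable_finsetSum _ fun j _ => ho.integrable_sq_drift x j).const_mul _
    have hi3 : Integrable (fun ζ => 4 * η ^ 2 * K *
        (β ^ 2 * ∑ j ∈ Finset.range K, ‖localPoint h m η x j ζ - x‖ ^ 2 + K * ‖m x‖ ^ 2))
        (Measure.infinitePi fun _ : ℕ => P) :=
      (hi2.add (integrable_const (K * ‖m x‖ ^ 2))).const_mul (4 * η ^ 2 * K)
    have := integral_mono (ho.integrable_sq_drift (η := η) x k) (hi1.add hi3)
      fun ζ => ho.sq_norm_localPoint_sub_le x hkK ζ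
    refine this.trans ?_
    simp only [Pi.add_apply]
    rw [integral_add hi1 hi3, integral_const_mul, integral_const_mul,
      integral_add hi2 (integrable_const _), integral_const_mul,
      integral_finsetSum _ fun j _ => ho.integrable_sq_drift x j]
    have h1 := ho.integral_sq_localNoise_le (η := η) x k
    have h2 : (k : ℝ) * σ ^ 2 ≤ K * σ ^ 2 := by gcongr
    simp only [integral_const, probReal_univ, one_smul]
    gcongr
    exact h1.trans h2
  have hsum := Finset.sum_le_sum hstep
  rw [Finset.sum_const, Finset.card_range, nsmul_eq_mul] at hsum
  have he0 : 0 ≤ ∑ j ∈ Finset.range K, e j :=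
    Finset.sum_nonneg fun j _ => integral_nonneg fun ζ => by positivity
  have h1 : 0 ≤ K * (η ^ 2 * K * σ ^ 2) := by positivity
  have h2 : 0 ≤ K * (η ^ 2 * K ^ 2 * ‖m x‖ ^ 2) := by positivity
  -- The total drift reappears on the right with the coefficient 4(ηβK)² ≤ 1/64. Absorbing it
  -- multiplies the constants 2 and 4 by 64/63, which stays below 3 and 5.
  nlinarith [mul_le_mul_of_nonneg_right hη he0]

end IsOracle

end Client

/-! ### Smooth functions -/

section Smoothness

variable {V : Type*} [NormedAddCommGroup V] [InnerProductSpace ℝ V] [CompleteSpace V]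
  {β μ : ℝ} {φ : V → ℝ}

/-- The quadratic upper bound for a function with Lipschitz gradient. -/
lemma le_quadratic (hd : Differentiable ℝ φ)
    (hL : ∀ x y, ‖gradient φ x - gradient φ y‖ ≤ β * ‖x - y‖) (x y : V) :
    φ y ≤ φ x + inner ℝ (gradient φ x) (y - x) + β / 2 * ‖y - x‖ ^ 2 := by
  set v := y - x with hv
  -- The function along the segment minus the claimed bound, up to a constant. Its derivative is at
  -- most 0 on [0,1] by Cauchy–Schwarz and the Lipschitz gradient, so comparing the endpoints gives
  -- the claim.
  let ψ : ℝ → ℝ := fun t => φ (x + t • v) - t * inner ℝ (gradient φ x) v - β / 2 * ‖v‖ ^ 2 * t ^ 2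
  have hder : ∀ t, HasDerivAt ψ (inner ℝ (gradient φ (x + t • v)) v
      - inner ℝ (gradient φ x) v - β / 2 * ‖v‖ ^ 2 * (2 * t)) t := by
    intro t
    have h1 : HasDerivAt (fun t : ℝ => x + t • v) v t := by
      simpa using ((hasDerivAt_id t).smul_const v).const_add x
    have h2 := (hd (x + t • v)).hasGradientAt.hasFDerivAt.comp_hasDerivAt t h1
    have h3 : HasDerivAt (fun t : ℝ => t * inner ℝ (gradient φ x) v)
        (inner ℝ (gradient φ x) v) t := by
      simpa using (hasDerivAt_id t).mul_const (inner ℝ (gradient φ x) v)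
    have h4 : HasDerivAt (fun t : ℝ => β / 2 * ‖v‖ ^ 2 * t ^ 2) (β / 2 * ‖v‖ ^ 2 * (2 * t)) t := by
      simpa using (hasDerivAt_pow 2 t).const_mul (β / 2 * ‖v‖ ^ 2)
    have h5 : HasDerivAt ψ _ t := (h2.sub h3).sub h4
    exact h5.congr_deriv (by simp)
  have hanti : AntitoneOn ψ (Set.Icc 0 1) := by
    refine antitoneOn_of_deriv_nonpos (convex_Icc 0 1)
      (fun t _ => (hder t).continuousAt.continuousWithinAt)
      (fun t _ => (hder t).differentiableAt.differentiableWithinAt) fun t ht => ?_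
    rw [interior_Icc] at ht
    rw [(hder t).deriv, ← inner_sub_left]
    have h1 := real_inner_le_norm (gradient φ (x + t • v) - gradient φ x) v
    have h2 := hL (x + t • v) x
    rw [add_sub_cancel_left, norm_smul, Real.norm_of_nonneg ht.1.le] at h2
    nlinarith [mul_le_mul_of_nonneg_right h2 (norm_nonneg v)]
  have h := hanti (Set.left_mem_Icc.2 zero_le_one) (Set.right_mem_Icc.2 zero_le_one) zero_le_one
  simp only [ψ, one_smul, zero_smul, add_zero, hv, add_sub_cancel] at h
  linarith

/-- A gradient step of length 1/β lowers `φ` by at least ‖∇φ(x)‖²/(2β) and cannot go below `c`. -/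
lemma sq_norm_gradient_le (hβ : 0 < β) (hd : Differentiable ℝ φ)
    (hL : ∀ x y, ‖gradient φ x - gradient φ y‖ ≤ β * ‖x - y‖) {c : ℝ} (hc : ∀ x, c ≤ φ x) (x : V) :
    ‖gradient φ x‖ ^ 2 ≤ 2 * β * (φ x - c) := by
  have h := le_quadratic hd hL x (x - (1 / β) • gradient φ x)
  have h2 := hc (x - (1 / β) • gradient φ x)
  rw [sub_sub_cancel_left, norm_neg, inner_neg_right, inner_smul_right, real_inner_self_eq_norm_sq,
    norm_smul, mul_pow, Real.norm_of_nonneg (by positivity)] at h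
  have h3 : -(1 / β * ‖gradient φ x‖ ^ 2) + β / 2 * ((1 / β) ^ 2 * ‖gradient φ x‖ ^ 2)
      = -(‖gradient φ x‖ ^ 2 / (2 * β)) := by field_simp; ring
  have h4 : ‖gradient φ x‖ ^ 2 / (2 * β) ≤ φ x - c := by linarith
  rw [div_le_iff₀ (by positivity)] at h4
  linarith

/-- Adding the convexity inequalities at the two points and using the Lipschitz gradient. This is μ
≤ β; the factor ‖x − y‖² has to stay because the space may have only one point. -/
lemma sq_norm_le_of_convex (hL : ∀ x y, ‖gradient φ x - gradient φ y‖ ≤ β * ‖x - y‖)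
    (hc : ∀ x y, inner ℝ (gradient φ x) (y - x) ≤ -(φ x - φ y + μ / 2 * ‖x - y‖ ^ 2)) (x y : V) :
    μ * ‖x - y‖ ^ 2 ≤ β * ‖x - y‖ ^ 2 := by
  have h1 := hc x y
  have h2 := hc y x
  have h0 : inner ℝ (gradient φ y) (x - y) = -inner ℝ (gradient φ y) (y - x) := by
    rw [← inner_neg_right, neg_sub]
  rw [norm_sub_rev y x, h0] at h2
  have h3 := real_inner_le_norm (gradient φ y - gradient φ x) (y - x)
  rw [inner_sub_left] at h3
  have h4 := hL y x
  rw [norm_sub_rev y x] at h3 h4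
  nlinarith [mul_le_mul_of_nonneg_right h4 (norm_nonneg (x - y))]

/-- Convexity at a perturbed point. -/
lemma inner_gradient_le_of_convex (hμ : 0 ≤ μ) (hd : Differentiable ℝ φ)
    (hL : ∀ x y, ‖gradient φ x - gradient φ y‖ ≤ β * ‖x - y‖)
    (hc : ∀ x y, inner ℝ (gradient φ x) (y - x) ≤ -(φ x - φ y + μ / 2 * ‖x - y‖ ^ 2))
    (x y z : V) :
    inner ℝ (gradient φ y) (z - x) ≤ φ z - φ x - μ / 4 * ‖x - z‖ ^ 2 + β * ‖y - x‖ ^ 2 := by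
  have h1 := hc y z
  have h2 := le_quadratic hd hL y x
  have h3 : inner ℝ (gradient φ y) (z - x) =
      inner ℝ (gradient φ y) (z - y) - inner ℝ (gradient φ y) (x - y) := by
    rw [← inner_sub_right]; congr 1; abel
  -- Moving the quadratic term from `y` to `x` halves its coefficient and costs μ/2·‖x − y‖² ≤
  -- β/2·‖x − y‖². Together with the β/2 from the quadratic bound this makes the constant β.
  have h4 := sq_norm_le_of_convex hL hc y x
  have h5 : ‖x - z‖ ^ 2 ≤ 2 * ‖x - y‖ ^ 2 + 2 * ‖y - z‖ ^ 2 := by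
    have h6 := pow_le_pow_left₀ (norm_nonneg _) (norm_sub_le_norm_sub_add_norm_sub x y z) 2
    nlinarith [sq_nonneg (‖x - y‖ - ‖y - z‖)]
  rw [norm_sub_rev x y] at h2 h5
  nlinarith [mul_le_mul_of_nonneg_left h5 hμ]

end Smoothness

/-! ### Smoothness of the averaged objective and the two dissimilarity conditions -/

section Objective

variable {d N : ℕ} {β μ G B : ℝ} {f : Fin N → Vec d → ℝ}

lemma hasGradientAt_objective (hf : Smooth β f) (x : Vec d) :
    HasGradientAt (objective f) ((1 / (N : ℝ)) • ∑ i, gradient (f i) x) x := by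
  rw [hasGradientAt_iff_hasFDerivAt, map_smul, map_sum]
  have h : HasFDerivAt (fun y => ∑ i, f i y)
      (∑ i, InnerProductSpace.toDual ℝ (Vec d) (gradient (f i) x)) x :=
    HasFDerivAt.fun_sum fun i _ => ((hf i).1 x).hasGradientAt.hasFDerivAt
  exact h.const_mul (1 / (N : ℝ))

lemma gradient_objective (hf : Smooth β f) (x : Vec d) :
    gradient (objective f) x = (1 / (N : ℝ)) • ∑ i, gradient (f i) x :=
  (hasGradientAt_objective hf x).gradient

lemma differentiable_objective (hf : Smooth β f) : Differentiable ℝ (objective f) :=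
  fun x => (hasGradientAt_objective hf x).differentiableAt

lemma gradient_objective_lipschitz (hN : 0 < N) (hf : Smooth β f) (x y : Vec d) :
    ‖gradient (objective f) x - gradient (objective f) y‖ ≤ β * ‖x - y‖ := by
  have hN' : (0 : ℝ) < N := by exact_mod_cast hN
  rw [gradient_objective hf, gradient_objective hf, ← smul_sub, ← Finset.sum_sub_distrib, norm_smul,
    Real.norm_of_nonneg (by positivity), one_div, inv_mul_le_iff₀ hN']
  refine (norm_sum_le_of_le _ fun i _ => (hf i).2 x y).trans ?_
  simp

lemma continuous_gradient_objective (hN : 0 < N) (hf : Smooth β f) :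
    Continuous (gradient (objective f)) :=
  (LipschitzWith.of_dist_le' (K := β) fun x y => by
    simpa [dist_eq_norm] using gradient_objective_lipschitz hN hf x y).continuous

/-- Smoothness gives ‖∇f(x)‖² ≤ 2β(f(x) − f⋆), so the convex cases need only the relaxed condition.
-/
lemma BoundedDissimilarity.relaxed (hβ : 0 < β) (hN : 0 < N) (hf : Smooth β f) {fstar : ℝ}
    (hm : ∀ x, fstar ≤ objective f x) (h : BoundedDissimilarity G B f) :
    RelaxedDissimilarity β G B fstar f := fun x => by
  have h1 := sq_norm_gradient_le hβ (differentiable_objective hf)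
    (gradient_objective_lipschitz hN hf) hm x
  nlinarith [h x, mul_le_mul_of_nonneg_left h1 (sq_nonneg B)]

end Objective

/-! ### Sampling clients without replacement -/

section Sampling

variable {N S : ℕ}

/-- The uniform distribution on the sets of `S` clients. -/
def samplingLaw (N S : ℕ) : Measure (Finset (Fin N)) :=
  uniformOn {s : Finset (Fin N) | s.card = S}

lemma isProbabilityMeasure_samplingLaw (hSN : S ≤ N) : IsProbabilityMeasure (samplingLaw N S) := by
  refine isProbabilityMeasure_uniformOn (Set.toFinite _) ?_
  obtain ⟨s, -, hs⟩ := Finset.exists_subset_card_eq (s := (Finset.univ : Finset (Fin N)))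
    (n := S) (by simpa using hSN)
  exact ⟨s, hs⟩

lemma ae_card_eq : ∀ᵐ s ∂(samplingLaw N S), s.card = S :=
  ae_cond_mem (Set.toFinite _).measurableSet

lemma samplingLaw_superset (t : Finset (Fin N)) (ht : t.card ≤ S) :
    (samplingLaw N S).real {s | t ⊆ s}
      = ((N - t.card).choose (S - t.card) : ℝ) / (N.choose S : ℝ) := by
  have h1 : {s : Finset (Fin N) | s.card = S}
      = ((Finset.univ : Finset (Fin N)).powersetCard S : Set (Finset (Fin N))) := by
    ext s; simp
  have h2 : {s : Finset (Fin N) | t ⊆ s}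
      = ((Finset.univ.filter fun s : Finset (Fin N) => t ⊆ s) : Set (Finset (Fin N))) := by
    ext s; simp
  have h3 := Finset.card_filter_powersetCard_subset t (Finset.univ : Finset (Fin N)) S
    (Finset.subset_univ _) ht
  have h4 : (Finset.univ : Finset (Fin N)).powersetCard S
      ∩ (Finset.univ.filter fun s : Finset (Fin N) => t ⊆ s)
      = ((Finset.univ : Finset (Fin N)).powersetCard S).filter (t ⊆ ·) := by
    ext s; simp
  rw [measureReal_def, samplingLaw, h1, h2, uniformOn_apply_finset, h4, h3]
  simp

lemma samplingLaw_mem (hS : 1 ≤ S) (hSN : S ≤ N) (i : Fin N) :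
    (samplingLaw N S).real {s | i ∈ s} = (S : ℝ) / N := by
  have h := samplingLaw_superset (S := S) {i} (by simpa using hS)
  simp only [Finset.singleton_subset_iff, Finset.card_singleton] at h
  rw [h]
  obtain ⟨k, rfl⟩ : ∃ k, S = k + 1 := ⟨S - 1, by omega⟩
  obtain ⟨n, rfl⟩ : ∃ n, N = n + 1 := ⟨N - 1, by omega⟩
  have h2 : ((n : ℝ) + 1) * n.choose k = (n + 1).choose (k + 1) * (k + 1) := by
    exact_mod_cast Nat.add_one_mul_choose_eq n k
  have h3 : ((n + 1).choose (k + 1) : ℝ) ≠ 0 := by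
    exact_mod_cast (Nat.choose_pos hSN).ne'
  rw [div_eq_div_iff h3 (by positivity)]
  simp only [Nat.add_sub_cancel]
  push_cast
  linarith

lemma samplingLaw_mem_mem (hS : 1 ≤ S) (hSN : S ≤ N) {i j : Fin N} (hij : i ≠ j) :
    (samplingLaw N S).real {s | i ∈ s ∧ j ∈ s} = (S : ℝ) * (S - 1) / (N * (N - 1)) := by
  have hc : ({i, j} : Finset (Fin N)).card = 2 := Finset.card_pair hij
  rcases hS.eq_or_lt with rfl | hS2
  -- A single client cannot contain two, so the event is null; the counting formula requires at
  -- least two sampled clients.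
  · simp only [Nat.cast_one, sub_self, mul_zero, zero_div]
    rw [measureReal_eq_zero_iff (by
      have := isProbabilityMeasure_samplingLaw hSN
      exact measure_ne_top _ _)]
    refine measure_mono_null (t := {s | ¬ s.card = 1}) (fun s hs hs1 => ?_) ae_card_eq
    exact hij (Finset.card_le_one.1 (le_of_eq hs1) _ hs.1 _ hs.2)
  have h := samplingLaw_superset (S := S) {i, j} (by omega)
  rw [hc] at h
  simp only [Finset.insert_subset_iff, Finset.singleton_subset_iff] at h
  rw [h]
  obtain ⟨k, rfl⟩ : ∃ k, S = k + 2 := ⟨S - 2, by omega⟩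
  obtain ⟨n, rfl⟩ : ∃ n, N = n + 2 := ⟨N - 2, by omega⟩
  have h2 : ((n : ℝ) + 1) * n.choose k = (n + 1).choose (k + 1) * (k + 1) := by
    exact_mod_cast Nat.add_one_mul_choose_eq n k
  have h4 : ((n : ℝ) + 2) * (n + 1).choose (k + 1) = (n + 2).choose (k + 2) * (k + 2) := by
    exact_mod_cast Nat.add_one_mul_choose_eq (n + 1) (k + 1)
  have h3 : ((n + 2).choose (k + 2) : ℝ) ≠ 0 := by
    exact_mod_cast (Nat.choose_pos hSN).ne'
  have h5 : ((n + 2 : ℕ) : ℝ) * ((n + 2 : ℕ) - 1) ≠ 0 := by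
    push_cast
    have : (0 : ℝ) ≤ n := n.cast_nonneg
    have h6 : (n : ℝ) + 2 - 1 ≠ 0 := by linarith
    positivity
  rw [div_eq_div_iff h3 h5]
  simp only [Nat.add_sub_cancel]
  push_cast
  linear_combination ((n : ℝ) + 2) * h2 + ((k : ℝ) + 1) * h4

lemma integral_sampling_sum (hS : 1 ≤ S) (hSN : S ≤ N) (a : Fin N → ℝ) :
    ∫ s, ∑ i ∈ s, a i ∂(samplingLaw N S) = (S : ℝ) / N * ∑ i, a i := by
  have := isProbabilityMeasure_samplingLaw hSN
  have h1 : ∀ s : Finset (Fin N), ∑ i ∈ s, a i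
      = ∑ i, {s : Finset (Fin N) | i ∈ s}.indicator (fun _ => a i) s := fun s => by
    simp [Set.indicator_apply, Finset.sum_ite_mem]
  rw [integral_congr_ae (Filter.Eventually.of_forall h1),
    integral_finsetSum _ fun i _ => Integrable.of_finite, Finset.mul_sum]
  refine Finset.sum_congr rfl fun i _ => ?_
  rw [integral_indicator_const _ (Set.toFinite _).measurableSet, samplingLaw_mem hS hSN, smul_eq_mul]

variable {V : Type*} [NormedAddCommGroup V] [InnerProductSpace ℝ V]

/-- Expand the square into inner products: diagonal pairs are included with probability S/N, the
others with S(S−1)/(N(N−1)). For N = 1 the second coefficient is 0 by division by zero, harmlessly,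
since the bracket vanishes too. -/
lemma integral_sampling_sq_norm_sum (hS : 1 ≤ S) (hSN : S ≤ N) (v : Fin N → V) :
    ∫ s, ‖∑ i ∈ s, v i‖ ^ 2 ∂(samplingLaw N S) = (S : ℝ) / N * ∑ i, ‖v i‖ ^ 2
      + (S : ℝ) * (S - 1) / (N * (N - 1)) * (‖∑ i, v i‖ ^ 2 - ∑ i, ‖v i‖ ^ 2) := by
  have := isProbabilityMeasure_samplingLaw hSN
  have hexp : ∀ s : Finset (Fin N), ‖∑ i ∈ s, v i‖ ^ 2 = ∑ i ∈ s, ∑ j ∈ s, inner ℝ (v i) (v j) :=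
    fun s => by
      rw [← real_inner_self_eq_norm_sq, sum_inner]
      exact Finset.sum_congr rfl fun i _ => inner_sum _ _ _
  have h1 : ∀ s : Finset (Fin N), ‖∑ i ∈ s, v i‖ ^ 2 = ∑ i, ∑ j,
      {s : Finset (Fin N) | i ∈ s ∧ j ∈ s}.indicator (fun _ => inner ℝ (v i) (v j)) s := fun s => by
    rw [hexp]
    simp [Set.indicator_apply, Finset.sum_ite_mem, ite_and, Finset.sum_ite_irrel]
  rw [integral_congr_ae (Filter.Eventually.of_forall h1),
    integral_finsetSum _ fun i _ => Integrable.of_finite]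
  have h2 : ∀ i, ∫ s, ∑ j, {s : Finset (Fin N) | i ∈ s ∧ j ∈ s}.indicator
      (fun _ => inner ℝ (v i) (v j)) s ∂(samplingLaw N S)
      = (S : ℝ) / N * ‖v i‖ ^ 2 + (S : ℝ) * (S - 1) / (N * (N - 1)) *
        (∑ j, inner ℝ (v i) (v j) - ‖v i‖ ^ 2) := by
    intro i
    rw [integral_finsetSum _ fun i _ => Integrable.of_finite]
    have h3 : ∀ j, ∫ s, {s : Finset (Fin N) | i ∈ s ∧ j ∈ s}.indicator
        (fun _ => (inner ℝ (v i) (v j) : ℝ)) s ∂(samplingLaw N S)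
        = (S : ℝ) * (S - 1) / (N * (N - 1)) * inner ℝ (v i) (v j)
          + if i = j then ((S : ℝ) / N - (S : ℝ) * (S - 1) / (N * (N - 1))) * ‖v i‖ ^ 2 else 0 := by
      intro j
      rw [integral_indicator_const _ (Set.toFinite _).measurableSet, smul_eq_mul]
      split_ifs with hij
      · subst hij
        simp only [and_self]
        rw [samplingLaw_mem hS hSN, real_inner_self_eq_norm_sq]
        ring
      · rw [samplingLaw_mem_mem hS hSN hij, add_zero]
    simp only [h3]
    rw [Finset.sum_add_distrib, ← Finset.mul_sum]
    simp
    ring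
  simp only [h2]
  rw [Finset.sum_add_distrib, ← Finset.mul_sum, ← Finset.mul_sum, Finset.sum_sub_distrib, hexp]

/-- The variance of the mean of a sample without replacement. -/
lemma integral_sampling_sq_norm_mean_le (hS : 1 ≤ S) (hSN : S ≤ N) :
    ∃ c : ℝ, 0 ≤ c ∧ c ≤ 1 ∧ c ≤ 2 * ((1 - (S : ℝ) / N) / S) ∧ ∀ v : Fin N → V,
      ∫ s, ‖(1 / (S : ℝ)) • ∑ i ∈ s, v i‖ ^ 2 ∂(samplingLaw N S) ≤
        ‖(1 / (N : ℝ)) • ∑ i, v i‖ ^ 2 + c * ((1 / (N : ℝ)) * ∑ i, ‖v i‖ ^ 2) := by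
  have hS' : (1 : ℝ) ≤ S := by exact_mod_cast hS
  have hSN' : (S : ℝ) ≤ N := by exact_mod_cast hSN
  have hsq : ∀ (n : ℕ) (u : V), ‖(1 / (n : ℝ)) • u‖ ^ 2 = (1 / (n : ℝ)) ^ 2 * ‖u‖ ^ 2 :=
    fun n u => by rw [norm_smul, mul_pow, Real.norm_of_nonneg (by positivity)]
  rcases hSN.eq_or_lt with rfl | hlt
  · refine ⟨0, le_rfl, zero_le_one, ?_, fun v => ?_⟩
    · rw [div_self (by positivity)]; simp
    · simp only [hsq]
      rw [integral_const_mul, integral_sampling_sq_norm_sum hS hSN, div_self (by positivity)]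
      rcases hS.eq_or_lt with rfl | h1
      · simp
      · have h1' : (1 : ℝ) < S := by exact_mod_cast h1
        have h2 : (S : ℝ) - 1 ≠ 0 := by linarith
        rw [div_self (by positivity)]
        simp
  · have hlt' : (S : ℝ) + 1 ≤ N := by exact_mod_cast hlt
    have hN1 : (0 : ℝ) < N - 1 := by linarith
    have hN : (0 : ℝ) < N := by linarith
    -- The finite population correction. The bound c ≤ 1 is N ≤ SN, and the other bound is N ≤
    -- 2(N−1). The first will be used for the part of the dissimilarity that is absorbed, the second
    -- for G².
    refine ⟨(N - S) / (S * (N - 1)), by apply div_nonneg <;> nlinarith, ?_, ?_, fun v => ?_⟩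
    · rw [div_le_one (by positivity)]; nlinarith
    · rw [show 2 * ((1 - (S : ℝ) / N) / S) = 2 * (N - S) / (S * N) by field_simp,
        div_le_div_iff₀ (by positivity) (by positivity)]
      have : 0 ≤ (S : ℝ) * (N - S) * (N - 2) := by
        apply mul_nonneg <;> nlinarith
      nlinarith
    · simp only [hsq]
      rw [integral_const_mul, integral_sampling_sq_norm_sum hS hSN]
      have h1 : (1 / (S : ℝ)) ^ 2 * ((S : ℝ) / N * ∑ i, ‖v i‖ ^ 2
          + (S : ℝ) * (S - 1) / (N * (N - 1)) * (‖∑ i, v i‖ ^ 2 - ∑ i, ‖v i‖ ^ 2))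
          = (1 / (N : ℝ)) ^ 2 * ‖∑ i, v i‖ ^ 2
            + (N - S) / (S * (N - 1)) * ((1 / (N : ℝ)) * ∑ i, ‖v i‖ ^ 2)
            - (N - S) / (S * (N - 1)) * (1 / (N : ℝ)) ^ 2 * ‖∑ i, v i‖ ^ 2 := by
        field_simp; ring
      rw [h1]
      have : 0 ≤ (N - S) / (S * (N - 1)) * (1 / (N : ℝ)) ^ 2 * ‖∑ i, v i‖ ^ 2 := by
        have : 0 ≤ (N : ℝ) - S := by linarith
        positivity
      linarith

end Sampling

/-! ### One round, started at a fixed server model -/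

section Pi

variable {ι V : Type*} [Fintype ι] {Ω : ι → Type*} [∀ i, MeasurableSpace (Ω i)]
  [NormedAddCommGroup V] [InnerProductSpace ℝ V] [CompleteSpace V]
  [MeasurableSpace V] [BorelSpace V] [SecondCountableTopology V]
  {Q : ∀ i, Measure (Ω i)} [∀ i, IsProbabilityMeasure (Q i)]

lemma memLp_comp_eval {M : ∀ i, Ω i → V} (i : ι) (hM : MemLp (M i) 2 (Q i)) :
    MemLp (fun ω : ∀ i, Ω i => M i (ω i)) 2 (Measure.pi Q) :=
  hM.comp_measurePreserving (measurePreserving_eval Q i)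

/-- The second moment of a sum of independent centred vectors. -/
lemma integral_sq_norm_sum_pi {M : ∀ i, Ω i → V} (hMm : ∀ i, Measurable (M i))
    (hM : ∀ i, MemLp (M i) 2 (Q i)) (h0 : ∀ i, ∫ ω, M i ω ∂(Q i) = 0) (s : Finset ι) :
    ∫ ω, ‖∑ i ∈ s, M i (ω i)‖ ^ 2 ∂(Measure.pi Q) = ∑ i ∈ s, ∫ ω, ‖M i ω‖ ^ 2 ∂(Q i) := by
  classical
  have hL : ∀ i, MemLp (fun ω : ∀ i, Ω i => M i (ω i)) 2 (Measure.pi Q) := fun i =>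
    memLp_comp_eval i (hM i)
  have hindep : iIndepFun (fun (i : ι) (ω : ∀ i, Ω i) => ω i) (Measure.pi Q) :=
    iIndepFun_pi (X := fun i => id) fun i => aemeasurable_id
  have hcross : ∀ i j, i ≠ j →
      ∫ ω, inner ℝ (M i (ω i)) (M j (ω j)) ∂(Measure.pi Q) = 0 := fun i j hij => by
    have hj : (Measure.pi Q).map (fun ω => ω j) = Q j := (measurePreserving_eval Q j).map_eq
    refine integral_inner_pair_eq_zero (U := M i) (W := fun p : Ω i × Ω j => M j p.2)
      (measurable_pi_apply i) (measurable_pi_apply j) (hindep.indepFun hij) (hMm i)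
      ((hMm j).comp measurable_snd) (hL i) (hL j) (fun x => ?_) fun x => ?_
    · rw [hj]; exact (hM j).integrable (by norm_num)
    · rw [hj]; exact h0 j
  induction s using Finset.induction_on with
  | empty => simp
  | insert a s ha ih =>
    have hs : MemLp (fun ω : ∀ i, Ω i => ∑ i ∈ s, M i (ω i)) 2 (Measure.pi Q) :=
      memLp_finsetSum _ fun i _ => hL i
    have hexp : ∀ ω : ∀ i, Ω i, ‖∑ i ∈ insert a s, M i (ω i)‖ ^ 2 = ‖M a (ω a)‖ ^ 2
        + 2 * inner ℝ (M a (ω a)) (∑ i ∈ s, M i (ω i)) + ‖∑ i ∈ s, M i (ω i)‖ ^ 2 := fun ω => by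
      rw [Finset.sum_insert ha, norm_add_sq_real]
    have hi1 := integrable_sq_norm_of_memLp (hL a)
    have hi2 := (integrable_inner_of_memLp (hL a) hs).const_mul 2
    have hi3 : Integrable (fun ω : ∀ i, Ω i => ‖M a (ω a)‖ ^ 2
        + 2 * inner ℝ (M a (ω a)) (∑ i ∈ s, M i (ω i))) (Measure.pi Q) := hi1.add hi2
    rw [integral_congr_ae (Filter.Eventually.of_forall hexp),
      integral_add hi3 (integrable_sq_norm_of_memLp hs), integral_add hi1 hi2, ih,
      integral_const_mul, Finset.sum_insert ha]
    have hz : ∫ ω, inner ℝ (M a (ω a)) (∑ i ∈ s, M i (ω i)) ∂(Measure.pi Q) = 0 := by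
      simp only [inner_sum]
      rw [integral_finsetSum _ fun i _ => integrable_inner_of_memLp (hL a) (hL i)]
      exact Finset.sum_eq_zero fun i hi => hcross a i fun h => ha (h ▸ hi)
    rw [hz, mul_zero, add_zero, integral_comp_eval (f := fun ω => ‖M a ω‖ ^ 2)]
    exact ((hMm a).norm.pow_const 2).aestronglyMeasurable

end Pi

section Round

/-- With finitely many client sets, measurability and integrability may be checked for one set at a
time. -/
lemma integral_prod_of_finite {α Ω : Type*} [Finite α] [MeasurableSpace α]
    [MeasurableSingletonClass α] [MeasurableSpace Ω] {ν : Measure α} [IsProbabilityMeasure ν]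
    {ρ : Measure Ω} [IsProbabilityMeasure ρ] {F : α × Ω → ℝ} (hF : ∀ s, Measurable fun ω => F (s, ω))
    (hi : ∀ s, Integrable (fun ω => F (s, ω)) ρ) :
    Integrable F (ν.prod ρ) ∧ ∫ p, F p ∂(ν.prod ρ) = ∫ s, ∫ ω, F (s, ω) ∂ρ ∂ν := by
  have hFm : Measurable F := measurable_from_prod_countable_right hF
  have h : Integrable F (ν.prod ρ) :=
    (integrable_prod_iff hFm.aestronglyMeasurable).2
      ⟨Filter.Eventually.of_forall hi, Integrable.of_finite⟩
  exact ⟨h, integral_prod _ h⟩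

variable {d N S K : ℕ} {Z : Type*} [MeasurableSpace Z] {f : Fin N → Vec d → ℝ}
  {P : Fin N → Measure Z} [∀ i, IsProbabilityMeasure (P i)] {g : Fin N → Vec d → Z → Vec d}
  {β σ ηl ηg : ℝ}

lemma StochasticGradient.isOracle (hg : StochasticGradient σ f P g) (hf : Smooth β f) (i : Fin N) :
    IsOracle β σ (P i) (g i) (gradient (f i)) where
  measurable := hg.measurable i
  memLp_two := hg.memLp_two i
  unbiased := hg.unbiased i
  variance_le := hg.variance_le i
  lipschitz := (hf i).2

/-- The function `m` is free because it enters only the noise component of the state. -/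
lemma localIter_eq (i : Fin N) (ζ : ℕ → Z) (x : Vec d) (k : ℕ) (m : Vec d → Vec d) :
    localIter g i ηl ζ x k = localPoint (g i) m ηl x k ζ := by
  induction k with
  | zero => rfl
  | succ k ih => rw [localIter, ih]; rfl

/-- The sum of the stochastic gradients that client `i` uses in `K` local steps. -/
def clientSum (f : Fin N → Vec d → ℝ) (g : Fin N → Vec d → Z → Vec d) (ηl : ℝ) (x : Vec d) (K : ℕ)
    (i : Fin N) (ζ : ℕ → Z) : Vec d :=
  localNoise (g i) (gradient (f i)) ηl x K ζ
    + ∑ k ∈ Finset.range K, gradient (f i) (localPoint (g i) (gradient (f i)) ηl x k ζ)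

/-- The mean squared drift of client `i` in `K` local steps. -/
def clientDrift (f : Fin N → Vec d → ℝ) (P : Fin N → Measure Z) (g : Fin N → Vec d → Z → Vec d)
    (ηl : ℝ) (x : Vec d) (K : ℕ) (i : Fin N) : ℝ :=
  (1 / (K : ℝ)) * ∑ k ∈ Finset.range K,
    ∫ ζ, ‖localPoint (g i) (gradient (f i)) ηl x k ζ - x‖ ^ 2
      ∂(Measure.infinitePi fun _ : ℕ => P i)

/-- The mean over the local steps of the expected inner product of the local gradients with `h`. -/
def clientInner (f : Fin N → Vec d → ℝ) (P : Fin N → Measure Z) (g : Fin N → Vec d → Z → Vec d)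
    (ηl : ℝ) (x : Vec d) (K : ℕ) (h : Vec d) (i : Fin N) : ℝ :=
  (1 / (K : ℝ)) * ∑ k ∈ Finset.range K,
    ∫ ζ, inner ℝ (gradient (f i) (localPoint (g i) (gradient (f i)) ηl x k ζ)) h
      ∂(Measure.infinitePi fun _ : ℕ => P i)

lemma roundStep_sub (f : Fin N → Vec d → ℝ) (x : Vec d) (ξ : Round N Z) :
    roundStep g S K ηl ηg x ξ - x =
      (-(ηg * ηl / S)) • ∑ i ∈ ξ.1, clientSum f g ηl x K i (ξ.2 i) := by
  have h : ∀ i ∈ ξ.1, localIter g i ηl (ξ.2 i) x K - x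
      = (-ηl) • clientSum f g ηl x K i (ξ.2 i) := fun i _ => by
    rw [localIter_eq i _ x K (gradient (f i)), localPoint_eq, clientSum]
    module
  rw [roundStep, Finset.sum_congr rfl h, ← Finset.smul_sum, add_sub_cancel_left, smul_smul]
  congr 1
  ring

variable (hg : StochasticGradient σ f P g) (hf : Smooth β f)
include hg hf

lemma memLp_gradient_localPoint (x : Vec d) (k : ℕ) (i : Fin N) :
    MemLp (fun ζ => gradient (f i) (localPoint (g i) (gradient (f i)) ηl x k ζ)) 2
      (Measure.infinitePi fun _ : ℕ => P i) :=
  (hg.isOracle hf i).memLp_mean ((hg.isOracle hf i).measurable_localPoint x k)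
    ((hg.isOracle hf i).memLp_local x k).1

lemma measurable_clientSum (x : Vec d) (K : ℕ) (i : Fin N) :
    Measurable (clientSum f g ηl x K i) :=
  ((hg.isOracle hf i).measurable_localNoise x K).add
    (Finset.measurable_fun_sum _ fun k _ =>
      (hg.isOracle hf i).measurable_mean.comp ((hg.isOracle hf i).measurable_localPoint x k))

lemma memLp_clientSum (x : Vec d) (K : ℕ) (i : Fin N) :
    MemLp (clientSum f g ηl x K i) 2 (Measure.infinitePi fun _ : ℕ => P i) :=
  ((hg.isOracle hf i).memLp_local x K).2.add
    (memLp_finsetSum _ fun k _ => memLp_gradient_localPoint hg hf x k i)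

lemma integral_inner_clientSum (hK : 1 ≤ K) (x h : Vec d) (i : Fin N) :
    ∫ ζ, inner ℝ (clientSum f g ηl x K i ζ) h ∂(Measure.infinitePi fun _ : ℕ => P i)
      = K * clientInner f P g ηl x K h i := by
  have hK' : (0 : ℝ) < K := by exact_mod_cast hK
  have ho := hg.isOracle hf i
  have hM := (ho.memLp_local (η := ηl) x K).2
  have hi : ∀ k ∈ Finset.range K, Integrable
      (fun ζ => inner ℝ (gradient (f i) (localPoint (g i) (gradient (f i)) ηl x k ζ)) h)
      (Measure.infinitePi fun _ : ℕ => P i) := fun k _ =>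
    integrable_inner_of_memLp (memLp_gradient_localPoint hg hf x k i) (memLp_const h)
  have h1 : ∫ ζ, inner ℝ (localNoise (g i) (gradient (f i)) ηl x K ζ) h
      ∂(Measure.infinitePi fun _ : ℕ => P i) = 0 := by
    simp only [real_inner_comm]
    rw [integral_inner (hM.integrable (by norm_num)), ho.integral_localNoise, inner_zero_right]
  simp only [clientSum, inner_add_left, sum_inner, clientInner]
  rw [integral_add (integrable_inner_of_memLp hM (memLp_const h)) (integrable_finsetSum _ hi), h1,
    integral_finsetSum _ hi, zero_add, ← mul_assoc, mul_one_div_cancel hK'.ne', one_mul]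

omit hg in
-- Split into noise, drift error and gradients at `x`. Noise and gradients at `x` stay inside one
-- norm, so that independence and the sampling variance can still be exploited; only the drift error
-- pays for the triangle inequality over clients and steps.
lemma sq_norm_clientSum_le (x : Vec d) (s : Finset (Fin N)) (ζ : Fin N → ℕ → Z) :
    ‖∑ i ∈ s, clientSum f g ηl x K i (ζ i)‖ ^ 2 ≤
      3 * ‖∑ i ∈ s, localNoise (g i) (gradient (f i)) ηl x K (ζ i)‖ ^ 2
      + 3 * (s.card * ∑ i ∈ s, K * ∑ k ∈ Finset.range K,
          β ^ 2 * ‖localPoint (g i) (gradient (f i)) ηl x k (ζ i) - x‖ ^ 2)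
      + 3 * (K ^ 2 * ‖∑ i ∈ s, gradient (f i) x‖ ^ 2) := by
  have hsplit : ∑ i ∈ s, clientSum f g ηl x K i (ζ i) =
      ∑ i ∈ s, localNoise (g i) (gradient (f i)) ηl x K (ζ i)
      + ∑ i ∈ s, ∑ k ∈ Finset.range K,
          (gradient (f i) (localPoint (g i) (gradient (f i)) ηl x k (ζ i)) - gradient (f i) x)
      + (K : ℝ) • ∑ i ∈ s, gradient (f i) x := by
    rw [Finset.smul_sum, ← Finset.sum_add_distrib, ← Finset.sum_add_distrib]
    refine Finset.sum_congr rfl fun i _ => ?_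
    rw [clientSum, Finset.sum_sub_distrib, Finset.sum_const, Finset.card_range,
      Nat.cast_smul_eq_nsmul]
    abel
  have h3 : ∀ a b c : Vec d, ‖a + b + c‖ ^ 2 ≤ 3 * ‖a‖ ^ 2 + 3 * ‖b‖ ^ 2 + 3 * ‖c‖ ^ 2 := by
    intro a b c
    have := pow_le_pow_left₀ (norm_nonneg _) (norm_add₃_le (a := a) (b := b) (c := c)) 2
    nlinarith [sq_nonneg (‖a‖ - ‖b‖), sq_nonneg (‖a‖ - ‖c‖), sq_nonneg (‖b‖ - ‖c‖)]
  rw [hsplit]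
  refine (h3 _ _ _).trans ?_
  rw [norm_smul, mul_pow, Real.norm_of_nonneg (by positivity : (0 : ℝ) ≤ K)]
  gcongr
  refine (norm_sum_sq_le _ _).trans ?_
  gcongr with i _
  refine (norm_sum_sq_le _ _).trans ?_
  rw [Finset.card_range]
  gcongr with k _
  rw [← mul_pow]
  exact pow_le_pow_left₀ (norm_nonneg _) ((hf i).2 _ _) 2

/-- For a fixed client set, independence across clients makes the noise term linear in the number of
clients; this is the source of the factor 1/(KS) in the final variance. -/
lemma integral_sq_norm_clientSum_le (hK : 1 ≤ K) (x : Vec d) (s : Finset (Fin N)) :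
    ∫ ζ, ‖∑ i ∈ s, clientSum f g ηl x K i (ζ i)‖ ^ 2
      ∂(Measure.pi fun i => Measure.infinitePi fun _ : ℕ => P i) ≤
      3 * (s.card * (K * σ ^ 2))
      + 3 * (s.card * ∑ i ∈ s, K ^ 2 * (β ^ 2 * clientDrift f P g ηl x K i))
      + 3 * (K ^ 2 * ‖∑ i ∈ s, gradient (f i) x‖ ^ 2) := by
  have hK' : (0 : ℝ) < K := by exact_mod_cast hK
  set Q : Fin N → Measure (ℕ → Z) := fun i => Measure.infinitePi fun _ : ℕ => P i with hQ
  have hM : MemLp (fun ζ : Fin N → ℕ → Z =>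
      ∑ i ∈ s, localNoise (g i) (gradient (f i)) ηl x K (ζ i)) 2 (Measure.pi Q) :=
    memLp_finsetSum _ fun i _ =>
      memLp_comp_eval (Q := Q) (M := fun i => localNoise (g i) (gradient (f i)) ηl x K) i
        ((hg.isOracle hf i).memLp_local x K).2
  have hS : MemLp (fun ζ : Fin N → ℕ → Z => ∑ i ∈ s, clientSum f g ηl x K i (ζ i)) 2
      (Measure.pi Q) :=
    memLp_finsetSum _ fun i _ =>
      memLp_comp_eval (Q := Q) (M := clientSum f g ηl x K) i (memLp_clientSum hg hf x K i)
  have hdm : ∀ i k, AEStronglyMeasurable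
      (fun ζ => ‖localPoint (g i) (gradient (f i)) ηl x k ζ - x‖ ^ 2) (Q i) := fun i k =>
    ((hg.isOracle hf i).integrable_sq_drift x k).1
  have hd1 : ∀ i k, Integrable (fun ζ : Fin N → ℕ → Z =>
      β ^ 2 * ‖localPoint (g i) (gradient (f i)) ηl x k (ζ i) - x‖ ^ 2) (Measure.pi Q) :=
    fun i k => (integrable_comp_eval (μ := Q)
      ((hg.isOracle hf i).integrable_sq_drift x k)).const_mul _
  have hd2 : ∀ i, Integrable (fun ζ : Fin N → ℕ → Z => K * ∑ k ∈ Finset.range K,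
      β ^ 2 * ‖localPoint (g i) (gradient (f i)) ηl x k (ζ i) - x‖ ^ 2) (Measure.pi Q) :=
    fun i => (integrable_finsetSum _ fun k _ => hd1 i k).const_mul _
  have hd3 : Integrable (fun ζ : Fin N → ℕ → Z => 3 * (s.card * ∑ i ∈ s,
      K * ∑ k ∈ Finset.range K,
        β ^ 2 * ‖localPoint (g i) (gradient (f i)) ηl x k (ζ i) - x‖ ^ 2)) (Measure.pi Q) :=
    ((integrable_finsetSum _ fun i _ => hd2 i).const_mul _).const_mul _
  have hM2 := (integrable_sq_norm_of_memLp hM).const_mul 3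
  have hMd : Integrable (fun ζ : Fin N → ℕ → Z =>
      3 * ‖∑ i ∈ s, localNoise (g i) (gradient (f i)) ηl x K (ζ i)‖ ^ 2
      + 3 * (s.card * ∑ i ∈ s, K * ∑ k ∈ Finset.range K,
        β ^ 2 * ‖localPoint (g i) (gradient (f i)) ηl x k (ζ i) - x‖ ^ 2)) (Measure.pi Q) :=
    hM2.add hd3
  refine (integral_mono (integrable_sq_norm_of_memLp hS) (hMd.add (integrable_const
    (3 * (K ^ 2 * ‖∑ i ∈ s, gradient (f i) x‖ ^ 2))))
    fun ζ => sq_norm_clientSum_le hf x s ζ).trans ?_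
  simp only [Pi.add_apply]
  rw [integral_add hMd (integrable_const _), integral_add hM2 hd3, integral_const_mul,
    integral_const_mul, integral_const_mul, integral_finsetSum _ fun i _ => hd2 i]
  simp only [integral_const, probReal_univ, one_smul]
  have h1 : ∫ ζ, ‖∑ i ∈ s, localNoise (g i) (gradient (f i)) ηl x K (ζ i)‖ ^ 2 ∂(Measure.pi Q)
      ≤ s.card * (K * σ ^ 2) := by
    rw [integral_sq_norm_sum_pi (Q := Q) (M := fun i => localNoise (g i) (gradient (f i)) ηl x K)
      (fun i => (hg.isOracle hf i).measurable_localNoise x K)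
      (fun i => ((hg.isOracle hf i).memLp_local x K).2)
      (fun i => (hg.isOracle hf i).integral_localNoise x K), ← nsmul_eq_mul]
    exact Finset.sum_le_card_nsmul _ _ _ fun i _ => (hg.isOracle hf i).integral_sq_localNoise_le x K
  have h2 : ∀ i, ∫ ζ : Fin N → ℕ → Z, K * ∑ k ∈ Finset.range K,
        β ^ 2 * ‖localPoint (g i) (gradient (f i)) ηl x k (ζ i) - x‖ ^ 2 ∂(Measure.pi Q)
      = K ^ 2 * (β ^ 2 * clientDrift f P g ηl x K i) := fun i => by
    rw [integral_const_mul, integral_finsetSum _ fun k _ => hd1 i k, clientDrift]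
    simp only [integral_const_mul]
    rw [← Finset.mul_sum, Finset.sum_congr rfl fun k _ => integral_comp_eval (μ := Q) (hdm i k)]
    field_simp
    rfl
  simp only [h2]
  gcongr

/-- The mean of one server update. -/
lemma integral_inner_roundStep (hS : 1 ≤ S) (hSN : S ≤ N) (hK : 1 ≤ K) (x h : Vec d) :
    Integrable (fun ξ => inner ℝ (roundStep g S K ηl ηg x ξ - x) h) (roundLaw S P) ∧
    ∫ ξ, inner ℝ (roundStep g S K ηl ηg x ξ - x) h ∂(roundLaw S P) =
      -(K * ηl * ηg) * ((1 / (N : ℝ)) * ∑ i, clientInner f P g ηl x K h i) := by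
  have := isProbabilityMeasure_samplingLaw hSN
  have hS' : (0 : ℝ) < S := by exact_mod_cast hS
  set Q : Fin N → Measure (ℕ → Z) := fun i => Measure.infinitePi fun _ : ℕ => P i with hQ
  have hi : ∀ i, Integrable (fun ζ : Fin N → ℕ → Z => inner ℝ (clientSum f g ηl x K i (ζ i)) h)
      (Measure.pi Q) := fun i =>
    integrable_inner_of_memLp (memLp_comp_eval (Q := Q) (M := clientSum f g ηl x K) i
      (memLp_clientSum hg hf x K i)) (memLp_const h)
  have hm : ∀ i, Measurable (clientSum f g ηl x K i) := fun i => measurable_clientSum hg hf x K i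
  have key := integral_prod_of_finite (ν := samplingLaw N S) (ρ := Measure.pi Q)
    (F := fun p => inner ℝ (roundStep g S K ηl ηg x p - x) h) (fun s => by
      simp only [roundStep_sub f, inner_smul_left, sum_inner]
      exact (Finset.measurable_fun_sum _ fun i _ =>
        ((hm i).comp (measurable_pi_apply i)).inner measurable_const).const_mul _)
    (fun s => by
      simp only [roundStep_sub f, inner_smul_left, sum_inner]
      exact (integrable_finsetSum _ fun i _ => hi i).const_mul _)
  refine ⟨key.1, key.2.trans ?_⟩
  have h1 : ∀ s : Finset (Fin N), ∫ ζ, inner ℝ (roundStep g S K ηl ηg x (s, ζ) - x) h ∂(Measure.pi Q)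
      = -(ηg * ηl / S) * ∑ i ∈ s, K * clientInner f P g ηl x K h i := fun s => by
    simp only [roundStep_sub f, inner_smul_left, sum_inner]
    rw [integral_const_mul, integral_finsetSum _ fun i _ => hi i]
    congr 1
    refine Finset.sum_congr rfl fun i _ => ?_
    rw [integral_comp_eval (μ := Q) (i := i) (f := fun ζ => inner ℝ (clientSum f g ηl x K i ζ) h),
      integral_inner_clientSum hg hf hK]
    exact ((hm i).inner measurable_const).aestronglyMeasurable
  rw [integral_congr_ae (Filter.Eventually.of_forall h1), integral_const_mul,
    integral_sampling_sum hS hSN, ← Finset.mul_sum]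
  field_simp

/-- The second moment of one server update. -/
lemma integral_sq_norm_roundStep_le (hS : 1 ≤ S) (hSN : S ≤ N) (hK : 1 ≤ K) :
    ∃ c : ℝ, 0 ≤ c ∧ c ≤ 1 ∧ c ≤ 2 * ((1 - (S : ℝ) / N) / S) ∧ ∀ x : Vec d,
    Integrable (fun ξ => ‖roundStep g S K ηl ηg x ξ - x‖ ^ 2) (roundLaw S P) ∧
    ∫ ξ, ‖roundStep g S K ηl ηg x ξ - x‖ ^ 2 ∂(roundLaw S P) ≤
      (K * ηl * ηg) ^ 2 * (3 * (σ ^ 2 / (K * S))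
        + 3 * (β ^ 2 * ((1 / (N : ℝ)) * ∑ i, clientDrift f P g ηl x K i))
        + 3 * (‖gradient (objective f) x‖ ^ 2
          + c * ((1 / (N : ℝ)) * ∑ i, ‖gradient (f i) x‖ ^ 2))) := by
  have hprob := isProbabilityMeasure_samplingLaw hSN
  have hS' : (0 : ℝ) < S := by exact_mod_cast hS
  have hK' : (0 : ℝ) < K := by exact_mod_cast hK
  obtain ⟨c, hc0, hc1, hc2, hc⟩ := integral_sampling_sq_norm_mean_le (V := Vec d) hS hSN
  refine ⟨c, hc0, hc1, hc2, fun x => ?_⟩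
  set Q : Fin N → Measure (ℕ → Z) := fun i => Measure.infinitePi fun _ : ℕ => P i with hQ
  have hi : ∀ s : Finset (Fin N), MemLp (fun ζ : Fin N → ℕ → Z =>
      ∑ i ∈ s, clientSum f g ηl x K i (ζ i)) 2 (Measure.pi Q) := fun s =>
    memLp_finsetSum _ fun i _ => memLp_comp_eval (Q := Q) (M := clientSum f g ηl x K) i
      (memLp_clientSum hg hf x K i)
  have hm : ∀ i, Measurable (clientSum f g ηl x K i) := fun i => measurable_clientSum hg hf x K i
  have hsq : ∀ ξ : Round N Z, ‖roundStep g S K ηl ηg x ξ - x‖ ^ 2 =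
      (ηg * ηl / S) ^ 2 * ‖∑ i ∈ ξ.1, clientSum f g ηl x K i (ξ.2 i)‖ ^ 2 := fun ξ => by
    rw [roundStep_sub f, norm_smul, mul_pow, Real.norm_eq_abs, sq_abs, neg_sq]
  have key := integral_prod_of_finite (ν := samplingLaw N S) (ρ := Measure.pi Q)
    (F := fun p => ‖roundStep g S K ηl ηg x p - x‖ ^ 2) (fun s => by
      simp only [hsq]
      exact ((Finset.measurable_fun_sum _ fun i _ =>
        (hm i).comp (measurable_pi_apply i)).norm.pow_const 2).const_mul _)
    (fun s => by
      simp only [hsq]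
      exact (integrable_sq_norm_of_memLp (hi s)).const_mul _)
  refine ⟨key.1, key.2.trans_le ?_⟩
  -- Only almost surely, since the set has exactly `S` elements on the support of the sampling law.
  have h1 : ∀ᵐ s ∂(samplingLaw N S),
      ∫ ζ, ‖roundStep g S K ηl ηg x (s, ζ) - x‖ ^ 2 ∂(Measure.pi Q) ≤
      (K * ηl * ηg) ^ 2 * (3 * (σ ^ 2 / (K * S))
        + 3 * (β ^ 2 * ((1 / (S : ℝ)) * ∑ i ∈ s, clientDrift f P g ηl x K i))
        + 3 * ‖(1 / (S : ℝ)) • ∑ i ∈ s, gradient (f i) x‖ ^ 2) := by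
    filter_upwards [ae_card_eq] with s hs
    simp only [hsq]
    rw [integral_const_mul]
    refine (mul_le_mul_of_nonneg_left (integral_sq_norm_clientSum_le hg hf hK x s)
      (sq_nonneg _)).trans (le_of_eq ?_)
    rw [hs, norm_smul, mul_pow, Real.norm_of_nonneg (by positivity), ← Finset.mul_sum,
      ← Finset.mul_sum]
    field_simp
  refine (integral_mono_ae Integrable.of_finite Integrable.of_finite h1).trans ?_
  rw [integral_const_mul, integral_add Integrable.of_finite Integrable.of_finite,
    integral_add Integrable.of_finite Integrable.of_finite]
  simp only [integral_const_mul, integral_const, probReal_univ, one_smul]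
  rw [integral_sampling_sum hS hSN, gradient_objective hf]
  have h2 := hc fun i => gradient (f i) x
  have h3 : 1 / (S : ℝ) * (S / N * ∑ i, clientDrift f P g ηl x K i)
      = (1 / (N : ℝ)) * ∑ i, clientDrift f P g ηl x K i := by
    rw [← mul_assoc]; congr 1; field_simp
  rw [h3]
  gcongr

/-- The mean drift of all clients. -/
lemma mean_clientDrift_le (hK : 1 ≤ K) (hη : (ηl * β * K) ^ 2 ≤ 1 / 256) (hN : 0 < N) (x : Vec d) :
    (1 / (N : ℝ)) * ∑ i, clientDrift f P g ηl x K i ≤ 3 * ηl ^ 2 * K * σ ^ 2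
      + 5 * ηl ^ 2 * K ^ 2 * ((1 / (N : ℝ)) * ∑ i, ‖gradient (f i) x‖ ^ 2) := by
  have hK' : (0 : ℝ) < K := by exact_mod_cast hK
  have hN' : (0 : ℝ) < N := by exact_mod_cast hN
  have h : ∀ i, clientDrift f P g ηl x K i ≤
      3 * ηl ^ 2 * K * σ ^ 2 + 5 * ηl ^ 2 * K ^ 2 * ‖gradient (f i) x‖ ^ 2 := fun i => by
    rw [clientDrift, one_div, inv_mul_le_iff₀ hK']
    exact (hg.isOracle hf i).sum_integral_sq_drift_le x K hη
  rw [one_div, inv_mul_le_iff₀ hN']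
  refine (Finset.sum_le_sum fun i _ => h i).trans (le_of_eq ?_)
  rw [Finset.sum_add_distrib, Finset.sum_const, Finset.card_univ, Fintype.card_fin, nsmul_eq_mul,
    ← Finset.mul_sum]
  field_simp

end Round

/-! ### Progress in one round -/

section Progress

variable {d N S K : ℕ} {Z : Type*} [MeasurableSpace Z] {f : Fin N → Vec d → ℝ}
  {P : Fin N → Measure Z} [∀ i, IsProbabilityMeasure (P i)] {g : Fin N → Vec d → Z → Vec d}
  {β σ ηl ηg G B μ : ℝ}

/-- The sum runs over a random set; since this set takes finitely many values, it is moved to the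
first factor and fixed. -/
lemma measurable_roundStep (hg : StochasticGradient σ f P g) :
    Measurable (Function.uncurry (roundStep g S K ηl ηg)) := by
  have hl : ∀ (i : Fin N) (k : ℕ), Measurable fun q : Vec d × (Fin N → ℕ → Z) =>
      localIter g i ηl (q.2 i) q.1 k := fun i k => by
    induction k with
    | zero => exact measurable_fst
    | succ k ih =>
      have hz : Measurable fun q : Vec d × (Fin N → ℕ → Z) => q.2 i k :=
        (measurable_pi_apply k).comp ((measurable_pi_apply i).comp measurable_snd)
      exact ih.sub (((hg.measurable i).comp (ih.prodMk hz)).const_smul ηl)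
  have h : Measurable fun p : Finset (Fin N) × (Vec d × (Fin N → ℕ → Z)) =>
      roundStep g S K ηl ηg p.2.1 (p.1, p.2.2) := by
    refine measurable_from_prod_countable_right fun s => ?_
    have hsum : Measurable fun q : Vec d × (Fin N → ℕ → Z) =>
        ∑ i ∈ s, (localIter g i ηl (q.2 i) q.1 K - q.1) :=
      Finset.measurable_fun_sum _ fun i _ => (hl i K).sub measurable_fst
    exact measurable_fst.add (hsum.const_smul (ηg / (S : ℝ)))
  exact h.comp ((measurable_fst.comp measurable_snd).prodMk
    (measurable_fst.prodMk (measurable_snd.comp measurable_snd)))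

/-- Perturbed convexity at each local point, integrated and averaged over steps and clients. The
drift term is the price for gradients that are not taken at `x`. -/
lemma neg_mean_clientInner_le_of_convex (hg : StochasticGradient σ f P g) (hf : Smooth β f)
    (hK : 1 ≤ K) (hN : 0 < N) (hμ : 0 ≤ μ) (hc : MuConvex μ f) (x xstar : Vec d) :
    -((1 / (N : ℝ)) * ∑ i, clientInner f P g ηl x K (x - xstar) i) ≤
      -(objective f x - objective f xstar) - μ / 4 * ‖x - xstar‖ ^ 2
        + β * ((1 / (N : ℝ)) * ∑ i, clientDrift f P g ηl x K i) := by
  have hK' : (0 : ℝ) < K := by exact_mod_cast hK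
  have hN' : (0 : ℝ) < N := by exact_mod_cast hN
  have h : ∀ i, -clientInner f P g ηl x K (x - xstar) i ≤
      f i xstar - f i x - μ / 4 * ‖x - xstar‖ ^ 2 + β * clientDrift f P g ηl x K i := fun i => by
    have ho := hg.isOracle hf i
    have h1 : ∀ k ∈ Finset.range K,
        -∫ ζ, inner ℝ (gradient (f i) (localPoint (g i) (gradient (f i)) ηl x k ζ)) (x - xstar)
          ∂(Measure.infinitePi fun _ : ℕ => P i) ≤
        (f i xstar - f i x - μ / 4 * ‖x - xstar‖ ^ 2)
          + β * ∫ ζ, ‖localPoint (g i) (gradient (f i)) ηl x k ζ - x‖ ^ 2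
          ∂(Measure.infinitePi fun _ : ℕ => P i) := fun k _ => by
      have hi : Integrable (fun ζ => inner ℝ (gradient (f i)
          (localPoint (g i) (gradient (f i)) ηl x k ζ)) (x - xstar))
          (Measure.infinitePi fun _ : ℕ => P i) :=
        integrable_inner_of_memLp (memLp_gradient_localPoint hg hf x k i) (memLp_const _)
      have hi2 := (ho.integrable_sq_drift (η := ηl) x k).const_mul β
      have h2 := integral_mono hi.neg ((integrable_const
        (f i xstar - f i x - μ / 4 * ‖x - xstar‖ ^ 2)).add hi2) fun ζ => by
          simp only [Pi.neg_apply, Pi.add_apply]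
          rw [← inner_neg_right, neg_sub]
          exact inner_gradient_le_of_convex hμ (hf i).1 (hf i).2 (hc i) x
            (localPoint (g i) (gradient (f i)) ηl x k ζ) xstar
      simp only [Pi.neg_apply, Pi.add_apply] at h2
      rw [integral_neg, integral_add (integrable_const _) hi2, integral_const_mul] at h2
      simpa using h2
    have h3 := Finset.sum_le_sum h1
    rw [Finset.sum_neg_distrib, Finset.sum_add_distrib, Finset.sum_const, Finset.card_range,
      nsmul_eq_mul, ← Finset.mul_sum] at h3
    have h4 := mul_le_mul_of_nonneg_left h3 (by positivity : 0 ≤ 1 / (K : ℝ))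
    rw [clientInner, clientDrift]
    refine (by linarith : _ ≤ _).trans (h4.trans (le_of_eq ?_))
    field_simp
  have h3 := Finset.sum_le_sum fun i (_ : i ∈ Finset.univ) => h i
  rw [Finset.sum_neg_distrib, Finset.sum_add_distrib, Finset.sum_sub_distrib,
    Finset.sum_sub_distrib, Finset.sum_const, Finset.card_univ, Fintype.card_fin, nsmul_eq_mul,
    ← Finset.mul_sum] at h3
  have h4 := mul_le_mul_of_nonneg_left h3 (by positivity : 0 ≤ 1 / (N : ℝ))
  rw [objective, objective]
  refine (by linarith : _ ≤ _).trans (h4.trans (le_of_eq ?_))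
  field_simp
  ring

/-- Young's inequality applied to the difference between local gradient and gradient at `x`. The
inner product of `v` with the client gradients is kept exact, since it averages to ‖v‖²; bounding it
client by client would bring in their dissimilarity. -/
lemma neg_mean_clientInner_le (hg : StochasticGradient σ f P g) (hf : Smooth β f)
    (hK : 1 ≤ K) (hN : 0 < N) (x : Vec d) :
    -((1 / (N : ℝ)) * ∑ i, clientInner f P g ηl x K (gradient (objective f) x) i) ≤
      -(1 / 2) * ‖gradient (objective f) x‖ ^ 2
        + β ^ 2 / 2 * ((1 / (N : ℝ)) * ∑ i, clientDrift f P g ηl x K i) := by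
  have hK' : (0 : ℝ) < K := by exact_mod_cast hK
  have hN' : (0 : ℝ) < N := by exact_mod_cast hN
  set v := gradient (objective f) x with hv
  have h : ∀ i, -clientInner f P g ηl x K v i ≤
      1 / 2 * ‖v‖ ^ 2 - inner ℝ (gradient (f i) x) v
        + β ^ 2 / 2 * clientDrift f P g ηl x K i := fun i => by
    have ho := hg.isOracle hf i
    have h1 : ∀ k ∈ Finset.range K,
        -∫ ζ, inner ℝ (gradient (f i) (localPoint (g i) (gradient (f i)) ηl x k ζ)) v
          ∂(Measure.infinitePi fun _ : ℕ => P i) ≤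
        (1 / 2 * ‖v‖ ^ 2 - inner ℝ (gradient (f i) x) v)
          + β ^ 2 / 2 * ∫ ζ, ‖localPoint (g i) (gradient (f i)) ηl x k ζ - x‖ ^ 2
          ∂(Measure.infinitePi fun _ : ℕ => P i) := fun k _ => by
      have hi : Integrable (fun ζ => inner ℝ (gradient (f i)
          (localPoint (g i) (gradient (f i)) ηl x k ζ)) v)
          (Measure.infinitePi fun _ : ℕ => P i) :=
        integrable_inner_of_memLp (memLp_gradient_localPoint hg hf x k i) (memLp_const _)
      have hi2 := (ho.integrable_sq_drift (η := ηl) x k).const_mul (β ^ 2 / 2)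
      have h2 := integral_mono hi.neg ((integrable_const
        (1 / 2 * ‖v‖ ^ 2 - inner ℝ (gradient (f i) x) v)).add hi2) fun ζ => by
          simp only [Pi.neg_apply, Pi.add_apply]
          have h5 := pow_le_pow_left₀ (norm_nonneg _)
            (ho.lipschitz (localPoint (g i) (gradient (f i)) ηl x k ζ) x) 2
          have h6 := norm_add_sq_real
            (gradient (f i) (localPoint (g i) (gradient (f i)) ηl x k ζ) - gradient (f i) x) v
          rw [inner_sub_left] at h6
          nlinarith [sq_nonneg ‖gradient (f i) (localPoint (g i) (gradient (f i)) ηl x k ζ)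
            - gradient (f i) x + v‖]
      simp only [Pi.neg_apply, Pi.add_apply] at h2
      rw [integral_neg, integral_add (integrable_const _) hi2, integral_const_mul] at h2
      simpa using h2
    have h3 := Finset.sum_le_sum h1
    rw [Finset.sum_neg_distrib, Finset.sum_add_distrib, Finset.sum_const, Finset.card_range,
      nsmul_eq_mul, ← Finset.mul_sum] at h3
    have h4 := mul_le_mul_of_nonneg_left h3 (by positivity : 0 ≤ 1 / (K : ℝ))
    rw [clientInner, clientDrift]
    refine (by linarith : _ ≤ _).trans (h4.trans (le_of_eq ?_))
    field_simp
  have h3 := Finset.sum_le_sum fun i (_ : i ∈ Finset.univ) => h i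
  rw [Finset.sum_neg_distrib, Finset.sum_add_distrib, Finset.sum_sub_distrib,
    Finset.sum_const, Finset.card_univ, Fintype.card_fin, nsmul_eq_mul,
    ← Finset.mul_sum, ← sum_inner] at h3
  have h4 := mul_le_mul_of_nonneg_left h3 (by positivity : 0 ≤ 1 / (N : ℝ))
  have h5 : 1 / (N : ℝ) * inner ℝ (∑ i, gradient (f i) x) v = ‖v‖ ^ 2 := by
    rw [← real_inner_self_eq_norm_sq v]
    nth_rw 2 [hv]
    rw [gradient_objective hf, inner_smul_left]
    simp
  have h6 : 1 / (N : ℝ) * (N * (1 / 2 * ‖v‖ ^ 2)) = 1 / 2 * ‖v‖ ^ 2 := by field_simp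
  rw [mul_add, mul_sub, h5, h6] at h4
  linarith

/-- The bound on the second moment of an update in terms of the dissimilarity bound `G² + q`. -/
lemma exists_roundStep_bound (hg : StochasticGradient σ f P g) (hf : Smooth β f)
    (hS : 1 ≤ S) (hSN : S ≤ N) (hK : 1 ≤ K) (hβ : 0 < β) (hηl : 0 < ηl) (hηg : 1 ≤ ηg)
    (hη : K * ηl * ηg * β ≤ 1 / 16) {q : ℝ} (hq : 0 ≤ q) {x : Vec d}
    (hV : (1 / (N : ℝ)) * ∑ i, ‖gradient (f i) x‖ ^ 2 ≤ G ^ 2 + q) :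
    0 ≤ (1 / (N : ℝ)) * ∑ i, clientDrift f P g ηl x K i ∧
    (1 / (N : ℝ)) * ∑ i, clientDrift f P g ηl x K i ≤
      (K * ηl * ηg) ^ 2 * (3 * (σ ^ 2 / (K * ηg ^ 2)) + 5 * (G ^ 2 + q)) ∧
    Integrable (fun ξ => ‖roundStep g S K ηl ηg x ξ - x‖ ^ 2) (roundLaw S P) ∧
    ∫ ξ, ‖roundStep g S K ηl ηg x ξ - x‖ ^ 2 ∂(roundLaw S P) ≤
      (K * ηl * ηg) ^ 2 * (3 * (σ ^ 2 / (K * S))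
        + 3 * (β ^ 2 * ((1 / (N : ℝ)) * ∑ i, clientDrift f P g ηl x K i))
        + 3 * (‖gradient (objective f) x‖ ^ 2
          + (2 * ((1 - (S : ℝ) / N) / S * G ^ 2) + q))) := by
  have hN : 0 < N := by omega
  have hK' : (0 : ℝ) < K := by exact_mod_cast hK
  have hηg0 : 0 < ηg := by linarith
  have hsmall : (ηl * β * K) ^ 2 ≤ 1 / 256 := by
    -- Here ηg ≥ 1 lets the bound on the effective step control the local step.
    have h1 : ηl * β * K ≤ 1 / 16 := by
      have : ηl * β * K * 1 ≤ ηl * β * K * ηg := by gcongr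
      linarith
    have h0 : 0 ≤ ηl * β * K := by positivity
    nlinarith
  obtain ⟨c, hc0, hc1, hc2, hc⟩ := integral_sq_norm_roundStep_le (ηl := ηl) (ηg := ηg) hg hf hS hSN hK
  refine ⟨?_, ?_, (hc x).1, (hc x).2.trans ?_⟩
  · refine mul_nonneg (by positivity) (Finset.sum_nonneg fun i _ => mul_nonneg (by positivity)
      (Finset.sum_nonneg fun k _ => integral_nonneg fun ζ => by positivity))
  · refine (mean_clientDrift_le hg hf hK hsmall hN x).trans ?_
    have h1 : (K * ηl * ηg) ^ 2 * (3 * (σ ^ 2 / (K * ηg ^ 2))) = 3 * ηl ^ 2 * K * σ ^ 2 := by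
      field_simp
    have h2 : 5 * ηl ^ 2 * K ^ 2 * (1 / (N : ℝ) * ∑ i, ‖gradient (f i) x‖ ^ 2) ≤
        5 * ηl ^ 2 * K ^ 2 * ηg ^ 2 * (G ^ 2 + q) := by
      have h3 : 5 * ηl ^ 2 * K ^ 2 * 1 ≤ 5 * ηl ^ 2 * K ^ 2 * ηg ^ 2 := by
        gcongr; nlinarith
      rw [mul_one] at h3
      exact mul_le_mul h3 hV (by positivity) (by positivity)
    nlinarith
  -- Two bounds on the same `c`: the sharp one multiplies G² and keeps the factor 1 − S/N, while c ≤
  -- 1 suffices for `q`.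
  · have h4 : c * (1 / (N : ℝ) * ∑ i, ‖gradient (f i) x‖ ^ 2) ≤
        2 * ((1 - (S : ℝ) / N) / S * G ^ 2) + q := by
      have h5 := mul_le_mul_of_nonneg_left hV hc0
      have h6 := mul_le_mul_of_nonneg_right hc2 (sq_nonneg G)
      nlinarith
    gcongr

/-- The three parts of M²/(KS): noise averaged over all samples of a round, noise entering through
the drift, and the variance of client sampling. -/
lemma sqM_div (hS : 1 ≤ S) (hK : 1 ≤ K) (hηg : 1 ≤ ηg) : sqM N S K σ G ηg / (K * S) =
    σ ^ 2 / (K * S) + σ ^ 2 / (K * ηg ^ 2) + (1 - (S : ℝ) / N) / S * G ^ 2 := by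
  have hK' : (0 : ℝ) < K := by exact_mod_cast hK
  have hS' : (0 : ℝ) < S := by exact_mod_cast hS
  have hηg0 : 0 < ηg := by linarith
  rw [sqM]
  field_simp

variable (hg : StochasticGradient σ f P g) (hf : Smooth β f) (hS : 1 ≤ S) (hSN : S ≤ N)
  (hK : 1 ≤ K) (hβ : 0 < β) (hηl : 0 < ηl) (hηg : 1 ≤ ηg) (hB : 1 ≤ B)
  (hη : 8 * (1 + B ^ 2) * β * (K * ηl * ηg) ≤ 1)
include hg hf hS hSN hK hβ hηl hηg hB hη

/-- One round decreases the squared distance to the minimizer. -/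
lemma roundStep_convex (hμ : 0 ≤ μ) (hc : MuConvex μ f) {xstar : Vec d}
    (hmin : ∀ x, objective f xstar ≤ objective f x)
    (hV : RelaxedDissimilarity β G B (objective f xstar) f) (x : Vec d) :
    Integrable (fun ξ => ‖roundStep g S K ηl ηg x ξ - xstar‖ ^ 2) (roundLaw S P) ∧
    ∫ ξ, ‖roundStep g S K ηl ηg x ξ - xstar‖ ^ 2 ∂(roundLaw S P) ≤
      (1 - μ * (K * ηl * ηg) / 2) * ‖x - xstar‖ ^ 2
        - (K * ηl * ηg) * (objective f x - objective f xstar)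
        + ((K * ηl * ηg) ^ 2 * (6 * (sqM N S K σ G ηg / (K * S)))
          + (K * ηl * ηg) ^ 3 * (11 * β * G ^ 2)) := by
  have hN : 0 < N := by omega
  have hK' : (0 : ℝ) < K := by exact_mod_cast hK
  have hS' : (0 : ℝ) < S := by exact_mod_cast hS
  have hηg0 : 0 < ηg := by linarith
  have hprob := isProbabilityMeasure_samplingLaw hSN
  have hprob2 : IsProbabilityMeasure (roundLaw S P) :=
    inferInstanceAs (IsProbabilityMeasure ((samplingLaw N S).prod _))
  have he : 0 ≤ objective f x - objective f xstar := sub_nonneg.2 (hmin x)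
  have hη0 : 0 < K * ηl * ηg := by positivity
  have hB2 : 1 ≤ B ^ 2 := by nlinarith
  have hu0 : 0 < K * ηl * ηg * β := by positivity
  have huw : K * ηl * ηg * β + K * ηl * ηg * β * B ^ 2 ≤ 1 / 8 := by linarith
  have hu : K * ηl * ηg * β ≤ 1 / 16 := by nlinarith
  obtain ⟨hE0, hE, hint, hsq⟩ := exists_roundStep_bound hg hf hS hSN hK hβ hηl hηg hu
    (q := 2 * β * B ^ 2 * (objective f x - objective f xstar)) (by positivity) (hV x)
  obtain ⟨hint2, hlin⟩ := integral_inner_roundStep (ηl := ηl) (ηg := ηg) hg hf hS hSN hK x (x - xstar)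
  have hconv := neg_mean_clientInner_le_of_convex (ηl := ηl) hg hf hK hN hμ hc x xstar
  have hgrad := sq_norm_gradient_le hβ (differentiable_objective hf)
    (gradient_objective_lipschitz hN hf) hmin x
  have hexp : ∀ ξ, ‖roundStep g S K ηl ηg x ξ - xstar‖ ^ 2 = ‖x - xstar‖ ^ 2
      + 2 * inner ℝ (roundStep g S K ηl ηg x ξ - x) (x - xstar)
      + ‖roundStep g S K ηl ηg x ξ - x‖ ^ 2 := fun ξ => by
    rw [← sub_add_sub_cancel (roundStep g S K ηl ηg x ξ) x xstar, norm_add_sq_real]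
    ring
  have hi1 : Integrable (fun ξ => ‖x - xstar‖ ^ 2
      + 2 * inner ℝ (roundStep g S K ηl ηg x ξ - x) (x - xstar)) (roundLaw S P) :=
    (integrable_const _).add (hint2.const_mul 2)
  simp only [hexp]
  refine ⟨hi1.add hint, ?_⟩
  rw [integral_add hi1 hint, integral_add (integrable_const _) (hint2.const_mul 2),
    integral_const_mul, hlin, sqM_div hS hK hηg]
  simp only [integral_const, probReal_univ, one_smul]
  set E := (1 / (N : ℝ)) * ∑ i, clientDrift f P g ηl x K i
  set I := (1 / (N : ℝ)) * ∑ i, clientInner f P g ηl x K (x - xstar) i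
  set e := objective f x - objective f xstar
  set D := ‖x - xstar‖ ^ 2
  set Γ := ‖gradient (objective f) x‖ ^ 2
  set η := K * ηl * ηg
  have hA : 0 ≤ σ ^ 2 / (K * S) := by positivity
  have hA' : 0 ≤ σ ^ 2 / (K * ηg ^ 2) := by positivity
  set A := σ ^ 2 / (K * S)
  set A' := σ ^ 2 / (K * ηg ^ 2)
  set Gs := (1 - (S : ℝ) / N) / S * G ^ 2
  have h1 : η * (-I) ≤ η * (-e - μ / 4 * D + β * E) := mul_le_mul_of_nonneg_left hconv hη0.le
  have h2 : η ^ 2 * Γ ≤ η * (η * β) * (2 * e) := by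
    calc η ^ 2 * Γ ≤ η ^ 2 * (2 * β * e) := by gcongr
      _ = _ := by ring
  have h3 : η * β * E ≤ η * β * (η ^ 2 * (3 * A' + 5 * (G ^ 2 + 2 * β * B ^ 2 * e))) := by gcongr
  have h4 : η ^ 2 * (β ^ 2 * E) ≤ 1 / 16 * (η * β * E) := by
    have : 0 ≤ η * β * E := by positivity
    nlinarith
  have h5 : η * β * (η ^ 2 * A') ≤ 1 / 16 * (η ^ 2 * A') := by gcongr
  have h6 : (η * β) * (η * β * B ^ 2) ≤ 1 / 16 * (1 / 8) := by
    have : η * β * B ^ 2 ≤ 1 / 8 := by linarith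
    gcongr
  have h7 : (η * β) * (η * β * B ^ 2) * (η * e) ≤ 1 / 16 * (1 / 8) * (η * e) := by gcongr
  have h8 : (η * β + η * β * B ^ 2) * (η * e) ≤ 1 / 8 * (η * e) := by gcongr
  have h9 : 0 ≤ η ^ 2 * A := by positivity
  have h10 : 0 ≤ η ^ 2 * A' := by positivity
  have h12 : 0 ≤ η * e := by positivity
  have h13 : 0 ≤ η ^ 3 * (β * G ^ 2) := by positivity
  -- The drift has weight 2 from convexity and at most 3/16 from the second moment, in total 35/16;
  -- times 5 this gives 175/16 ≤ 11 in front of βG². The objective gap has coefficient −2 from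
  -- convexity, at most 6/8 from the second moment and at most 350/2048 from the drift, which sums
  -- to −1 − 81/1024.
  linear_combination hsq + 2 * h1 + 3 * h2 + (35 / 16) * h3 + 3 * h4 + (105 / 16) * h5
    + (350 / 16) * h7 + 6 * h8 + 3 * h9 + (6 - 105 / 256) * h10 + (81 / 1024) * h12
    + (1 / 16) * h13

/-- One round decreases the objective. -/
lemma roundStep_nonconvex {fstar : ℝ} (hmin : ∀ x, fstar ≤ objective f x)
    (hV : BoundedDissimilarity G B f) (x : Vec d) :
    Integrable (fun ξ => objective f (roundStep g S K ηl ηg x ξ) - fstar) (roundLaw S P) ∧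
    ∫ ξ, (objective f (roundStep g S K ηl ηg x ξ) - fstar) ∂(roundLaw S P) ≤
      (objective f x - fstar) - (K * ηl * ηg) / 4 * ‖gradient (objective f) x‖ ^ 2
        + ((K * ηl * ηg) ^ 2 * (3 * β * (sqM N S K σ G ηg / (K * S)))
          + (K * ηl * ηg) ^ 3 * (3 * β ^ 2 * G ^ 2)) := by
  have hN : 0 < N := by omega
  have hK' : (0 : ℝ) < K := by exact_mod_cast hK
  have hS' : (0 : ℝ) < S := by exact_mod_cast hS
  have hηg0 : 0 < ηg := by linarith
  have hprob := isProbabilityMeasure_samplingLaw hSN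
  have hprob2 : IsProbabilityMeasure (roundLaw S P) :=
    inferInstanceAs (IsProbabilityMeasure ((samplingLaw N S).prod _))
  have hη0 : 0 < K * ηl * ηg := by positivity
  have hB2 : 1 ≤ B ^ 2 := by nlinarith
  have hu0 : 0 < K * ηl * ηg * β := by positivity
  have huw : K * ηl * ηg * β + K * ηl * ηg * β * B ^ 2 ≤ 1 / 8 := by linarith
  have hu : K * ηl * ηg * β ≤ 1 / 16 := by nlinarith
  obtain ⟨hE0, hE, hint, hsq⟩ := exists_roundStep_bound hg hf hS hSN hK hβ hηl hηg hu
    (q := B ^ 2 * ‖gradient (objective f) x‖ ^ 2) (by positivity) (hV x)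
  obtain ⟨hint2, hlin⟩ := integral_inner_roundStep (ηl := ηl) (ηg := ηg) hg hf hS hSN hK x
    (gradient (objective f) x)
  have hdir := neg_mean_clientInner_le (ηl := ηl) hg hf hK hN x
  have hi1 : Integrable (fun ξ => objective f x - fstar
      + inner ℝ (roundStep g S K ηl ηg x ξ - x) (gradient (objective f) x)) (roundLaw S P) :=
    (integrable_const _).add hint2
  have hle : ∀ ξ, objective f (roundStep g S K ηl ηg x ξ) - fstar ≤ objective f x - fstar
      + inner ℝ (roundStep g S K ηl ηg x ξ - x) (gradient (objective f) x)
      + β / 2 * ‖roundStep g S K ηl ηg x ξ - x‖ ^ 2 := fun ξ => by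
    have := le_quadratic (differentiable_objective hf) (gradient_objective_lipschitz hN hf) x
      (roundStep g S K ηl ηg x ξ)
    rw [real_inner_comm] at this
    linarith
  have hm : Measurable fun ξ => objective f (roundStep g S K ηl ηg x ξ) - fstar :=
    ((differentiable_objective hf).continuous.measurable.comp
      ((measurable_roundStep hg).comp measurable_prodMk_left)).sub_const _
  have hi2 := hi1.add (hint.const_mul (β / 2))
  -- The objective is not assumed integrable along the run: it lies between `fstar` and the
  -- integrable quadratic upper bound.
  have hi3 : Integrable (fun ξ => objective f (roundStep g S K ηl ηg x ξ) - fstar)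
      (roundLaw S P) :=
    hi2.mono' hm.aestronglyMeasurable (Filter.Eventually.of_forall fun ξ => by
      rw [Real.norm_of_nonneg (sub_nonneg.2 (hmin _))]
      exact hle ξ)
  refine ⟨hi3, (integral_mono hi3 hi2 hle).trans ?_⟩
  simp only [Pi.add_apply]
  rw [integral_add hi1 (hint.const_mul (β / 2)), integral_add (integrable_const _) hint2,
    integral_const_mul, hlin, sqM_div hS hK hηg]
  simp only [integral_const, probReal_univ, one_smul]
  set E := (1 / (N : ℝ)) * ∑ i, clientDrift f P g ηl x K i
  set I := (1 / (N : ℝ)) * ∑ i, clientInner f P g ηl x K (gradient (objective f) x) i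
  set e := objective f x - fstar
  set Γ := ‖gradient (objective f) x‖ ^ 2
  have hΓ : 0 ≤ Γ := sq_nonneg _
  set η := K * ηl * ηg
  have hA : 0 ≤ σ ^ 2 / (K * S) := by positivity
  have hA' : 0 ≤ σ ^ 2 / (K * ηg ^ 2) := by positivity
  set A := σ ^ 2 / (K * S)
  set A' := σ ^ 2 / (K * ηg ^ 2)
  set Gs := (1 - (S : ℝ) / N) / S * G ^ 2
  have h1 : η * (-I) ≤ η * (-(1 / 2) * Γ + β ^ 2 / 2 * E) :=
    mul_le_mul_of_nonneg_left hdir hη0.le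
  have h0 := mul_le_mul_of_nonneg_left hsq (by positivity : 0 ≤ β / 2)
  have h3 : η * β ^ 2 * E ≤ η * β ^ 2 * (η ^ 2 * (3 * A' + 5 * (G ^ 2 + B ^ 2 * Γ))) := by gcongr
  have h4 : η ^ 2 * (β ^ 3 * E) ≤ 1 / 16 * (η * β ^ 2 * E) := by
    have : 0 ≤ η * β ^ 2 * E := by positivity
    nlinarith
  have h5 : η * β * (η ^ 2 * β * A') ≤ 1 / 16 * (η ^ 2 * β * A') := by gcongr
  have h6 : (η * β) * (η * β * B ^ 2) ≤ 1 / 16 * (1 / 8) := by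
    have : η * β * B ^ 2 ≤ 1 / 8 := by linarith
    gcongr
  have h7 : (η * β) * (η * β * B ^ 2) * (η * Γ) ≤ 1 / 16 * (1 / 8) * (η * Γ) := by gcongr
  have h8 : (η * β + η * β * B ^ 2) * (η * Γ) ≤ 1 / 8 * (η * Γ) := by gcongr
  have h9 : 0 ≤ η ^ 2 * (β * A) := by positivity
  have h10 : 0 ≤ η ^ 2 * (β * A') := by positivity
  have h12 : 0 ≤ η * Γ := by positivity
  have h13 : 0 ≤ η ^ 3 * (β ^ 2 * G ^ 2) := by positivity
  -- As in the convex case: the drift has weight 1/2 + 3/32 = 19/32, hence 95/32 ≤ 3 in front of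
  -- β²G², and ‖∇f‖² has coefficient at most −1/2 + 3/16 + 95/4096 ≤ −1/4.
  linear_combination h0 + h1 + (19 / 32) * h3 + (3 / 2) * h4 + (57 / 32) * h5
    + (95 / 32) * h7 + (3 / 2) * h8 + (3 / 2) * h9 + (3 - 57 / 512) * h10
    + (1 / 4 - 3 / 16 - 95 / 4096) * h12 + (1 / 32) * h13

end Progress

/-! ### The whole run -/

section Run

variable {d N S K : ℕ} {Z : Type*} [MeasurableSpace Z] {f : Fin N → Vec d → ℝ}
  {P : Fin N → Measure Z} [∀ i, IsProbabilityMeasure (P i)] {g : Fin N → Vec d → Z → Vec d}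
  {σ ηl ηg : ℝ} {x0 : Vec d} {err : Vec d → ℝ}

/-- The expected error of the server models along a run satisfies a descent recursion: a
nonnegative potential, starting at `D0`, contracts by `1 - a` and decreases by `η` times the error,
up to `v`. -/
def Descends (P : Fin N → Measure Z) (g : Fin N → Vec d → Z → Vec d) (S K : ℕ) (ηl ηg : ℝ)
    (x0 : Vec d) (err : Vec d → ℝ) (D0 a η v : ℝ) : Prop :=
  (∀ r, Integrable (fun ω => err (serverIter g S K ηl ηg x0 ω r)) (runLaw S P)) ∧
  ∃ D : ℕ → ℝ, D 0 = D0 ∧ (∀ r, 0 ≤ D r) ∧ ∀ r, D (r + 1) ≤ (1 - a) * D r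
    - η * ∫ ω, err (serverIter g S K ηl ηg x0 ω r) ∂(runLaw S P) + v

lemma serverIter_eq_orbit (ω : ℕ → Round N Z) (r : ℕ) :
    serverIter g S K ηl ηg x0 ω r = orbit (roundStep g S K ηl ηg) x0 ω r := by
  induction r with
  | zero => rfl
  | succ r ih => rw [serverIter, ih]; rfl

lemma isProbabilityMeasure_roundLaw (hSN : S ≤ N) : IsProbabilityMeasure (roundLaw S P) :=
  have := isProbabilityMeasure_samplingLaw hSN
  inferInstanceAs (IsProbabilityMeasure ((samplingLaw N S).prod _))

lemma measurable_serverIter (hg : StochasticGradient σ f P g) (r : ℕ) :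
    Measurable fun ω => serverIter g S K ηl ηg x0 ω r := by
  simp only [serverIter_eq_orbit]
  exact measurable_orbit (measurable_roundStep hg) x0 r

/-- The server model depends only on earlier rounds, so the bound at a fixed starting point
integrates over its law. The domination `err ≤ c φ` serves only to make the errors integrable. -/
lemma descends_of_step (hg : StochasticGradient σ f P g) (hSN : S ≤ N) {φ : Vec d → ℝ}
    {a η v c : ℝ} (hφm : Measurable φ) (hem : Measurable err) (hφ0 : ∀ x, 0 ≤ φ x)
    (he0 : ∀ x, 0 ≤ err x) (hec : ∀ x, err x ≤ c * φ x)
    (hstep : ∀ x, Integrable (fun ξ => φ (roundStep g S K ηl ηg x ξ)) (roundLaw S P) ∧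
      ∫ ξ, φ (roundStep g S K ηl ηg x ξ) ∂(roundLaw S P) ≤ (1 - a) * φ x - η * err x + v) :
    Descends P g S K ηl ηg x0 err (φ x0) a η v := by
  have := isProbabilityMeasure_roundLaw (P := P) hSN
  have hprob : IsProbabilityMeasure (runLaw S P) := by unfold runLaw; infer_instance
  have hXm : ∀ r, Measurable fun ω => serverIter g S K ηl ηg x0 ω r := fun r =>
    measurable_serverIter hg r
  have herr : ∀ r, Integrable (fun ω => φ (serverIter g S K ηl ηg x0 ω r)) (runLaw S P) →
      Integrable (fun ω => err (serverIter g S K ηl ηg x0 ω r)) (runLaw S P) := fun r h =>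
    (h.const_mul c).mono' (hem.comp (hXm r)).aestronglyMeasurable
      (Filter.Eventually.of_forall fun ω => by
        rw [Real.norm_of_nonneg (he0 _)]; exact hec _)
  have hsucc : ∀ r, Integrable (fun ω => φ (serverIter g S K ηl ηg x0 ω r)) (runLaw S P) →
      Integrable (fun ω => φ (serverIter g S K ηl ηg x0 ω (r + 1))) (runLaw S P) ∧
      ∫ ω, φ (serverIter g S K ηl ηg x0 ω (r + 1)) ∂(runLaw S P) ≤
        (1 - a) * ∫ ω, φ (serverIter g S K ηl ηg x0 ω r) ∂(runLaw S P)
        - η * ∫ ω, err (serverIter g S K ηl ηg x0 ω r) ∂(runLaw S P) + v := by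
    intro r hr
    have hmap : (runLaw S P).map (fun ω => ω r) = roundLaw S P :=
      Measure.infinitePi_map_eval _ r
    have hind : IndepFun (fun ω => serverIter g S K ηl ηg x0 ω r) (fun ω => ω r) (runLaw S P) := by
      simp only [serverIter_eq_orbit]
      exact indepFun_orbit (roundLaw S P) (measurable_roundStep hg) x0 r
    have hψi : Integrable (fun ω => (1 - a) * φ (serverIter g S K ηl ηg x0 ω r)
        - η * err (serverIter g S K ηl ηg x0 ω r)) (runLaw S P) :=
      (hr.const_mul _).sub ((herr r hr).const_mul _)
    have key := integral_pair_le
      (φ := fun p : Vec d × Round N Z => φ (roundStep g S K ηl ηg p.1 p.2))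
      (ψ := fun x => (1 - a) * φ x - η * err x + v) (hXm r) (measurable_pi_apply r) hind
      (hφm.comp (measurable_roundStep hg)) (fun p => hφ0 _)
      (fun x => by rw [hmap]; exact (hstep x).1) (fun x => by rw [hmap]; exact (hstep x).2)
      (((hφm.const_mul _).sub (hem.const_mul _)).add_const v) (hψi.add (integrable_const v))
    refine ⟨key.1, key.2.trans (le_of_eq ?_)⟩
    rw [integral_add hψi (integrable_const v),
      integral_sub (hr.const_mul _) ((herr r hr).const_mul _), integral_const_mul,
      integral_const_mul]
    simp
  have hint : ∀ r, Integrable (fun ω => φ (serverIter g S K ηl ηg x0 ω r)) (runLaw S P) := by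
    intro r
    induction r with
    | zero =>
      change Integrable (fun _ => φ x0) (runLaw S P)
      exact integrable_const _
    | succ r ih => exact (hsucc r ih).1
  refine ⟨fun r => herr r (hint r),
    fun r => ∫ ω, φ (serverIter g S K ηl ηg x0 ω r) ∂(runLaw S P), ?_,
    fun r => integral_nonneg fun ω => hφ0 _, fun r => (hsucc r (hint r)).2⟩
  simp [serverIter]

/-- The error of the output is the weighted mean of the errors of the server models. -/
lemma outputErrorLE_of_sum_le (hg : StochasticGradient σ f P g) (hem : Measurable err)
    (hint : ∀ r, Integrable (fun ω => err (serverIter g S K ηl ηg x0 ω r)) (runLaw S P))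
    {R : ℕ} {b : ℝ} (w : ℕ → ℝ) (hw : ∀ r, 0 ≤ w r) (hpos : 0 < ∑ r ∈ Finset.range (R + 1), w r)
    (hb : ∑ r ∈ Finset.range (R + 1),
      w r * ∫ ω, err (serverIter g S K ηl ηg x0 ω r) ∂(runLaw S P)
        ≤ b * ∑ r ∈ Finset.range (R + 1), w r) :
    OutputErrorLE P g S K ηl ηg x0 R err b := by
  have hXm : ∀ r, Measurable fun ω => serverIter g S K ηl ηg x0 ω r := fun r =>
    measurable_serverIter hg r
  have hi : ∀ r ∈ Finset.range (R + 1), Integrable err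
      (ENNReal.ofReal (w r / ∑ t ∈ Finset.range (R + 1), w t) •
        (runLaw S P).map (fun ω => serverIter g S K ηl ηg x0 ω r)) := fun r _ =>
    ((integrable_map_measure hem.aestronglyMeasurable (hXm r).aemeasurable).2
      (hint r)).smul_measure ENNReal.ofReal_ne_top
  refine ⟨w, hw, hpos, integrable_finsetSum_measure.2 hi, ?_⟩
  rw [outputLaw, integral_finsetSum_measure hi]
  have h1 : ∀ r ∈ Finset.range (R + 1), ∫ x, err x
      ∂(ENNReal.ofReal (w r / ∑ t ∈ Finset.range (R + 1), w t) •
        (runLaw S P).map (fun ω => serverIter g S K ηl ηg x0 ω r))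
      = (w r * ∫ ω, err (serverIter g S K ηl ηg x0 ω r) ∂(runLaw S P))
        / ∑ t ∈ Finset.range (R + 1), w t := fun r _ => by
    rw [integral_smul_measure, ENNReal.toReal_ofReal (div_nonneg (hw r) hpos.le),
      integral_map (hXm r).aemeasurable hem.aestronglyMeasurable, smul_eq_mul]
    ring
  rw [Finset.sum_congr rfl h1, ← Finset.sum_div, div_le_iff₀ hpos]
  exact hb

lemma OutputErrorLE.mono {R : ℕ} {b b' : ℝ} (h : OutputErrorLE P g S K ηl ηg x0 R err b)
    (hb : b ≤ b') : OutputErrorLE P g S K ηl ηg x0 R err b' := by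
  obtain ⟨w, h1, h2, h3, h4⟩ := h
  exact ⟨w, h1, h2, h3, h4.trans hb⟩

variable {D0 a η v : ℝ}

/-- The output may be the initial model. -/
lemma Descends.outputErrorLE_initial (hg : StochasticGradient σ f P g) (hem : Measurable err)
    (hSN : S ≤ N) (h : Descends P g S K ηl ηg x0 err D0 a η v) (R : ℕ) {b : ℝ} (hb : err x0 ≤ b) :
    OutputErrorLE P g S K ηl ηg x0 R err b := by
  have := isProbabilityMeasure_roundLaw (P := P) hSN
  have hprob : IsProbabilityMeasure (runLaw S P) := by unfold runLaw; infer_instance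
  have hs : ∀ c : ℕ → ℝ, ∑ r ∈ Finset.range (R + 1), (if r = 0 then 1 else 0) * c r = c 0 :=
    fun c => by simp
  have h1 := hs fun _ => 1
  simp only [mul_one] at h1
  refine outputErrorLE_of_sum_le hg hem h.1 (fun r => if r = 0 then 1 else 0)
    (fun r => by positivity) (by rw [h1]; norm_num) ?_
  rw [hs, h1]
  simpa [serverIter] using hb

/-- Uniform averaging. -/
lemma Descends.outputErrorLE_uniform (hg : StochasticGradient σ f P g) (hem : Measurable err)
    (hη : 0 < η) (h : Descends P g S K ηl ηg x0 err D0 0 η v) (R : ℕ) :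
    OutputErrorLE P g S K ηl ηg x0 R err (D0 / (η * (R + 1)) + v / η) := by
  obtain ⟨hint, D, hD0, hDnn, hD⟩ := h
  refine outputErrorLE_of_sum_le hg hem hint (fun _ => 1) (fun _ => zero_le_one) ?_ ?_
  · simp; positivity
  · set e : ℕ → ℝ := fun r => ∫ ω, err (serverIter g S K ηl ηg x0 ω r) ∂(runLaw S P) with he
    have hsum : ∀ n : ℕ, η * ∑ r ∈ Finset.range n, e r ≤ D0 - D n + n * v := by
      intro n
      induction n with
      | zero => simp [hD0]
      | succ n ih =>
        rw [Finset.sum_range_succ]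
        have := hD n
        push_cast
        simp only [sub_zero, one_mul] at this
        simp only [he] at ih ⊢
        linarith
    have h1 := hsum (R + 1)
    have h2 := hDnn (R + 1)
    simp only [one_mul, Finset.sum_const, Finset.card_range, nsmul_eq_mul, mul_one]
    push_cast at h1 ⊢
    rw [show (D0 / (η * (R + 1)) + v / η) * (R + 1 : ℝ) = (D0 + (R + 1) * v) / η by
      field_simp, le_div_iff₀ hη]
    linarith

/-- Exponentially weighted averaging. -/
lemma Descends.outputErrorLE_exponential (hg : StochasticGradient σ f P g) (hem : Measurable err)
    (hη : 0 < η) (h : Descends P g S K ηl ηg x0 err D0 a η v) (R : ℕ) (ha : 0 < a) (ha1 : a < 1)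
    (haR : 1 / 2 ≤ a * R) (hD00 : 0 ≤ D0) :
    OutputErrorLE P g S K ηl ηg x0 R err (3 * (a / η) * D0 * Real.exp (-(a * R)) + v / η) := by
  obtain ⟨hint, D, hD0, hDnn, hD⟩ := h
  have hq : 0 < 1 - a := by linarith
  -- The weights p^(r+1) undo the contraction, so the weighted recursion telescopes.
  set p := (1 - a)⁻¹ with hp
  have hp0 : 0 < p := inv_pos.2 hq
  have hpa : p * (1 - a) = 1 := inv_mul_cancel₀ hq.ne'
  have hW0 : 0 < ∑ r ∈ Finset.range (R + 1), p ^ (r + 1) :=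
    Finset.sum_pos (fun r _ => by positivity) (by simp)
  refine outputErrorLE_of_sum_le hg hem hint (fun r => p ^ (r + 1)) (fun r => by positivity) hW0 ?_
  set e : ℕ → ℝ := fun r => ∫ ω, err (serverIter g S K ηl ηg x0 ω r) ∂(runLaw S P) with he
  have hsum : ∀ n : ℕ, η * ∑ r ∈ Finset.range n, p ^ (r + 1) * e r ≤
      D0 - p ^ n * D n + v * ∑ r ∈ Finset.range n, p ^ (r + 1) := by
    intro n
    induction n with
    | zero => simp [hD0]
    | succ n ih =>
      rw [Finset.sum_range_succ, Finset.sum_range_succ]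
      have h1 := mul_le_mul_of_nonneg_left (hD n) (pow_pos hp0 (n + 1)).le
      have h2 : p ^ (n + 1) * ((1 - a) * D n) = p ^ n * D n := by
        rw [pow_succ]; linear_combination p ^ n * D n * hpa
      rw [mul_add, mul_sub, h2] at h1
      simp only [he] at ih ⊢
      linarith
  have hgeom : ∀ n : ℕ, a * ∑ r ∈ Finset.range n, p ^ (r + 1) = p ^ n - 1 := by
    intro n
    induction n with
    | zero => simp
    | succ n ih =>
      rw [Finset.sum_range_succ, mul_add, ih, pow_succ]
      linear_combination (-p ^ n) * hpa
  set W := ∑ r ∈ Finset.range (R + 1), p ^ (r + 1)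
  have hexp : Real.exp (a * R) ≤ p ^ (R + 1) := by
    have h1 : Real.exp a ≤ p := by
      rw [hp, ← Real.exp_log (inv_pos.2 hq), Real.exp_le_exp, Real.log_inv]
      have := Real.log_le_sub_one_of_pos hq
      linarith
    calc Real.exp (a * R) ≤ Real.exp ((R + 1 : ℕ) * a) := by
          rw [Real.exp_le_exp]; push_cast; nlinarith
      _ = Real.exp a ^ (R + 1) := Real.exp_nat_mul _ _
      _ ≤ _ := pow_le_pow_left₀ (Real.exp_pos _).le h1 _
  have h32 : 3 / 2 ≤ Real.exp (a * R) := by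
    have := Real.add_one_le_exp (a * R)
    linarith
  -- The geometric sum is a·W = p^(R+1) − 1 ≥ e^{aR} − 1. Once e^{aR} ≥ 3/2, which a·R ≥ 1/2
  -- ensures, subtracting 1 leaves at least a third.
  have hWexp : 1 ≤ 3 * a * Real.exp (-(a * R)) * W := by
    have h1 := hgeom (R + 1)
    have h2 : Real.exp (a * R) ≤ 3 * (a * W) := by
      have : a * W = p ^ (R + 1) - 1 := h1
      linarith
    have h3 : Real.exp (-(a * R)) * Real.exp (a * R) = 1 := by
      rw [← Real.exp_add]; simp
    have := mul_le_mul_of_nonneg_left h2 (Real.exp_pos (-(a * R))).le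
    linarith
  have h1 := hsum (R + 1)
  have h2 := mul_nonneg (pow_pos hp0 (R + 1)).le (hDnn (R + 1))
  have h3 := mul_le_mul_of_nonneg_left hWexp hD00
  rw [show (3 * (a / η) * D0 * Real.exp (-(a * R)) + v / η) * W
    = (D0 * (3 * a * Real.exp (-(a * R)) * W) + v * W) / η by field_simp, le_div_iff₀ hη]
  have h4 : η * ∑ r ∈ Finset.range (R + 1), p ^ (r + 1) * e r
      = (∑ r ∈ Finset.range (R + 1), p ^ (r + 1) * e r) * η := mul_comm _ _
  rw [← h4]
  linarith

end Run

/-! ### Choice of the step-size -/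

section Tuning

variable {d N S K : ℕ} {Z : Type*} [MeasurableSpace Z] {f : Fin N → Vec d → ℝ}
  {P : Fin N → Measure Z} [∀ i, IsProbabilityMeasure (P i)] {g : Fin N → Vec d → Z → Vec d}
  {σ ηg : ℝ} {x0 : Vec d} {err : Vec d → ℝ} {D0 b c₁ c₂ μ : ℝ}
  (hg : StochasticGradient σ f P g) (hem : Measurable err) (hSN : S ≤ N)
  (hK : 1 ≤ K) (hηg : 0 < ηg) (hb : 0 < b) (hc₁ : 0 ≤ c₁) (hc₂ : 0 ≤ c₂) (hD0 : 0 ≤ D0)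

/-- The recursion depends on the local step only through the effective step, so the latter can be
chosen freely. -/
lemma exists_localStep (hK : 1 ≤ K) (hηg : 0 < ηg) {η : ℝ} (hη : 0 < η) :
    ∃ ηl : ℝ, 0 < ηl ∧ K * ηl * ηg = η := by
  have hK' : (0 : ℝ) < K := by exact_mod_cast hK
  exact ⟨η / (K * ηg), by positivity, by field_simp⟩

include hg hem hSN hK hηg hb hc₁ hc₂ hD0

/-- Number of rounds that suffice when there is no contraction. -/
lemma exists_rounds_sublinear
    (h : ∀ ηl : ℝ, 0 < ηl → b * (K * ηl * ηg) ≤ 1 → Descends P g S K ηl ηg x0 err D0 0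
      (K * ηl * ηg) ((K * ηl * ηg) ^ 2 * c₁ + (K * ηl * ηg) ^ 3 * c₂)) {ε : ℝ} (hε : 0 < ε) :
    ∃ (R : ℕ) (ηl : ℝ), (R : ℝ) ≤ 3 * D0 / ε * (b + 3 * c₁ / ε + √(3 * c₂ / ε)) ∧ 0 < ηl ∧
      b * (K * ηl * ηg) ≤ 1 ∧ OutputErrorLE P g S K ηl ηg x0 R err ε := by
  -- η ≤ 1/s makes ηc₁ ≤ ε/3, η ≤ 1/t makes η²c₂ ≤ ε/3, and η ≤ 1/b is admissibility. The choice
  -- 1/(b+s+t) meets all three and has an inverse that splits additively.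
  set s := 3 * c₁ / ε with hs
  set t := √(3 * c₂ / ε) with ht
  have hs0 : 0 ≤ s := by positivity
  have ht0 : 0 ≤ t := Real.sqrt_nonneg _
  have ht2 : t ^ 2 = 3 * c₂ / ε := Real.sq_sqrt (by positivity)
  have hq : 0 < b + s + t := by positivity
  obtain ⟨ηl, hηl, hη⟩ := exists_localStep (ηg := ηg) hK hηg (inv_pos.2 hq)
  set η := (b + s + t)⁻¹
  have hη0 : 0 < η := inv_pos.2 hq
  have hηq : η * (b + s + t) = 1 := inv_mul_cancel₀ hq.ne'
  have hηb : b * η ≤ 1 := by nlinarith [mul_nonneg hη0.le hs0, mul_nonneg hη0.le ht0]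
  have hηs : η * s ≤ 1 := by nlinarith [mul_nonneg hη0.le hb.le, mul_nonneg hη0.le ht0]
  have hηt : η * t ≤ 1 := by nlinarith [mul_nonneg hη0.le hb.le, mul_nonneg hη0.le hs0]
  have hdesc := h ηl hηl (by rw [hη]; exact hηb)
  rw [hη] at hdesc
  -- Rounding down suffices because R rounds produce R + 1 models; no additive 1 is lost.
  refine ⟨⌊3 * D0 / ε * (b + s + t)⌋₊, ηl, Nat.floor_le (by positivity), hηl,
    by rw [hη]; exact hηb, (hdesc.outputErrorLE_uniform hg hem hη0 _).mono ?_⟩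
  have hR := (Nat.lt_floor_add_one (3 * D0 / ε * (b + s + t))).le
  set R : ℝ := (⌊3 * D0 / ε * (b + s + t)⌋₊ : ℝ)
  have hR0 : 0 ≤ R := Nat.cast_nonneg _
  have h1 : D0 / (η * (R + 1)) ≤ ε / 3 := by
    rw [div_le_iff₀ (by positivity)]
    have h2 := mul_le_mul_of_nonneg_left hR (by positivity : 0 ≤ η * (ε / 3))
    have h3 : η * (ε / 3) * (3 * D0 / ε * (b + s + t)) = D0 * (η * (b + s + t)) := by field_simp
    rw [h3, hηq] at h2
    linarith
  have hc1 : c₁ = s * ε / 3 := by rw [hs]; field_simp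
  have hc2 : c₂ = t ^ 2 * ε / 3 := by rw [ht2]; field_simp
  have h4 : (η ^ 2 * c₁ + η ^ 3 * c₂) / η = η * s * (ε / 3) + (η * t) ^ 2 * (ε / 3) := by
    rw [hc1, hc2]; field_simp
  have h5 : η * s * (ε / 3) ≤ 1 * (ε / 3) := by gcongr
  have h6 : (η * t) ^ 2 * (ε / 3) ≤ 1 * (ε / 3) := by
    gcongr; exact pow_le_one₀ (by positivity) hηt
  rw [h4]
  linarith

/-- Rate when there is no contraction. -/
lemma exists_rate_sublinear
    (h : ∀ ηl : ℝ, 0 < ηl → b * (K * ηl * ηg) ≤ 1 → Descends P g S K ηl ηg x0 err D0 0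
      (K * ηl * ηg) ((K * ηl * ηg) ^ 2 * c₁ + (K * ηl * ηg) ^ 3 * c₂))
    (h0 : D0 = 0 → err x0 ≤ 0) (R : ℕ) :
    ∃ ηl : ℝ, 0 < ηl ∧ b * (K * ηl * ηg) ≤ 1 ∧ OutputErrorLE P g S K ηl ηg x0 R err
      (b * D0 / (R + 1) + 2 * √(c₁ * D0 / (R + 1))
        + 2 * (c₂ ^ (1 / 3 : ℝ) * D0 ^ (2 / 3 : ℝ) / ((R : ℝ) + 1) ^ (2 / 3 : ℝ))) := by
  have hn : (0 : ℝ) < R + 1 := by positivity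
  rcases hD0.eq_or_lt with hz | hpos
  · obtain ⟨ηl, hηl, hη⟩ := exists_localStep (ηg := ηg) hK hηg (inv_pos.2 hb)
    have hηb : b * (K * ηl * ηg) ≤ 1 := by rw [hη, mul_inv_cancel₀ hb.ne']
    refine ⟨ηl, hηl, hηb, (h ηl hηl hηb).outputErrorLE_initial hg hem hSN R ?_⟩
    exact (h0 hz.symm).trans (by positivity)
  -- The error is x/η + ηc₁ + η²c₂. The values `s` and `t` balance the first term against each of
  -- the others: c₁ = xs² and c₂ = xt³. They need x > 0, whence the separate case above.
  set x := D0 / (R + 1 : ℝ) with hx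
  have hx0 : 0 < x := by positivity
  set s := √(c₁ / x) with hs
  set t := (c₂ / x) ^ (1 / 3 : ℝ) with ht
  have hs0 : 0 ≤ s := Real.sqrt_nonneg _
  have ht0 : 0 ≤ t := by positivity
  have hs2 : c₁ = x * s ^ 2 := by rw [hs, Real.sq_sqrt (by positivity)]; field_simp
  have ht3 : c₂ = x * t ^ 3 := by
    rw [ht, ← Real.rpow_natCast, ← Real.rpow_mul (by positivity)]
    norm_num
    field_simp
  have hq : 0 < b + s + t := by positivity
  obtain ⟨ηl, hηl, hη⟩ := exists_localStep (ηg := ηg) hK hηg (inv_pos.2 hq)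
  set η := (b + s + t)⁻¹ with hηdef
  have hη0 : 0 < η := inv_pos.2 hq
  have hηq : η * (b + s + t) = 1 := inv_mul_cancel₀ hq.ne'
  have hηb : b * η ≤ 1 := by nlinarith [mul_nonneg hη0.le hs0, mul_nonneg hη0.le ht0]
  have hηs : η * s ≤ 1 := by nlinarith [mul_nonneg hη0.le hb.le, mul_nonneg hη0.le ht0]
  have hηt : η * t ≤ 1 := by nlinarith [mul_nonneg hη0.le hb.le, mul_nonneg hη0.le hs0]
  have hdesc := h ηl hηl (by rw [hη]; exact hηb)
  rw [hη] at hdesc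
  refine ⟨ηl, hηl, by rw [hη]; exact hηb, (hdesc.outputErrorLE_uniform hg hem hη0 R).mono ?_⟩
  have hxs : √(c₁ * D0 / (R + 1)) = x * s := by
    rw [show c₁ * D0 / (R + 1 : ℝ) = (x * s) ^ 2 by
      rw [mul_div_assoc, ← hx]; nth_rw 1 [hs2]; ring]
    exact Real.sqrt_sq (by positivity)
  have hxt : c₂ ^ (1 / 3 : ℝ) * D0 ^ (2 / 3 : ℝ) / ((R : ℝ) + 1) ^ (2 / 3 : ℝ) = x * t := by
    rw [mul_div_assoc, ← Real.div_rpow hD0 hn.le, ← hx, ht, Real.div_rpow hc₂ hx0.le]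
    have h1 : x ^ (2 / 3 : ℝ) * x ^ (1 / 3 : ℝ) = x := by
      rw [← Real.rpow_add hx0]; norm_num
    have h2 : 0 < x ^ (1 / 3 : ℝ) := by positivity
    field_simp
    rw [mul_assoc, h1]
  have h1 : D0 / (η * (R + 1)) = x * (b + s + t) := by
    rw [hηdef, hx]; field_simp
  have h4 : (η ^ 2 * c₁ + η ^ 3 * c₂) / η = x * s * (η * s) + x * t * (η * t) ^ 2 := by
    rw [hs2, ht3]; field_simp
  have h5 : x * s * (η * s) ≤ x * s * 1 := by gcongr
  have h6 : x * t * (η * t) ^ 2 ≤ x * t * 1 := by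
    gcongr; exact pow_le_one₀ (by positivity) hηt
  have h7 : b * D0 / (R + 1 : ℝ) = x * b := by rw [hx]; ring
  rw [hxs, hxt, h1, h4, h7]
  linarith

/-- Number of rounds that suffice under contraction. -/
lemma exists_rounds_linear (hμ : 0 < μ) (hμb : μ ≤ b)
    (h : ∀ ηl : ℝ, 0 < ηl → b * (K * ηl * ηg) ≤ 1 → Descends P g S K ηl ηg x0 err D0
      (μ * (K * ηl * ηg) / 2)
      (K * ηl * ηg) ((K * ηl * ηg) ^ 2 * c₁ + (K * ηl * ηg) ^ 3 * c₂)) {ε : ℝ} (hε : 0 < ε) :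
    ∃ (R : ℕ) (ηl : ℝ), (R : ℝ) ≤
      2 * (1 + Real.log (1 + μ * D0 / ε)) * ((b + 5 * c₁ / ε + √(5 * c₂ / ε)) / μ) + 1 ∧ 0 < ηl ∧
      b * (K * ηl * ηg) ≤ 1 ∧ OutputErrorLE P g S K ηl ηg x0 R err ε := by
  -- Each noise term gets ε/5, which leaves 3ε/5 for the initial distance.
  set s := 5 * c₁ / ε with hs
  set t := √(5 * c₂ / ε) with ht
  have hs0 : 0 ≤ s := by positivity
  have ht0 : 0 ≤ t := Real.sqrt_nonneg _
  have ht2 : t ^ 2 = 5 * c₂ / ε := Real.sq_sqrt (by positivity)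
  have hq : 0 < b + s + t := by positivity
  obtain ⟨ηl, hηl, hη⟩ := exists_localStep (ηg := ηg) hK hηg (inv_pos.2 hq)
  set η := (b + s + t)⁻¹
  have hη0 : 0 < η := inv_pos.2 hq
  have hηq : η * (b + s + t) = 1 := inv_mul_cancel₀ hq.ne'
  have hηb : b * η ≤ 1 := by nlinarith [mul_nonneg hη0.le hs0, mul_nonneg hη0.le ht0]
  have hηs : η * s ≤ 1 := by nlinarith [mul_nonneg hη0.le hb.le, mul_nonneg hη0.le ht0]
  have hηt : η * t ≤ 1 := by nlinarith [mul_nonneg hη0.le hb.le, mul_nonneg hη0.le hs0]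
  have hμη : μ * η ≤ 1 := (mul_le_mul_of_nonneg_right hμb hη0.le).trans hηb
  have hdesc := h ηl hηl (by rw [hη]; exact hηb)
  rw [hη] at hdesc
  have hz1 : 1 ≤ 1 + μ * D0 / ε := by
    have : 0 ≤ μ * D0 / ε := by positivity
    linarith
  have hlog := Real.log_nonneg hz1
  set L := 1 + Real.log (1 + μ * D0 / ε) with hL
  have hR := Nat.le_ceil (2 * L * ((b + s + t) / μ))
  refine ⟨⌈2 * L * ((b + s + t) / μ)⌉₊, ηl, (Nat.ceil_lt_add_one (by positivity)).le, hηl,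
    by rw [hη]; exact hηb, ?_⟩
  set R : ℕ := ⌈2 * L * ((b + s + t) / μ)⌉₊
  have haR : L ≤ μ * η / 2 * R := by
    have h2 := mul_le_mul_of_nonneg_left hR (by positivity : 0 ≤ μ * η / 2)
    have h3 : μ * η / 2 * (2 * L * ((b + s + t) / μ)) = L * (η * (b + s + t)) := by field_simp
    rw [h3, hηq] at h2
    linarith
  refine (hdesc.outputErrorLE_exponential hg hem hη0 R (by positivity) (by linarith)
    (by linarith) hD0).mono ?_
  -- The summand 1 in `L` supplies e^{-1} ≤ 0.37, needed to offset the factor 3/2 of the exponential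
  -- average: 1.5 · 0.37 ≤ 0.6.
  have hexp : Real.exp (-(μ * η / 2 * R)) ≤ 0.37 / (1 + μ * D0 / ε) := by
    calc Real.exp (-(μ * η / 2 * R)) ≤ Real.exp (-1 + -Real.log (1 + μ * D0 / ε)) := by
          rw [Real.exp_le_exp]; linarith
      _ = Real.exp (-1) * (1 + μ * D0 / ε)⁻¹ := by
          rw [Real.exp_add, Real.exp_neg (Real.log _), Real.exp_log (by linarith)]
      _ ≤ 0.37 * (1 + μ * D0 / ε)⁻¹ := by
          have := Real.exp_neg_one_lt_d9
          gcongr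
          linarith
      _ = _ := (div_eq_mul_inv _ _).symm
  have h1 : 3 * (μ * η / 2 / η) * D0 * Real.exp (-(μ * η / 2 * R)) ≤ 0.6 * ε := by
    have h2 : μ * D0 ≤ ε * (1 + μ * D0 / ε) := by
      have : ε * (1 + μ * D0 / ε) = ε + μ * D0 := by field_simp
      linarith
    calc 3 * (μ * η / 2 / η) * D0 * Real.exp (-(μ * η / 2 * R))
        = 3 / 2 * (μ * D0 * Real.exp (-(μ * η / 2 * R))) := by field_simp
      _ ≤ 3 / 2 * (ε * (1 + μ * D0 / ε) * (0.37 / (1 + μ * D0 / ε))) := by gcongr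
      _ = 0.555 * ε := by field_simp; norm_num
      _ ≤ 0.6 * ε := by gcongr; norm_num
  have hc1 : c₁ = s * ε / 5 := by rw [hs]; field_simp
  have hc2 : c₂ = t ^ 2 * ε / 5 := by rw [ht2]; field_simp
  have h4 : (η ^ 2 * c₁ + η ^ 3 * c₂) / η = η * s * (ε / 5) + (η * t) ^ 2 * (ε / 5) := by
    rw [hc1, hc2]; field_simp
  have h5 : η * s * (ε / 5) ≤ 1 * (ε / 5) := by gcongr
  have h6 : (η * t) ^ 2 * (ε / 5) ≤ 1 * (ε / 5) := by
    gcongr; exact pow_le_one₀ (by positivity) hηt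
  rw [h4]
  linarith

/-- Rate under contraction; `τ₁`, `τ₂` are the variance and drift terms. -/
lemma exists_rate_linear (hμ : 0 < μ) (hμb : μ ≤ b)
    (h : ∀ ηl : ℝ, 0 < ηl → b * (K * ηl * ηg) ≤ 1 → Descends P g S K ηl ηg x0 err D0
      (μ * (K * ηl * ηg) / 2)
      (K * ηl * ηg) ((K * ηl * ηg) ^ 2 * c₁ + (K * ηl * ηg) ^ 3 * c₂))
    {τ₁ τ₂ : ℝ} (hτ₁ : 0 ≤ τ₁) (hτ₂ : 0 ≤ τ₂) {R : ℕ} (hR : b / μ ≤ R)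
    (h₁ : c₁ = 6 * (μ * R * τ₁)) (h₂ : c₂ = 11 * (μ ^ 2 * R ^ 2 * τ₂)) :
    ∃ ηl : ℝ, 0 < ηl ∧ b * (K * ηl * ηg) ≤ 1 ∧ OutputErrorLE P g S K ηl ηg x0 R err
      (12 * ((1 + Real.log (1 + μ * D0 / (τ₁ + τ₂))) * τ₁)
        + 46 * ((1 + Real.log (1 + μ * D0 / (τ₁ + τ₂))) ^ 2 * τ₂) + 2 * τ₁
        + 2 * (μ * D0 * Real.exp (-(μ / (2 * b) * R)))) := by
  have hbR : b ≤ μ * R := by rwa [div_le_iff₀' hμ] at hR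
  have hR0 : (0 : ℝ) < R := by
    by_contra hcon
    have : (R : ℝ) = 0 := le_antisymm (not_lt.1 hcon) (Nat.cast_nonneg R)
    rw [this] at hbR
    linarith
  have hz0 : 0 ≤ μ * D0 / (τ₁ + τ₂) := by positivity
  have hlog := Real.log_nonneg (by linarith : 1 ≤ 1 + μ * D0 / (τ₁ + τ₂))
  set L := 1 + Real.log (1 + μ * D0 / (τ₁ + τ₂)) with hL
  have hL1 : 1 ≤ L := by linarith
  have hE0 := Real.exp_pos (-(μ / (2 * b) * R))
  have hμD : 0 ≤ μ * D0 := by positivity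
  -- What both choices of step share: η ≤ 2L/(μR) bounds the noise by 12Lτ₁ + 44L²τ₂. Only the decay
  -- of the initial distance depends on the choice, and it may add 2L²τ₂ + 2τ₁.
  have bound : ∀ η : ℝ, 0 < η → b * η ≤ 1 → η ≤ 2 * L / (μ * R) → 1 / 2 ≤ μ * η / 2 * R →
      3 / 2 * (μ * D0 * Real.exp (-(μ * η / 2 * R))) ≤
        2 * L ^ 2 * τ₂ + 2 * τ₁ + 2 * (μ * D0 * Real.exp (-(μ / (2 * b) * R))) →
      ∃ ηl : ℝ, 0 < ηl ∧ b * (K * ηl * ηg) ≤ 1 ∧ OutputErrorLE P g S K ηl ηg x0 R err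
      (12 * (L * τ₁) + 46 * (L ^ 2 * τ₂) + 2 * τ₁
        + 2 * (μ * D0 * Real.exp (-(μ / (2 * b) * R)))) := by
    intro η hη0 hηb hηL haR hexp
    obtain ⟨ηl, hηl, hη⟩ := exists_localStep (ηg := ηg) hK hηg hη0
    have hμη : μ * η ≤ 1 := (mul_le_mul_of_nonneg_right hμb hη0.le).trans hηb
    have hdesc := h ηl hηl (by rw [hη]; exact hηb)
    rw [hη] at hdesc
    refine ⟨ηl, hηl, by rw [hη]; exact hηb, (hdesc.outputErrorLE_exponential hg hem hη0 R
      (by positivity) (by linarith) haR hD0).mono ?_⟩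
    have hηR : η * (μ * R) ≤ 2 * L := by rwa [le_div_iff₀ (by positivity)] at hηL
    have h4 : (η ^ 2 * c₁ + η ^ 3 * c₂) / η
        = 6 * (η * (μ * R) * τ₁) + 11 * ((η * (μ * R)) ^ 2 * τ₂) := by
      rw [h₁, h₂]; field_simp
    have h5 : η * (μ * R) * τ₁ ≤ 2 * L * τ₁ := by gcongr
    have h6 : (η * (μ * R)) ^ 2 * τ₂ ≤ (2 * L) ^ 2 * τ₂ := by gcongr
    have h7 : 3 * (μ * η / 2 / η) * D0 * Real.exp (-(μ * η / 2 * R))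
        = 3 / 2 * (μ * D0 * Real.exp (-(μ * η / 2 * R))) := by field_simp
    rw [h4, h7]
    linarith
  have hbmax : b * (1 / b) ≤ 1 := by rw [mul_one_div_cancel hb.ne']
  have hexp1 : μ * (1 / b) / 2 * R = μ / (2 * b) * R := by field_simp
  -- This is where b/μ ≤ R is needed: the largest step must reach the threshold a·R ≥ 1/2.
  have hhalf : 1 / 2 ≤ μ * (1 / b) / 2 * R := by
    rw [show μ * (1 / b) / 2 * R = μ * R / b / 2 by ring]
    have : 1 ≤ μ * R / b := by rwa [one_le_div hb]
    linarith
  have hbig : 3 / 2 * (μ * D0 * Real.exp (-(μ * (1 / b) / 2 * R))) ≤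
      2 * L ^ 2 * τ₂ + 2 * τ₁ + 2 * (μ * D0 * Real.exp (-(μ / (2 * b) * R))) := by
    rw [hexp1]
    have h8 : 0 ≤ μ * D0 * Real.exp (-(μ / (2 * b) * R)) := by positivity
    have h9 : 0 ≤ L ^ 2 * τ₂ := by positivity
    linarith
  -- The step is the smaller of 1/b and 2L/(μR).
  by_cases hcase : 1 / b ≤ 2 * L / (μ * R)
  · exact bound (1 / b) (by positivity) hbmax hcase hhalf hbig
  · rcases (add_nonneg hτ₁ hτ₂).eq_or_lt with hτ | hτ
    -- Without noise nothing is gained by a smaller step. Division by zero makes L = 1 here, so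
    -- 2L/(μR) would not give enough decay.
    · have e1 : τ₁ = 0 := by linarith
      have e2 : τ₂ = 0 := by linarith
      obtain ⟨ηl, hηl, hη⟩ := exists_localStep (ηg := ηg) hK hηg (by positivity : 0 < 1 / b)
      have hdesc := h ηl hηl (by rw [hη]; exact hbmax)
      rw [hη] at hdesc
      have hμη : μ * (1 / b) ≤ 1 := by rw [mul_one_div, div_le_one hb]; exact hμb
      refine ⟨ηl, hηl, by rw [hη]; exact hbmax, (hdesc.outputErrorLE_exponential hg hem
        (by positivity) R (by positivity) (by linarith) hhalf hD0).mono ?_⟩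
      have h7 : 3 * (μ * (1 / b) / 2 / (1 / b)) * D0 * Real.exp (-(μ * (1 / b) / 2 * R))
          = 3 / 2 * (μ * D0 * Real.exp (-(μ * (1 / b) / 2 * R))) := by field_simp
      rw [h7, h₁, h₂, e1, e2]
      rw [e1, e2] at hbig
      simpa using hbig
    -- Now the exponent is exactly `L`, and e^{-L} ≤ 1/(1 + μD0/(τ₁+τ₂)) brings the initial distance
    -- down to the noise level τ₁ + τ₂.
    · have hη0 : 0 < 2 * L / (μ * R) := by positivity
      have hηR : μ * (2 * L / (μ * R)) / 2 * R = L := by field_simp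
      refine bound (2 * L / (μ * R)) hη0 ?_ le_rfl (by rw [hηR]; linarith) ?_
      · have := mul_le_mul_of_nonneg_left (not_le.1 hcase).le hb.le
        linarith
      · rw [hηR]
        have hexp : Real.exp (-L) ≤ 1 * (1 + μ * D0 / (τ₁ + τ₂))⁻¹ := by
          rw [hL, neg_add, Real.exp_add, Real.exp_neg (Real.log _), Real.exp_log (by linarith)]
          gcongr
          exact Real.exp_le_one_iff.2 (by norm_num)
        have h8 : μ * D0 * Real.exp (-L) ≤ τ₁ + τ₂ := by
          calc μ * D0 * Real.exp (-L) ≤ μ * D0 * (1 * (1 + μ * D0 / (τ₁ + τ₂))⁻¹) := by gcongr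
            _ ≤ τ₁ + τ₂ := by
              rw [one_mul, ← div_eq_mul_inv, div_le_iff₀ (by linarith)]
              have : (τ₁ + τ₂) * (1 + μ * D0 / (τ₁ + τ₂)) = τ₁ + τ₂ + μ * D0 := by field_simp
              linarith
        have h9 : τ₂ ≤ L ^ 2 * τ₂ := le_mul_of_one_le_left hτ₂ (one_le_pow₀ hL1)
        have h10 : 0 ≤ μ * D0 * Real.exp (-(μ / (2 * b) * R)) := by positivity
        linarith

end Tuning

/-! ### Convex and non-convex runs -/

section Main

variable {d N S K : ℕ} {Z : Type*} [MeasurableSpace Z] {f : Fin N → Vec d → ℝ}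
  {P : Fin N → Measure Z} [∀ i, IsProbabilityMeasure (P i)] {g : Fin N → Vec d → Z → Vec d}
  {β σ ηl ηg G B μ : ℝ} {x0 : Vec d}

/-- The gradient vanishes at the minimizer, so the quadratic bound there has no linear term. This
makes the errors integrable and settles the case of a start at the minimizer. -/
lemma objective_sub_le (hβ : 0 < β) (hN : 0 < N) (hf : Smooth β f) {xstar : Vec d}
    (hmin : ∀ x, objective f xstar ≤ objective f x) (x : Vec d) :
    objective f x - objective f xstar ≤ β / 2 * ‖x - xstar‖ ^ 2 := by
  have h1 := sq_norm_gradient_le hβ (differentiable_objective hf)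
    (gradient_objective_lipschitz hN hf) hmin xstar
  have h2 : gradient (objective f) xstar = 0 := by
    rw [← norm_eq_zero, ← sq_eq_zero_iff]
    exact le_antisymm (by linarith) (sq_nonneg _)
  have h3 := le_quadratic (differentiable_objective hf) (gradient_objective_lipschitz hN hf) xstar x
  rw [h2, inner_zero_left] at h3
  linarith

variable (hg : StochasticGradient σ f P g) (hf : Smooth β f) (hS : 1 ≤ S) (hSN : S ≤ N)
  (hK : 1 ≤ K) (hβ : 0 < β) (hηg : 1 ≤ ηg) (hB : 1 ≤ B)
include hg hf hS hSN hK hβ hηg hB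

lemma descends_convex (hμ : 0 ≤ μ) (hc : MuConvex μ f) {xstar : Vec d}
    (hmin : ∀ x, objective f xstar ≤ objective f x)
    (hV : RelaxedDissimilarity β G B (objective f xstar) f) (hηl : 0 < ηl)
    (hη : 8 * (1 + B ^ 2) * β * (K * ηl * ηg) ≤ 1) :
    Descends P g S K ηl ηg x0 (fun x => objective f x - objective f xstar) (‖x0 - xstar‖ ^ 2)
      (μ * (K * ηl * ηg) / 2) (K * ηl * ηg)
      ((K * ηl * ηg) ^ 2 * (6 * (sqM N S K σ G ηg / (K * S)))
        + (K * ηl * ηg) ^ 3 * (11 * β * G ^ 2)) :=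
  descends_of_step (φ := fun x => ‖x - xstar‖ ^ 2) (c := β / 2) hg hSN
    ((measurable_id.sub_const xstar).norm.pow_const 2)
    ((differentiable_objective hf).continuous.measurable.sub_const _)
    (fun x => sq_nonneg _) (fun x => sub_nonneg.2 (hmin x))
    (objective_sub_le hβ (by omega) hf hmin)
    (roundStep_convex hg hf hS hSN hK hβ hηl hηg hB hη hμ hc hmin hV)

/-- The factor 4 in the potential turns the decrease η/4·‖∇f‖² into η times the error. -/
lemma descends_nonconvex {fstar : ℝ} (hmin : ∀ x, fstar ≤ objective f x)
    (hV : BoundedDissimilarity G B f) (hηl : 0 < ηl)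
    (hη : 8 * (1 + B ^ 2) * β * (K * ηl * ηg) ≤ 1) :
    Descends P g S K ηl ηg x0 (fun x => ‖gradient (objective f) x‖ ^ 2)
      (4 * (objective f x0 - fstar)) 0 (K * ηl * ηg)
      ((K * ηl * ηg) ^ 2 * (12 * β * (sqM N S K σ G ηg / (K * S)))
        + (K * ηl * ηg) ^ 3 * (12 * β ^ 2 * G ^ 2)) := by
  have hN : 0 < N := by omega
  refine descends_of_step (φ := fun x => 4 * (objective f x - fstar)) (c := β / 2) hg hSN
    (((differentiable_objective hf).continuous.measurable.sub_const _).const_mul 4)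
    ((continuous_gradient_objective hN hf).measurable.norm.pow_const 2)
    (fun x => by linarith [hmin x]) (fun x => sq_nonneg _) (fun x => ?_) fun x => ?_
  · have := sq_norm_gradient_le hβ (differentiable_objective hf)
      (gradient_objective_lipschitz hN hf) hmin x
    linarith
  · obtain ⟨h1, h2⟩ := roundStep_nonconvex hg hf hS hSN hK hβ hηl hηg hB hη hmin hV x
    refine ⟨h1.const_mul 4, ?_⟩
    rw [integral_const_mul]
    linarith

end Main

/-! ### Elementary bounds for the step-sizes and the variance M² -/

section Bounds

variable {N S K : ℕ} {σ G B β ηg ηl : ℝ}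

lemma sqM_nonneg (hS : 1 ≤ S) (hSN : S ≤ N) : 0 ≤ sqM N S K σ G ηg := by
  have hN' : (0 : ℝ) < N := by exact_mod_cast (by omega : 0 < N)
  have h : 0 ≤ 1 - (S : ℝ) / N := by
    rw [sub_nonneg, div_le_one hN']; exact_mod_cast hSN
  rw [sqM]
  positivity

/-- With a global step-size of at least `√S` the local noise is dominated. -/
lemma sqM_div_le (hS : 1 ≤ S) (hK : 1 ≤ K) (hηg : √(S : ℝ) ≤ ηg) :
    sqM N S K σ G ηg / (K * S) ≤ 2 * (σ ^ 2 / (K * S)) + (1 - (S : ℝ) / N) / S * G ^ 2 := by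
  have hK' : (0 : ℝ) < K := by exact_mod_cast hK
  have hS' : (1 : ℝ) ≤ S := by exact_mod_cast hS
  have h1 : 1 ≤ ηg := (Real.one_le_sqrt.2 hS').trans hηg
  have h2 : (S : ℝ) ≤ ηg ^ 2 := (Real.sqrt_le_left (by linarith)).1 hηg
  rw [sqM_div hS hK h1]
  have h3 : σ ^ 2 / (K * ηg ^ 2) ≤ σ ^ 2 / (K * S) := by gcongr
  linarith

lemma localStep_le (hβ : 0 < β) (hK : 1 ≤ K) (hηg : 1 ≤ ηg)
    (hη : 8 * (1 + B ^ 2) * β * (K * ηl * ηg) ≤ 1) :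
    ηl ≤ 1 / (8 * (1 + B ^ 2) * β * K * ηg) := by
  have hK' : (0 : ℝ) < K := by exact_mod_cast hK
  have hηg0 : 0 < ηg := by linarith
  rw [le_div_iff₀ (by positivity)]
  linarith

lemma localStep_le_six (hβ : 0 < β) (hK : 1 ≤ K) (hηg : 1 ≤ ηg)
    (hη : 8 * (1 + B ^ 2) * β * (K * ηl * ηg) ≤ 1) :
    ηl ≤ 1 / ((1 + B ^ 2) * 6 * β * K * ηg) := by
  have hK' : (0 : ℝ) < K := by exact_mod_cast hK
  have hηg0 : 0 < ηg := by linarith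
  refine (localStep_le hβ hK hηg hη).trans ?_
  apply one_div_le_one_div_of_le (by positivity)
  have : 0 ≤ (1 + B ^ 2) * β * K * ηg := by positivity
  linarith

lemma rpow_three_halves {ε : ℝ} (hε : 0 < ε) : ε ^ (3 / 2 : ℝ) = ε * √ε := by
  rw [show (3 / 2 : ℝ) = 1 + 1 / 2 by norm_num, Real.rpow_add hε, Real.rpow_one, Real.sqrt_eq_rpow]

lemma sqrt_sq_mul_div_le {k a ε c : ℝ} (hc : 0 ≤ c) (hk : k ≤ c ^ 2) (ha : 0 ≤ a)
    (hG : 0 ≤ G) (hε : 0 < ε) : √(k * a * G ^ 2 / ε) ≤ c * (√a * G / √ε) := by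
  refine Real.sqrt_le_iff.2 ⟨by positivity, ?_⟩
  rw [mul_pow, div_pow, mul_pow, Real.sq_sqrt ha, Real.sq_sqrt hε.le, ← mul_div_assoc, ← mul_assoc]
  have h : k * a * G ^ 2 ≤ c ^ 2 * a * G ^ 2 := by gcongr
  gcongr

end Bounds

end FedAvg

end

/-! ### Assembly of the six bounds -/

set_option maxHeartbeats 1600000 in
theorem theorem1 :
    ∃ C : ℝ, 0 < C ∧
    ∀ (d N S K : ℕ) (Z : Type*) [MeasurableSpace Z]
      (f : Fin N → FedAvg.Vec d → ℝ) (P : Fin N → Measure Z) [∀ i, IsProbabilityMeasure (P i)]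
      (g : Fin N → FedAvg.Vec d → Z → FedAvg.Vec d) (β σ G B : ℝ) (x0 : FedAvg.Vec d),
      1 ≤ S → S ≤ N → 1 ≤ K → 0 < β → 0 ≤ σ → 0 ≤ G → 1 ≤ B →
      FedAvg.Smooth β f → FedAvg.StochasticGradient σ f P g →
      -- strongly convex
      (∀ (μ : ℝ) (xstar : FedAvg.Vec d), 0 < μ → FedAvg.MuConvex μ f →
        (∀ x, FedAvg.objective f xstar ≤ FedAvg.objective f x) →
        (FedAvg.BoundedDissimilarity G B f ∨
          FedAvg.RelaxedDissimilarity β G B (FedAvg.objective f xstar) f) →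
        (∀ ε > (0 : ℝ), ∀ ηg : ℝ, √(S : ℝ) ≤ ηg →
          ∃ (R : ℕ) (ηl : ℝ),
            (R : ℝ) ≤ C * (1 + Real.log (1 + μ * ‖x0 - xstar‖ ^ 2 / ε)) *
              (σ ^ 2 / (μ * K * S * ε) + (1 - (S : ℝ) / N) * (G ^ 2 / (μ * S * ε))
                + √β * G / (μ * √ε) + B ^ 2 * β / μ) ∧
            0 < ηl ∧ ηl ≤ 1 / ((1 + B ^ 2) * 6 * β * K * ηg) ∧
            FedAvg.OutputErrorLE P g S K ηl ηg x0 R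
              (fun x => FedAvg.objective f x - FedAvg.objective f xstar) ε) ∧
        (∀ (R : ℕ) (ηg : ℝ), 1 ≤ ηg → 8 * (1 + B ^ 2) * β / μ ≤ R →
          ∃ ηl : ℝ, 0 < ηl ∧ ηl ≤ 1 / (8 * (1 + B ^ 2) * β * K * ηg) ∧
            FedAvg.OutputErrorLE P g S K ηl ηg x0 R
              (fun x => FedAvg.objective f x - FedAvg.objective f xstar)
              (let T₁ := FedAvg.sqM N S K σ G ηg / (μ * R * K * S)
               let T₂ := β * G ^ 2 / (μ ^ 2 * R ^ 2)
               let L := 1 + Real.log (1 + μ * ‖x0 - xstar‖ ^ 2 / (T₁ + T₂))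
               C * (L * T₁ + L ^ 2 * T₂
                + μ * ‖x0 - xstar‖ ^ 2 * Real.exp (-(μ / (16 * (1 + B ^ 2) * β)) * R))))) ∧
      -- general convex
      (∀ xstar : FedAvg.Vec d, FedAvg.MuConvex 0 f →
        (∀ x, FedAvg.objective f xstar ≤ FedAvg.objective f x) →
        (FedAvg.BoundedDissimilarity G B f ∨
          FedAvg.RelaxedDissimilarity β G B (FedAvg.objective f xstar) f) →
        (∀ ε > (0 : ℝ), ∀ ηg : ℝ, √(S : ℝ) ≤ ηg →
          ∃ (R : ℕ) (ηl : ℝ),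
            (R : ℝ) ≤ C *
              (σ ^ 2 * ‖x0 - xstar‖ ^ 2 / (K * S * ε ^ 2)
                + (1 - (S : ℝ) / N) * (G ^ 2 * ‖x0 - xstar‖ ^ 2 / (S * ε ^ 2))
                + √β * G * ‖x0 - xstar‖ ^ 2 / ε ^ (3 / 2 : ℝ)
                + B ^ 2 * β * ‖x0 - xstar‖ ^ 2 / ε) ∧
            0 < ηl ∧ ηl ≤ 1 / ((1 + B ^ 2) * 6 * β * K * ηg) ∧
            FedAvg.OutputErrorLE P g S K ηl ηg x0 R
              (fun x => FedAvg.objective f x - FedAvg.objective f xstar) ε) ∧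
        (∀ (R : ℕ) (ηg : ℝ), 1 ≤ ηg → 1 ≤ R →
          ∃ ηl : ℝ, 0 < ηl ∧ ηl ≤ 1 / ((1 + B ^ 2) * 8 * β * K * ηg) ∧
            FedAvg.OutputErrorLE P g S K ηl ηg x0 R
              (fun x => FedAvg.objective f x - FedAvg.objective f xstar)
              (C * (√(FedAvg.sqM N S K σ G ηg) * ‖x0 - xstar‖ / √((R : ℝ) * K * S)
                + ‖x0 - xstar‖ ^ (4 / 3 : ℝ) * (β * G ^ 2) ^ (1 / 3 : ℝ)
                    / ((R : ℝ) + 1) ^ (2 / 3 : ℝ)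
                + B ^ 2 * β * ‖x0 - xstar‖ ^ 2 / R)))) ∧
      -- non-convex
      (∀ fstar : ℝ, (∀ x, fstar ≤ FedAvg.objective f x) → FedAvg.BoundedDissimilarity G B f →
        (∀ ε > (0 : ℝ), ∀ ηg : ℝ, √(S : ℝ) ≤ ηg →
          ∃ (R : ℕ) (ηl : ℝ),
            (R : ℝ) ≤ C *
              (β * σ ^ 2 * (FedAvg.objective f x0 - fstar) / (K * S * ε ^ 2)
                + (1 - (S : ℝ) / N) * (β * G ^ 2 * (FedAvg.objective f x0 - fstar) / (S * ε ^ 2))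
                + β * G * (FedAvg.objective f x0 - fstar) / ε ^ (3 / 2 : ℝ)
                + B ^ 2 * β * (FedAvg.objective f x0 - fstar) / ε) ∧
            0 < ηl ∧ ηl ≤ 1 / ((1 + B ^ 2) * 6 * β * K * ηg) ∧
            FedAvg.OutputErrorLE P g S K ηl ηg x0 R
              (fun x => ‖gradient (FedAvg.objective f) x‖ ^ 2) ε) ∧
        (∀ (R : ℕ) (ηg : ℝ), 1 ≤ ηg → 1 ≤ R →
          ∃ ηl : ℝ, 0 < ηl ∧ ηl ≤ 1 / ((1 + B ^ 2) * 8 * β * K * ηg) ∧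
            FedAvg.OutputErrorLE P g S K ηl ηg x0 R
              (fun x => ‖gradient (FedAvg.objective f) x‖ ^ 2)
              (C * (√(β * FedAvg.sqM N S K σ G ηg) * √(FedAvg.objective f x0 - fstar)
                    / √((R : ℝ) * K * S)
                + (FedAvg.objective f x0 - fstar) ^ (2 / 3 : ℝ) * (β ^ 2 * G ^ 2) ^ (1 / 3 : ℝ)
                    / ((R : ℝ) + 1) ^ (2 / 3 : ℝ)
                + B ^ 2 * β * (FedAvg.objective f x0 - fstar) / R)))) := by
  -- The largest constant that occurs is 864 = 3 · 4 · 72, in the number of rounds for the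
  -- non-convex case.
  refine ⟨1000, by norm_num, ?_⟩
  intro d N S K Z _ f P _ g β σ G B x0 hS hSN hK hβ hσ hG hB hf hg
  have hN : 0 < N := by omega
  have hN' : (0 : ℝ) < N := by exact_mod_cast hN
  have hK' : (0 : ℝ) < K := by exact_mod_cast hK
  have hS1 : (1 : ℝ) ≤ S := by exact_mod_cast hS
  have hS' : (0 : ℝ) < S := by linarith
  have hB2 : 1 ≤ B ^ 2 := one_le_pow₀ hB
  have hb : 0 < 8 * (1 + B ^ 2) * β := by positivity
  have hb16 : 8 * (1 + B ^ 2) * β ≤ 16 * (B ^ 2 * β) := by nlinarith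
  have hSN' : 0 ≤ 1 - (S : ℝ) / N := by
    rw [sub_nonneg, div_le_one hN']; exact_mod_cast hSN
  have hsqM : ∀ ηg, 0 ≤ FedAvg.sqM N S K σ G ηg := fun ηg => FedAvg.sqM_nonneg hS hSN
  have hem : ∀ c, Measurable fun x => FedAvg.objective f x - c := fun c =>
    (FedAvg.differentiable_objective hf).continuous.measurable.sub_const _
  have hsqrtS : ∀ ηg, √(S : ℝ) ≤ ηg → 1 ≤ ηg := fun ηg h => (Real.one_le_sqrt.2 hS1).trans h
  have hrel : ∀ xstar : FedAvg.Vec d, (∀ x, FedAvg.objective f xstar ≤ FedAvg.objective f x) →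
      (FedAvg.BoundedDissimilarity G B f ∨
        FedAvg.RelaxedDissimilarity β G B (FedAvg.objective f xstar) f) →
      FedAvg.RelaxedDissimilarity β G B (FedAvg.objective f xstar) f := fun xstar hmin h =>
    h.elim (fun h => h.relaxed hβ hN hf hmin) id
  refine ⟨fun μ xstar hμ hc hmin hV => ?_, fun xstar hc hmin hV => ?_, fun fstar hmin hV => ?_⟩
  · have hV' := hrel xstar hmin hV
    have herr := FedAvg.objective_sub_le hβ hN hf hmin x0
    set D := ‖x0 - xstar‖ ^ 2 with hD
    have hD0 : 0 ≤ D := sq_nonneg _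
    have hdesc : ∀ ηg, 1 ≤ ηg → ∀ ηl : ℝ, 0 < ηl → 8 * (1 + B ^ 2) * β * (K * ηl * ηg) ≤ 1 →
        FedAvg.Descends P g S K ηl ηg x0 (fun x => FedAvg.objective f x - FedAvg.objective f xstar)
          D (μ * (K * ηl * ηg) / 2) (K * ηl * ηg)
          ((K * ηl * ηg) ^ 2 * (6 * (FedAvg.sqM N S K σ G ηg / (K * S)))
            + (K * ηl * ηg) ^ 3 * (11 * β * G ^ 2)) := fun ηg hηg ηl hηl hη =>
      FedAvg.descends_convex hg hf hS hSN hK hβ hηg hB hμ.le hc hmin hV' hηl hη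
    -- Comparing μ and β needs two distinct points; if D = 0, none is at hand, and the initial model
    -- is already optimal and serves as output.
    have hμβ : D ≠ 0 → μ ≤ β := fun hDne => by
      have hDpos : 0 < D := lt_of_le_of_ne hD0 hDne.symm
      have h1 := FedAvg.sq_norm_le_of_convex (hf ⟨0, hN⟩).2 (hc ⟨0, hN⟩) x0 xstar
      exact le_of_mul_le_mul_right h1 hDpos
    have hβb : β ≤ 8 * (1 + B ^ 2) * β := by nlinarith
    refine ⟨fun ε hε ηg hηgS => ?_, fun R ηg hηg hR => ?_⟩
    · have hηg := hsqrtS ηg hηgS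
      have hηg0 : 0 < ηg := by linarith
      have hlog := Real.log_nonneg (by
        have : 0 ≤ μ * D / ε := by positivity
        linarith : 1 ≤ 1 + μ * D / ε)
      by_cases hDz : D = 0
      · obtain ⟨ηl, hηl, hη⟩ := FedAvg.exists_localStep (ηg := ηg) hK hηg0 (inv_pos.2 hb)
        have hηb : 8 * (1 + B ^ 2) * β * (K * ηl * ηg) ≤ 1 := by rw [hη, mul_inv_cancel₀ hb.ne']
        refine ⟨0, ηl, ?_, hηl, FedAvg.localStep_le_six hβ hK hηg hηb,
          (hdesc ηg hηg ηl hηl hηb).outputErrorLE_initial hg (hem _) hSN 0 ?_⟩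
        · rw [Nat.cast_zero]
          positivity
        · rw [hDz, mul_zero] at herr
          exact herr.trans hε.le
      have hμβ' := hμβ hDz
      obtain ⟨R, ηl, hR, hηl, hηb, hout⟩ := FedAvg.exists_rounds_linear hg (hem _) hSN hK hηg0 hb
        (c₁ := 6 * (FedAvg.sqM N S K σ G ηg / (K * S))) (c₂ := 11 * β * G ^ 2)
        (mul_nonneg (by norm_num) (div_nonneg (hsqM ηg) (by positivity))) (by positivity) hD0 hμ
        (hμβ'.trans hβb) (hdesc ηg hηg) hε
      refine ⟨R, ηl, hR.trans ?_, hηl, FedAvg.localStep_le_six hβ hK hηg hηb, hout⟩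
      set L := 1 + Real.log (1 + μ * D / ε)
      have hL1 : 1 ≤ L := by linarith
      have h1 := FedAvg.sqM_div_le (N := N) (σ := σ) (G := G) hS hK hηgS
      have h2 : √(5 * (11 * β * G ^ 2) / ε) ≤ 8 * (√β * G / √ε) := by
        rw [show 5 * (11 * β * G ^ 2) = 55 * β * G ^ 2 by ring]
        exact FedAvg.sqrt_sq_mul_div_le (by norm_num) (by norm_num) hβ.le hG hε
      set A := σ ^ 2 / (K * S)
      set Gs := (1 - (S : ℝ) / N) / S * G ^ 2
      have e1 : σ ^ 2 / (μ * K * S * ε) = A / ε / μ := by simp only [A]; field_simp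
      have e2 : (1 - (S : ℝ) / N) * (G ^ 2 / (μ * S * ε)) = Gs / ε / μ := by
        simp only [Gs]; field_simp
      have e3 : √β * G / (μ * √ε) = √β * G / √ε / μ := by rw [div_div, mul_comm μ]
      rw [e1, e2, e3, ← add_div, ← add_div, ← add_div]
      have hA : 0 ≤ A / ε := by positivity
      have hGs : 0 ≤ Gs / ε := by positivity
      have hT : 0 ≤ √β * G / √ε := by positivity
      have h3 : 8 * (1 + B ^ 2) * β + 5 * (6 * (FedAvg.sqM N S K σ G ηg / (K * S))) / ε
          + √(5 * (11 * β * G ^ 2) / ε) ≤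
          60 * (A / ε + Gs / ε + √β * G / √ε + B ^ 2 * β) := by
        have h4 : 5 * (6 * (FedAvg.sqM N S K σ G ηg / (K * S))) / ε ≤
            5 * (6 * (2 * A + Gs)) / ε := by gcongr
        have h5 : 5 * (6 * (2 * A + Gs)) / ε = 60 * (A / ε) + 30 * (Gs / ε) := by ring
        have h6 : 0 ≤ B ^ 2 * β := by positivity
        linarith
      -- The additive 1 from rounding up is absorbed because μ ≤ β ≤ B²β.
      have h4 : 1 ≤ L * ((A / ε + Gs / ε + √β * G / √ε + B ^ 2 * β) / μ) := by
        have h5 : 1 ≤ (A / ε + Gs / ε + √β * G / √ε + B ^ 2 * β) / μ := by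
          rw [one_le_div hμ]
          have h6 : 1 * β ≤ B ^ 2 * β := by gcongr
          linarith
        exact one_le_mul_of_one_le_of_one_le hL1 h5
      calc _ ≤ 2 * L * (60 * (A / ε + Gs / ε + √β * G / √ε + B ^ 2 * β) / μ)
            + L * ((A / ε + Gs / ε + √β * G / √ε + B ^ 2 * β) / μ) := by gcongr
        _ = 121 * (L * ((A / ε + Gs / ε + √β * G / √ε + B ^ 2 * β) / μ)) := by ring
        _ ≤ 1000 * (L * ((A / ε + Gs / ε + √β * G / √ε + B ^ 2 * β) / μ)) := by
            gcongr; norm_num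
        _ = _ := by ring
    · have hηg0 : 0 < ηg := by linarith
      have hR0 : (0 : ℝ) < R := lt_of_lt_of_le (by positivity) hR
      simp only
      set T₁ := FedAvg.sqM N S K σ G ηg / (μ * R * K * S) with hT₁
      set T₂ := β * G ^ 2 / (μ ^ 2 * R ^ 2) with hT₂
      have hT₁0 : 0 ≤ T₁ := div_nonneg (hsqM ηg) (by positivity)
      have hT₂0 : 0 ≤ T₂ := by positivity
      have hlog := Real.log_nonneg (by
        have : 0 ≤ μ * D / (T₁ + T₂) := by positivity
        linarith : 1 ≤ 1 + μ * D / (T₁ + T₂))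
      set L := 1 + Real.log (1 + μ * D / (T₁ + T₂)) with hL
      have hL1 : 1 ≤ L := by linarith
      have hexp := Real.exp_pos (-(μ / (16 * (1 + B ^ 2) * β)) * R)
      by_cases hDz : D = 0
      · obtain ⟨ηl, hηl, hη⟩ := FedAvg.exists_localStep (ηg := ηg) hK hηg0 (inv_pos.2 hb)
        have hηb : 8 * (1 + B ^ 2) * β * (K * ηl * ηg) ≤ 1 := by rw [hη, mul_inv_cancel₀ hb.ne']
        refine ⟨ηl, hηl, FedAvg.localStep_le hβ hK hηg hηb,
          (hdesc ηg hηg ηl hηl hηb).outputErrorLE_initial hg (hem _) hSN R ?_⟩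
        rw [hDz, mul_zero] at herr
        exact herr.trans (by positivity)
      obtain ⟨ηl, hηl, hηb, hout⟩ := FedAvg.exists_rate_linear hg (hem _) hSN hK hηg0 hb
        (c₁ := 6 * (FedAvg.sqM N S K σ G ηg / (K * S))) (c₂ := 11 * β * G ^ 2)
        (mul_nonneg (by norm_num) (div_nonneg (hsqM ηg) (by positivity))) (by positivity) hD0 hμ
        ((hμβ hDz).trans hβb) (hdesc ηg hηg) hT₁0 hT₂0 hR
        (by rw [hT₁]; field_simp) (by rw [hT₂]; field_simp)
      refine ⟨ηl, hηl, FedAvg.localStep_le hβ hK hηg hηb, hout.mono ?_⟩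
      rw [show -(μ / (2 * (8 * (1 + B ^ 2) * β)) * (R : ℝ)) = -(μ / (16 * (1 + B ^ 2) * β)) * R by
        rw [← mul_assoc, ← mul_assoc]; norm_num]
      have h1 : 0 ≤ L ^ 2 * T₂ := by positivity
      have h2 : T₁ ≤ L * T₁ := le_mul_of_one_le_left hT₁0 hL1
      have h3 : 0 ≤ μ * D * Real.exp (-(μ / (16 * (1 + B ^ 2) * β)) * R) := by positivity
      linarith
  · have hV' := hrel xstar hmin hV
    have herr := FedAvg.objective_sub_le hβ hN hf hmin x0
    set D := ‖x0 - xstar‖ ^ 2 with hD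
    have hD0 : 0 ≤ D := sq_nonneg _
    have hdesc : ∀ ηg, 1 ≤ ηg → ∀ ηl : ℝ, 0 < ηl → 8 * (1 + B ^ 2) * β * (K * ηl * ηg) ≤ 1 →
        FedAvg.Descends P g S K ηl ηg x0 (fun x => FedAvg.objective f x - FedAvg.objective f xstar)
          D 0 (K * ηl * ηg)
          ((K * ηl * ηg) ^ 2 * (6 * (FedAvg.sqM N S K σ G ηg / (K * S)))
            + (K * ηl * ηg) ^ 3 * (11 * β * G ^ 2)) := fun ηg hηg ηl hηl hη => by
      simpa using FedAvg.descends_convex (x0 := x0) hg hf hS hSN hK hβ hηg hB le_rfl hc hmin hV'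
        hηl hη
    refine ⟨fun ε hε ηg hηgS => ?_, fun R ηg hηg hR => ?_⟩
    · have hηg := hsqrtS ηg hηgS
      have hηg0 : 0 < ηg := by linarith
      obtain ⟨R, ηl, hR, hηl, hηb, hout⟩ := FedAvg.exists_rounds_sublinear hg (hem _) hSN hK hηg0 hb
        (c₁ := 6 * (FedAvg.sqM N S K σ G ηg / (K * S))) (c₂ := 11 * β * G ^ 2)
        (mul_nonneg (by norm_num) (div_nonneg (hsqM ηg) (by positivity))) (by positivity) hD0
        (hdesc ηg hηg) hε
      refine ⟨R, ηl, hR.trans ?_, hηl, FedAvg.localStep_le_six hβ hK hηg hηb, hout⟩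
      have h1 := FedAvg.sqM_div_le (N := N) (σ := σ) (G := G) hS hK hηgS
      have h2 : √(3 * (11 * β * G ^ 2) / ε) ≤ 8 * (√β * G / √ε) := by
        rw [show 3 * (11 * β * G ^ 2) = 33 * β * G ^ 2 by ring]
        exact FedAvg.sqrt_sq_mul_div_le (by norm_num) (by norm_num) hβ.le hG hε
      set A := σ ^ 2 / (K * S)
      set Gs := (1 - (S : ℝ) / N) / S * G ^ 2
      have e1 : σ ^ 2 * D / (K * S * ε ^ 2) = D / ε * (A / ε) := by simp only [A]; field_simp
      have e2 : (1 - (S : ℝ) / N) * (G ^ 2 * D / (S * ε ^ 2)) = D / ε * (Gs / ε) := by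
        simp only [Gs]; field_simp
      have e3 : √β * G * D / ε ^ (3 / 2 : ℝ) = D / ε * (√β * G / √ε) := by
        rw [FedAvg.rpow_three_halves hε]; field_simp
      have e4 : B ^ 2 * β * D / ε = D / ε * (B ^ 2 * β) := by ring
      rw [e1, e2, e3, e4, ← mul_add, ← mul_add, ← mul_add]
      have hA : 0 ≤ A / ε := by positivity
      have hGs : 0 ≤ Gs / ε := by positivity
      have hT : 0 ≤ √β * G / √ε := by positivity
      have h3 : 8 * (1 + B ^ 2) * β + 3 * (6 * (FedAvg.sqM N S K σ G ηg / (K * S))) / ε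
          + √(3 * (11 * β * G ^ 2) / ε) ≤
          60 * (A / ε + Gs / ε + √β * G / √ε + B ^ 2 * β) := by
        have h4 : 3 * (6 * (FedAvg.sqM N S K σ G ηg / (K * S))) / ε ≤
            3 * (6 * (2 * A + Gs)) / ε := by gcongr
        have h5 : 3 * (6 * (2 * A + Gs)) / ε = 36 * (A / ε) + 18 * (Gs / ε) := by ring
        have h6 : 0 ≤ B ^ 2 * β := by positivity
        linarith
      calc _ ≤ 3 * D / ε * (60 * (A / ε + Gs / ε + √β * G / √ε + B ^ 2 * β)) := by gcongr
        _ = 180 * (D / ε * (A / ε + Gs / ε + √β * G / √ε + B ^ 2 * β)) := by ring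
        _ ≤ _ := by gcongr; norm_num
    · have hηg0 : 0 < ηg := by linarith
      have hR0 : (0 : ℝ) < R := by exact_mod_cast hR
      obtain ⟨ηl, hηl, hηb, hout⟩ := FedAvg.exists_rate_sublinear hg (hem _) hSN hK hηg0 hb
        (c₁ := 6 * (FedAvg.sqM N S K σ G ηg / (K * S))) (c₂ := 11 * β * G ^ 2)
        (mul_nonneg (by norm_num) (div_nonneg (hsqM ηg) (by positivity))) (by positivity) hD0
        (hdesc ηg hηg) (fun hz => by rw [hz, mul_zero] at herr; exact herr) R
      refine ⟨ηl, hηl, ?_, hout.mono ?_⟩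
      · rw [mul_comm (1 + B ^ 2) 8]
        exact FedAvg.localStep_le hβ hK hηg hηb
      have hM := hsqM ηg
      set M := FedAvg.sqM N S K σ G ηg
      have h1 : 8 * (1 + B ^ 2) * β * D / (R + 1) ≤ 16 * (B ^ 2 * β * D / R) := by
        calc _ ≤ 16 * (B ^ 2 * β) * D / R := by gcongr; linarith
          _ = _ := by ring
      have h2 : √(6 * (M / (K * S)) * D / (R + 1)) ≤ 3 * (√M * ‖x0 - xstar‖ / √((R : ℝ) * K * S)) := by
        refine Real.sqrt_le_iff.2 ⟨by positivity, ?_⟩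
        rw [mul_pow, div_pow, mul_pow, Real.sq_sqrt hM, Real.sq_sqrt (by positivity), ← hD]
        calc 6 * (M / (K * S)) * D / (R + 1) ≤ 9 * (M / (K * S)) * D / R := by
              gcongr
              · norm_num
              · linarith
          _ = _ := by field_simp; norm_num; ring
      have h3 : (11 * β * G ^ 2) ^ (1 / 3 : ℝ) * D ^ (2 / 3 : ℝ) / ((R : ℝ) + 1) ^ (2 / 3 : ℝ) ≤
          11 * (‖x0 - xstar‖ ^ (4 / 3 : ℝ) * (β * G ^ 2) ^ (1 / 3 : ℝ)
            / ((R : ℝ) + 1) ^ (2 / 3 : ℝ)) := by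
        have h4 : (11 : ℝ) ^ (1 / 3 : ℝ) ≤ 11 := by
          calc (11 : ℝ) ^ (1 / 3 : ℝ) ≤ 11 ^ (1 : ℝ) :=
                Real.rpow_le_rpow_of_exponent_le (by norm_num) (by norm_num)
            _ = 11 := Real.rpow_one _
        have h5 : D ^ (2 / 3 : ℝ) = ‖x0 - xstar‖ ^ (4 / 3 : ℝ) := by
          rw [hD, ← Real.rpow_natCast, ← Real.rpow_mul (norm_nonneg _)]; norm_num
        rw [mul_assoc 11 β, Real.mul_rpow (by norm_num) (by positivity), h5]
        calc _ ≤ 11 * (β * G ^ 2) ^ (1 / 3 : ℝ) * ‖x0 - xstar‖ ^ (4 / 3 : ℝ)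
              / ((R : ℝ) + 1) ^ (2 / 3 : ℝ) := by gcongr
          _ = _ := by ring
      have h4 : 0 ≤ B ^ 2 * β * D / R := by positivity
      have h5 : 0 ≤ √M * ‖x0 - xstar‖ / √((R : ℝ) * K * S) := by positivity
      have h6 : 0 ≤ ‖x0 - xstar‖ ^ (4 / 3 : ℝ) * (β * G ^ 2) ^ (1 / 3 : ℝ)
            / ((R : ℝ) + 1) ^ (2 / 3 : ℝ) := by positivity
      linarith
  · have hgm : Measurable fun x => ‖gradient (FedAvg.objective f) x‖ ^ 2 :=
      (FedAvg.continuous_gradient_objective hN hf).measurable.norm.pow_const 2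
    have herr := FedAvg.sq_norm_gradient_le hβ (FedAvg.differentiable_objective hf)
      (FedAvg.gradient_objective_lipschitz hN hf) hmin x0
    have hF0 : 0 ≤ FedAvg.objective f x0 - fstar := sub_nonneg.2 (hmin x0)
    have hdesc : ∀ ηg, 1 ≤ ηg → ∀ ηl : ℝ, 0 < ηl → 8 * (1 + B ^ 2) * β * (K * ηl * ηg) ≤ 1 →
        FedAvg.Descends P g S K ηl ηg x0 (fun x => ‖gradient (FedAvg.objective f) x‖ ^ 2)
          (4 * (FedAvg.objective f x0 - fstar)) 0 (K * ηl * ηg)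
          ((K * ηl * ηg) ^ 2 * (12 * β * (FedAvg.sqM N S K σ G ηg / (K * S)))
            + (K * ηl * ηg) ^ 3 * (12 * β ^ 2 * G ^ 2)) := fun ηg hηg ηl hηl hη =>
      FedAvg.descends_nonconvex hg hf hS hSN hK hβ hηg hB hmin hV hηl hη
    set F := FedAvg.objective f x0 - fstar
    refine ⟨fun ε hε ηg hηgS => ?_, fun R ηg hηg hR => ?_⟩
    · have hηg := hsqrtS ηg hηgS
      have hηg0 : 0 < ηg := by linarith
      obtain ⟨R, ηl, hR, hηl, hηb, hout⟩ := FedAvg.exists_rounds_sublinear hg hgm hSN hK hηg0 hb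
        (c₁ := 12 * β * (FedAvg.sqM N S K σ G ηg / (K * S))) (c₂ := 12 * β ^ 2 * G ^ 2)
        (mul_nonneg (by positivity) (div_nonneg (hsqM ηg) (by positivity))) (by positivity)
        (by positivity) (hdesc ηg hηg) hε
      refine ⟨R, ηl, hR.trans ?_, hηl, FedAvg.localStep_le_six hβ hK hηg hηb, hout⟩
      have h1 := FedAvg.sqM_div_le (N := N) (σ := σ) (G := G) hS hK hηgS
      have h2 : √(3 * (12 * β ^ 2 * G ^ 2) / ε) ≤ 6 * (β * G / √ε) := by
        rw [show 3 * (12 * β ^ 2 * G ^ 2) = 36 * β ^ 2 * G ^ 2 by ring]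
        have := FedAvg.sqrt_sq_mul_div_le (k := 36) (c := 6) (by norm_num) (by norm_num)
          (sq_nonneg β) hG hε
        rwa [Real.sqrt_sq hβ.le] at this
      set A := σ ^ 2 / (K * S)
      set Gs := (1 - (S : ℝ) / N) / S * G ^ 2
      have e1 : β * σ ^ 2 * F / (K * S * ε ^ 2) = F / ε * (β * A / ε) := by
        simp only [A]; field_simp
      have e2 : (1 - (S : ℝ) / N) * (β * G ^ 2 * F / (S * ε ^ 2)) = F / ε * (β * Gs / ε) := by
        simp only [Gs]; field_simp
      have e3 : β * G * F / ε ^ (3 / 2 : ℝ) = F / ε * (β * G / √ε) := by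
        rw [FedAvg.rpow_three_halves hε]; field_simp
      have e4 : B ^ 2 * β * F / ε = F / ε * (B ^ 2 * β) := by ring
      rw [e1, e2, e3, e4, ← mul_add, ← mul_add, ← mul_add]
      have hA : 0 ≤ β * A / ε := by positivity
      have hGs : 0 ≤ β * Gs / ε := by positivity
      have hT : 0 ≤ β * G / √ε := by positivity
      have h3 : 8 * (1 + B ^ 2) * β + 3 * (12 * β * (FedAvg.sqM N S K σ G ηg / (K * S))) / ε
          + √(3 * (12 * β ^ 2 * G ^ 2) / ε) ≤
          72 * (β * A / ε + β * Gs / ε + β * G / √ε + B ^ 2 * β) := by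
        have h4 : 3 * (12 * β * (FedAvg.sqM N S K σ G ηg / (K * S))) / ε ≤
            3 * (12 * β * (2 * A + Gs)) / ε := by gcongr
        have h5 : 3 * (12 * β * (2 * A + Gs)) / ε = 72 * (β * A / ε) + 36 * (β * Gs / ε) := by ring
        have h6 : 0 ≤ B ^ 2 * β := by positivity
        linarith
      calc _ ≤ 3 * (4 * F) / ε * (72 * (β * A / ε + β * Gs / ε + β * G / √ε + B ^ 2 * β)) := by
            gcongr
        _ = 864 * (F / ε * (β * A / ε + β * Gs / ε + β * G / √ε + B ^ 2 * β)) := by ring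
        _ ≤ _ := by gcongr; norm_num
    · have hηg0 : 0 < ηg := by linarith
      have hR0 : (0 : ℝ) < R := by exact_mod_cast hR
      obtain ⟨ηl, hηl, hηb, hout⟩ := FedAvg.exists_rate_sublinear hg hgm hSN hK hηg0 hb
        (c₁ := 12 * β * (FedAvg.sqM N S K σ G ηg / (K * S))) (c₂ := 12 * β ^ 2 * G ^ 2)
        (mul_nonneg (by positivity) (div_nonneg (hsqM ηg) (by positivity))) (by positivity)
        (by positivity) (hdesc ηg hηg) (fun hz => by nlinarith) R
      refine ⟨ηl, hηl, ?_, hout.mono ?_⟩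
      · rw [mul_comm (1 + B ^ 2) 8]
        exact FedAvg.localStep_le hβ hK hηg hηb
      have hM := hsqM ηg
      set M := FedAvg.sqM N S K σ G ηg
      have h1 : 8 * (1 + B ^ 2) * β * (4 * F) / (R + 1) ≤ 64 * (B ^ 2 * β * F / R) := by
        calc _ ≤ 16 * (B ^ 2 * β) * (4 * F) / R := by gcongr; linarith
          _ = _ := by ring
      have h2 : √(12 * β * (M / (K * S)) * (4 * F) / (R + 1)) ≤
          7 * (√(β * M) * √F / √((R : ℝ) * K * S)) := by
        refine Real.sqrt_le_iff.2 ⟨by positivity, ?_⟩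
        rw [mul_pow, div_pow, mul_pow, Real.sq_sqrt (by positivity), Real.sq_sqrt hF0,
          Real.sq_sqrt (by positivity)]
        calc 12 * β * (M / (K * S)) * (4 * F) / (R + 1) = 48 * β * (M / (K * S)) * F / (R + 1) := by
              ring
          _ ≤ 49 * β * (M / (K * S)) * F / R := by
              gcongr
              · norm_num
              · linarith
          _ = _ := by field_simp; norm_num; ring
      have h3 : (12 * β ^ 2 * G ^ 2) ^ (1 / 3 : ℝ) * (4 * F) ^ (2 / 3 : ℝ)
            / ((R : ℝ) + 1) ^ (2 / 3 : ℝ) ≤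
          48 * (F ^ (2 / 3 : ℝ) * (β ^ 2 * G ^ 2) ^ (1 / 3 : ℝ)
            / ((R : ℝ) + 1) ^ (2 / 3 : ℝ)) := by
        have h4 : (12 : ℝ) ^ (1 / 3 : ℝ) ≤ 12 := by
          calc (12 : ℝ) ^ (1 / 3 : ℝ) ≤ 12 ^ (1 : ℝ) :=
                Real.rpow_le_rpow_of_exponent_le (by norm_num) (by norm_num)
            _ = 12 := Real.rpow_one _
        have h5 : (4 : ℝ) ^ (2 / 3 : ℝ) ≤ 4 := by
          calc (4 : ℝ) ^ (2 / 3 : ℝ) ≤ 4 ^ (1 : ℝ) :=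
                Real.rpow_le_rpow_of_exponent_le (by norm_num) (by norm_num)
            _ = 4 := Real.rpow_one _
        rw [mul_assoc 12 (β ^ 2), Real.mul_rpow (by norm_num) (by positivity),
          Real.mul_rpow (by norm_num) hF0]
        calc _ ≤ 12 * (β ^ 2 * G ^ 2) ^ (1 / 3 : ℝ) * (4 * F ^ (2 / 3 : ℝ))
              / ((R : ℝ) + 1) ^ (2 / 3 : ℝ) := by gcongr
          _ = _ := by ring
      have h4 : 0 ≤ B ^ 2 * β * F / R := by positivity
      have h5 : 0 ≤ √(β * M) * √F / √((R : ℝ) * K * S) := by positivity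
      have h6 : 0 ≤ F ^ (2 / 3 : ℝ) * (β ^ 2 * G ^ 2) ^ (1 / 3 : ℝ)
            / ((R : ℝ) + 1) ^ (2 / 3 : ℝ) := by positivity
      linarith
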